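/- Let $\mathsf H_n=\sum_{j=1}^n\frac1j$. For a complex number $z$ and a finite sequence of complex numbers define the generalized polylogarithms recursively by $G(\,;z)=1$, $G(\underbrace{0,\dots,0}_n;z)=\frac{\log^n z}{n!}$, and $$G(\alpha_1,\dots,\alpha_n;z)=\int_0^z\frac{dx}{x-\alpha_1}\,G(\alpha_2,\dots,\alpha_n;x)\qquad\text{if }(\alpha_1,\dots,\alpha_n)\neq(0,\dots,0),$$ the integral being along the straight line segment from $0$ to $z$. For $a_1,\dots,a_n\in\mathbb Z_{>0}$ and $z_1\cdots z_n\neq0$ let $$\mathrm{Li}_{a_1,\dots,a_n}(z_1,\dots,z_n)=(-1)^nG\Big(\underbrace{0,\dots,0}_{a_1-1},\tfrac1{z_1},\underbrace{0,\dots,0}_{a_2-1},\tfrac1{z_1z_2},\dots,\underbrace{0,\dots,0}_{a_n-1},\tfrac1{z_1\cdots z_n};1\Big),$$ the analytic continuation of the series $\sum_{\ell_1>\dots>\ell_n>0}\prod_{j=1}^n z_j^{\ell_j}/\ell_j^{a_j}$. For positive integers $w,N$ let $\mathfrak Z_w(N)\subset\mathbb C$ be the $\mathbb Q$-vector space spanned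 by the cyclotomic multiple zeta values of weight $w$ and level $N$, that is, by all $\mathrm{Li}_{a_1,\dots,a_n}(z_1,\dots,z_n)$ with $a_1,\dots,a_n\in\mathbb Z_{>0}$, $a_1+\dots+a_n=w$, $z_1^N=\dots=z_n^N=1$ and $(a_1,z_1)\neq(1,1)$. Set $$\mathsf S_{6,r}(a_k;z)=\sum_{k=1}^\infty\frac{a_k\binom{2k}{k}z^k}{k^{r+1}\binom{3k}{k}\binom{6k}{3k}}.$$ Then for every integer $r\ge1$ all the series below converge absolutely, and the following hold. (a) $\mathsf S_{6,r}(a_k;2^3)\in\mathfrak Z_{r+2}(8)$ when $(a_k)_{k\ge1}$ is one of the sequences $\frac1k$, $\;-\mathsf H_k+2\mathsf H_{2k}+\mathsf H_{3k}-2\mathsf H_{6k}$, $\;\mathsf H_{2k-1}+\mathsf H_{3k}-2\mathsf H_{6k}$. (b) $\mathsf S_{6,r}(a_k;2^23^3)\in\mathfrak Z_{r+2}(12)$ when $(a_k)_{k\ge1}$ is one of the sequences $\frac1k$, $\;\mathsf H_{3k}-2\mathsf H_{6k}$, $\;\mathsf H_{2k}$, $\;\mathsf H_k$. -/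

import Mathlib

/-- Generalized polylogarithm `G(α₁,…,αₙ; z)`: `G(;z) = 1`, `G(0,…,0;z) = (log z)ⁿ / n!`, and
otherwise `G(α₁,…,αₙ;z) = ∫₀ᶻ G(α₂,…,αₙ;x) dx / (x - α₁)` along the segment `x = t z`,
`0 ≤ t ≤ 1`. -/
noncomputable def GPL : List ℂ → ℂ → ℂ
  | [], _ => 1
  | α :: αs, z =>
    open Classical in
    if ∀ β ∈ α :: αs, β = 0 then
      Complex.log z ^ (αs.length + 1) / ((αs.length + 1).factorial : ℂ)
    else
      ∫ t in (0 : ℝ)..1, z / ((t : ℂ) * z - α) * GPL αs ((t : ℂ) * z)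

/-- The word of the iterated integral of `Li_{a₁,…,aₙ}(z₁,…,zₙ)`, given by the list of pairs
`(aⱼ, zⱼ)`: for every `j` in turn, `aⱼ - 1` zeros followed by `1 / (P z₁ ⋯ zⱼ)`.
The parameter `P` accumulates the product and starts at `1`. -/
noncomputable def mplWord : ℂ → List (ℕ × ℂ) → List ℂ
  | _, [] => []
  | P, (a, z) :: s => List.replicate (a - 1) 0 ++ 1 / (P * z) :: mplWord (P * z) s

/-- Multiple polylogarithm `Li_{a₁,…,aₙ}(z₁,…,zₙ)`, the analytic continuation of
`∑_{ℓ₁ > ⋯ > ℓₙ > 0} ∏ⱼ zⱼ ^ ℓⱼ / ℓⱼ ^ aⱼ` through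
`(-1)ⁿ G(0,…,0, 1/z₁, 0,…,0, 1/(z₁z₂), …, 0,…,0, 1/(z₁⋯zₙ); 1)`. -/
noncomputable def MPL (s : List (ℕ × ℂ)) : ℂ :=
  (-1) ^ s.length * GPL (mplWord 1 s) 1

/-- The `ℚ`-vector space spanned by the cyclotomic multiple zeta values of weight `w` and
level `N`: the `Li_{a₁,…,aₙ}(z₁,…,zₙ)` with positive `aⱼ`, `zⱼ ^ N = 1`,
`(a₁, z₁) ≠ (1, 1)` and `a₁ + ⋯ + aₙ = w`. -/
noncomputable def CMZV (w N : ℕ) : Submodule ℚ ℂ :=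
  Submodule.span ℚ {x : ℂ | ∃ s : List (ℕ × ℂ),
    (∀ p ∈ s, 0 < p.1 ∧ p.2 ^ N = 1) ∧
    s.head? ≠ some (1, 1) ∧
    (s.map Prod.fst).sum = w ∧
    x = MPL s}

/-- The harmonic number `H_n = ∑_{j=1}^n 1/j` as a real number. -/
noncomputable def Hn (n : ℕ) : ℝ := (harmonic n : ℝ)

/-- The `k`-th term (`k ≥ 1`) of the series `S_{6,r}(a_k; z)`. -/
noncomputable def S6Term (a : ℕ → ℝ) (r : ℕ) (z : ℝ) (k : ℕ) : ℝ :=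
  a k * ((2 * k).choose k : ℝ) * z ^ k /
    ((k : ℝ) ^ (r + 1) * ((3 * k).choose k : ℝ) * ((6 * k).choose (3 * k) : ℝ))

/-- `S_{6,r}(a_k; z) = ∑_{k=1}^∞ a_k binom(2k,k) z^k / (k^{r+1} binom(3k,k) binom(6k,3k))`. -/
noncomputable def S6 (a : ℕ → ℝ) (r : ℕ) (z : ℝ) : ℝ :=
  ∑' k : ℕ, S6Term a r z (k + 1)

/-! The coefficient `binom(2k,k) / (k binom(3k,k) binom(6k,3k))` is `4 · 16^{-k} ∫₀¹ u^{2k}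
(1-u²)^{2k-1} du` (`betaVal_eq_binomCoef`). Summing under the integral sign (`S6_eq_integral`) gives
`S = 4 ∫₀¹ f(X) g(u) du/(1-u²)` with `X = (z/16) u² (1-u²)²`, where `f` is a power series `∑ h_k X^k
/ k^r`. Replacing `g = 1` by `log u²` or by `log(1-u²) - 2 log 2` differentiates the Beta function
in its parameters and so produces the combinations of harmonic numbers (`betaInt_log_sq`,
`betaInt_log_one_sub_sq`); `H_k` itself is put into `h_k`. Since `f` arises from `log(1-X)` by
repeated integration against `dX/X` (and once against `dX/(X(1-X))` for `h = H`), everything is an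
iterated integral, and it remains to find coordinates in which all forms have their poles at `0` and
at roots of unity.

For `z = 8` one has `1-X = (1-u²/2)(1+u⁴)`. The second factor is cyclotomic of level 8 in `u`, the
first one only after `u = 2p/(1+p²)`, which makes it `(1+p⁴)/(1+p²)²`. The forms `dX/X` and
`du/(1-u²)` and the logarithms in `g` are cyclotomic in both coordinates, and integration is linear;
so `log(1-X)` is split into a function of `p` plus a function of `u`, and the two summands are
integrated separately (`polyClass_of_arcs`, `kernelPath_dbl`). For `z = 108` the substitution `u =
(2/√3) sin θ` gives `X = sin² 3θ`, and every form, including `dX/(1-X)`, is cyclotomic of level 12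
in `q = exp(iθ)`. The path from `1` to `exp(iπ/3)` meets the letter `exp(iπ/6)`, where `X = 1`, so
it is cut there (`kernelPath_sinSub`).

The analytic core is the identification of end point values. On the disc slit along the cuts of `Dom
N`, polylogarithms obey the differential rule (`hasDerivAt_GPL_cons`) and the shuffle product
(`GPL_mul_GPL`). Shuffle regularization removes trailing zeros and leading ones. Near an end of the
path each polylogarithm is then a polynomial in one divergent logarithm `Λ`, whose coefficients are
cyclotomic values of complementary weight, up to an error smaller than every power of `Λ`
(`GoodEnd`). If such a function converges, the polynomial is constant and the limit is a value of
full weight (`HasExp.limit_mem`). Ends at other roots of unity are rotated to `1`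
(`goodEnd_rotate`), at the cost of `log ζ` having weight one. Hence a convergent integral along an
arc has the right weight and level (`PolyClass.integral_mem`), even if the polylogarithms in its
primitive diverge individually. -/

section

open Filter Topology
open scoped Real

/-! ### Words in the letters `0` and roots of unity -/

/-- All letters of the word `u` lie in `{0} ∪ μ_N`. -/
def IsWord (N : ℕ) (u : List ℂ) : Prop := ∀ α ∈ u, α = 0 ∨ α ^ N = 1

/-- All letters of the word `u` vanish. -/
def IsZeroWord (u : List ℂ) : Prop := ∀ β ∈ u, β = 0

lemma IsWord.tail {N : ℕ} {α : ℂ} {u : List ℂ} (h : IsWord N (α :: u)) : IsWord N u :=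
  fun β hβ => h β (List.mem_cons_of_mem _ hβ)

lemma IsWord.head {N : ℕ} {α : ℂ} {u : List ℂ} (h : IsWord N (α :: u)) : α = 0 ∨ α ^ N = 1 :=
  h α List.mem_cons_self

lemma IsWord.cons {N : ℕ} {α : ℂ} {u : List ℂ} (hα : α = 0 ∨ α ^ N = 1) (h : IsWord N u) :
    IsWord N (α :: u) := by
  intro β hβ
  rcases List.mem_cons.1 hβ with rfl | hβ
  · exact hα
  · exact h β hβ

lemma isZeroWord_cons {α : ℂ} {u : List ℂ} : IsZeroWord (α :: u) ↔ α = 0 ∧ IsZeroWord u := by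
  simp [IsZeroWord]

lemma isZeroWord_nil : IsZeroWord [] := by simp [IsZeroWord]

lemma IsZeroWord.eq_replicate {u : List ℂ} (h : IsZeroWord u) : u = List.replicate u.length 0 :=
  List.eq_replicate_iff.2 ⟨rfl, h⟩

lemma GPL_nil (z : ℂ) : GPL [] z = 1 := by simp [GPL]

lemma GPL_of_isZeroWord {u : List ℂ} (h : IsZeroWord u) (z : ℂ) :
    GPL u z = Complex.log z ^ u.length / (u.length.factorial : ℂ) := by
  cases u with
  | nil => simp [GPL]
  | cons α u =>
    rw [GPL]
    exact if_pos h

lemma GPL_cons {α : ℂ} {u : List ℂ} (h : ¬ IsZeroWord (α :: u)) (z : ℂ) :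
    GPL (α :: u) z = ∫ t in (0 : ℝ)..1, z / ((t : ℂ) * z - α) * GPL u ((t : ℂ) * z) := by
  rw [GPL]
  exact if_neg h

lemma norm_eq_one_of_letter {N : ℕ} (hN : 0 < N) {α : ℂ} (h : α = 0 ∨ α ^ N = 1) (h0 : α ≠ 0) :
    ‖α‖ = 1 :=
  Complex.norm_eq_one_of_pow_eq_one (h.resolve_left h0) hN.ne'

/-! ### Growth of polylogarithms in the open unit disc -/

lemma norm_log_le (z : ℂ) : ‖Complex.log z‖ ≤ |Real.log ‖z‖| + Real.pi := by
  refine (Complex.norm_le_abs_re_add_abs_im _).trans ?_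
  rw [Complex.log_re, Complex.log_im]
  gcongr
  exact Complex.abs_arg_le_pi z

lemma exists_norm_log_pow_le (n : ℕ) :
    ∃ C : ℝ, 0 ≤ C ∧ ∀ z : ℂ, z ≠ 0 → ‖z‖ ≤ 1 → ‖Complex.log z‖ ^ n ≤ C / √‖z‖ := by
  rcases Nat.eq_zero_or_pos n with rfl | hn
  · refine ⟨1, zero_le_one, fun z hz h1 => ?_⟩
    have : 0 < ‖z‖ := norm_pos_iff.2 hz
    rw [pow_zero, le_div_iff₀ (Real.sqrt_pos.2 this), one_mul]
    exact Real.sqrt_le_one.2 h1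
  · refine ⟨(2 * n + Real.pi) ^ n, by positivity, fun z hz h1 => ?_⟩
    have hr : 0 < ‖z‖ := norm_pos_iff.2 hz
    have hn' : (0 : ℝ) < n := by exact_mod_cast hn
    -- With this exponent `(‖z‖ ^ t) ^ n = √‖z‖`, so the `n`-th power of the bound for `|log| · ‖z‖
    -- ^ t` is the claim.
    set t : ℝ := 1 / (2 * n) with ht
    have htpos : 0 < t := by positivity
    have h2 := (Real.abs_log_mul_self_rpow_lt ‖z‖ t hr h1 htpos).le
    rw [abs_mul, abs_of_pos (Real.rpow_pos_of_pos hr t)] at h2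
    have h3 : ‖z‖ ^ t ≤ 1 := Real.rpow_le_one hr.le h1 htpos.le
    have h4 : ‖Complex.log z‖ * ‖z‖ ^ t ≤ 2 * n + Real.pi := by
      calc ‖Complex.log z‖ * ‖z‖ ^ t ≤ (|Real.log ‖z‖| + Real.pi) * ‖z‖ ^ t := by
            gcongr; exact norm_log_le z
        _ = |Real.log ‖z‖| * ‖z‖ ^ t + Real.pi * ‖z‖ ^ t := by ring
        _ ≤ 1 / t + Real.pi * 1 := by gcongr
        _ = 2 * n + Real.pi := by rw [ht]; field_simp
    rw [le_div_iff₀ (Real.sqrt_pos.2 hr)]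
    have h5 : √‖z‖ = (‖z‖ ^ t) ^ n := by
      rw [← Real.rpow_natCast, ← Real.rpow_mul hr.le, Real.sqrt_eq_rpow, ht]
      congr 1; field_simp
    rw [h5, ← mul_pow]
    gcongr

/-- The majorant of the integrands of generalized polylogarithms in the unit disc. -/
noncomputable def majorant (s : ℝ) : ℝ := 1 / (√s * (1 - s) * √(1 - s))

lemma majorant_nonneg {s : ℝ} (h1 : s ≤ 1) : 0 ≤ majorant s := by
  unfold majorant
  have : 0 ≤ 1 - s := by linarith
  positivity

lemma hasDerivAt_sqrt_div {r t : ℝ} (hr : 0 < r) (ht : 0 < t) (h : t * r < 1) :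
    HasDerivAt (fun t => 2 * (√(t * r) / √(1 - t * r))) (r * majorant (t * r)) t := by
  have h0 : 0 < t * r := by positivity
  have h1 : 0 < 1 - t * r := by linarith
  have e1 : HasDerivAt (fun t : ℝ => t * r) r t := by simpa using (hasDerivAt_id t).mul_const r
  have e2 : HasDerivAt (fun t : ℝ => 1 - t * r) (-r) t := by simpa using e1.const_sub 1
  have e3 := ((e1.sqrt h0.ne').div (e2.sqrt h1.ne') (Real.sqrt_pos.2 h1).ne').const_mul 2
  refine e3.congr_deriv ?_
  have a1 := Real.sqrt_pos.2 h0
  have a2 := Real.sqrt_pos.2 h1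
  have b1 : √(t * r) ^ 2 = t * r := Real.sq_sqrt h0.le
  have b2 : √(1 - t * r) ^ 2 = 1 - t * r := Real.sq_sqrt h1.le
  have key : ∀ x y : ℝ, 0 < x → 0 < y → x ^ 2 + y ^ 2 = 1 →
      2 * ((r / (2 * x) * y - x * (-r / (2 * y))) / y ^ 2) = r * (1 / (x * y ^ 2 * y)) := by
    intro x y hx hy hxy
    field_simp
    linear_combination hxy
  unfold majorant
  have := key _ _ a1 a2 (by rw [b1, b2]; ring)
  rw [this, b2]

/-- The primitive `2√s/√(1-s)` of the majorant has again the shape of the second bound in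
`GrowthBound`. This is what lets the induction on the length of a word close. -/
lemma integral_majorant {r : ℝ} (hr : 0 < r) (h1 : r < 1) :
    IntervalIntegrable (fun t => r * majorant (t * r)) MeasureTheory.volume 0 1 ∧
      ∫ t in (0 : ℝ)..1, r * majorant (t * r) = 2 * (√r / √(1 - r)) := by
  have hlt : ∀ t ∈ Set.Ioo (0 : ℝ) 1, t * r < 1 := fun t ht => by nlinarith [ht.1, ht.2]
  have hc : ContinuousOn (fun t => 2 * (√(t * r) / √(1 - t * r))) (Set.Icc 0 1) := by
    intro t ht
    have : 0 < √(1 - t * r) := Real.sqrt_pos.2 (by nlinarith [ht.1, ht.2])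
    have h1 : ContinuousAt (fun t : ℝ => √(t * r)) t := by fun_prop
    have h2 : ContinuousAt (fun t : ℝ => √(1 - t * r)) t := by fun_prop
    exact (continuousAt_const.mul (h1.div h2 this.ne')).continuousWithinAt
  have hi : IntervalIntegrable (fun t => r * majorant (t * r)) MeasureTheory.volume 0 1 := by
    rw [intervalIntegrable_iff_integrableOn_Ioc_of_le zero_le_one]
    exact intervalIntegral.integrableOn_deriv_of_nonneg hc
      (fun t ht => hasDerivAt_sqrt_div hr ht.1 (hlt t ht))
      (fun t ht => mul_nonneg hr.le (majorant_nonneg (hlt t ht).le))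
  refine ⟨hi, ?_⟩
  rw [intervalIntegral.integral_eq_sub_of_hasDerivAt_of_le zero_le_one hc
    (fun t ht => hasDerivAt_sqrt_div hr ht.1 (hlt t ht)) hi]
  simp

/-- The growth bound for the polylogarithm of a word in the unit disc. -/
def GrowthBound (u : List ℂ) (C : ℝ) : Prop :=
  ∀ z : ℂ, z ≠ 0 → ‖z‖ < 1 →
    (IsZeroWord u → ‖GPL u z‖ ≤ C / √‖z‖) ∧
    (¬ IsZeroWord u → ‖GPL u z‖ ≤ C * (√‖z‖ / √(1 - ‖z‖)))

/-- A letter `0` costs `1/‖z‖`, but then the remaining word has a nonzero letter and supplies a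
factor `√‖z‖`. A letter on the unit circle costs at most `1/(1-‖z‖)`. Both costs fit under the
majorant. -/
lemma GrowthBound.integrand {N : ℕ} (hN : 0 < N) {α : ℂ} {u : List ℂ} {C : ℝ} (hC : 0 ≤ C)
    (h : GrowthBound u C) (hα : α = 0 ∨ α ^ N = 1) (hne : ¬ IsZeroWord (α :: u)) {z : ℂ}
    (hz : z ≠ 0) (h1 : ‖z‖ < 1) : ‖GPL u z / (z - α)‖ ≤ C * majorant ‖z‖ := by
  have hr : 0 < ‖z‖ := norm_pos_iff.2 hz
  set r := ‖z‖ with hrdef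
  have hs : 0 < √r := Real.sqrt_pos.2 hr
  have hs2 : √r ^ 2 = r := Real.sq_sqrt hr.le
  have hk : 0 < 1 - r := by linarith
  have hks : 0 < √(1 - r) := Real.sqrt_pos.2 hk
  have hks1 : √(1 - r) ≤ 1 := Real.sqrt_le_one.2 (by linarith)
  rw [norm_div]
  by_cases hα0 : α = 0
  · subst hα0
    have hu : ¬ IsZeroWord u := fun hu => hne (isZeroWord_cons.2 ⟨rfl, hu⟩)
    rw [sub_zero, ← hrdef]
    calc ‖GPL u z‖ / r ≤ C * (√r / √(1 - r)) / r := by gcongr; exact (h z hz h1).2 hu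
      _ = C * (1 / (√r * 1 * √(1 - r))) := by
          have : √r / √(1 - r) / r = 1 / (√r * 1 * √(1 - r)) := by
            field_simp; exact hs2
          rw [← this]; ring
      _ ≤ C * majorant r := by unfold majorant; gcongr; linarith
  · have hnα := norm_eq_one_of_letter hN hα hα0
    have hd : 1 - r ≤ ‖z - α‖ := by
      have := norm_sub_norm_le α z
      rw [hnα, norm_sub_rev] at this
      exact this
    have hG : ‖GPL u z‖ ≤ C * (1 / (√r * √(1 - r))) := by
      by_cases hu : IsZeroWord u
      · refine ((h z hz h1).1 hu).trans ?_
        rw [div_eq_mul_one_div]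
        gcongr
        nlinarith
      · refine ((h z hz h1).2 hu).trans ?_
        refine mul_le_mul_of_nonneg_left ?_ hC
        rw [div_le_div_iff₀ hks (by positivity), ← hrdef]
        nlinarith
    calc ‖GPL u z‖ / ‖z - α‖ ≤ C * (1 / (√r * √(1 - r))) / (1 - r) := by gcongr
      _ = C * majorant r := by unfold majorant; field_simp

lemma norm_ofReal_mul {t : ℝ} (ht : 0 ≤ t) (z : ℂ) : ‖(t : ℂ) * z‖ = t * ‖z‖ := by
  rw [norm_mul, Complex.norm_real, Real.norm_of_nonneg ht]

lemma exists_growthBound {N : ℕ} (hN : 0 < N) (u : List ℂ) (hu : IsWord N u) :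
    ∃ C : ℝ, 0 ≤ C ∧ GrowthBound u C := by
  induction u with
  | nil =>
    refine ⟨1, zero_le_one, fun z hz h1 => ⟨fun _ => ?_, fun h => absurd isZeroWord_nil h⟩⟩
    rw [GPL_nil, norm_one, le_div_iff₀ (Real.sqrt_pos.2 (norm_pos_iff.2 hz)), one_mul]
    exact Real.sqrt_le_one.2 h1.le
  | cons α u ih =>
    obtain ⟨C, hC, hb⟩ := ih hu.tail
    by_cases hne : IsZeroWord (α :: u)
    · obtain ⟨D, hD, hD'⟩ := exists_norm_log_pow_le (α :: u).length
      refine ⟨D, hD, fun z hz h1 => ⟨fun _ => ?_, fun h => absurd hne h⟩⟩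
      rw [GPL_of_isZeroWord hne, norm_div, norm_pow]
      refine (div_le_self (by positivity) ?_).trans (hD' z hz h1.le)
      rw [Complex.norm_natCast]
      exact_mod_cast Nat.one_le_iff_ne_zero.2 (Nat.factorial_ne_zero _)
    · refine ⟨C * 2, by positivity, fun z hz h1 => ⟨fun h => absurd h hne, fun _ => ?_⟩⟩
      have hr : 0 < ‖z‖ := norm_pos_iff.2 hz
      obtain ⟨hi, hv⟩ := integral_majorant hr h1
      rw [GPL_cons hne, mul_assoc, ← hv, ← intervalIntegral.integral_const_mul]
      refine intervalIntegral.norm_integral_le_of_norm_le zero_le_one ?_ (hi.const_mul C)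
      refine Eventually.of_forall fun t ht => ?_
      have hn := norm_ofReal_mul ht.1.le z
      have htz : (t : ℂ) * z ≠ 0 := mul_ne_zero (by exact_mod_cast ht.1.ne') hz
      have h2 := hb.integrand hN hC hu.head hne htz (by rw [hn]; nlinarith [ht.1, ht.2])
      rw [hn] at h2
      calc ‖z / (t * z - α) * GPL u (t * z)‖ = ‖z‖ * ‖GPL u (t * z) / (t * z - α)‖ := by
            rw [← norm_mul]; congr 1; ring
        _ ≤ ‖z‖ * (C * majorant (t * ‖z‖)) := by gcongr
        _ = C * (‖z‖ * majorant (t * ‖z‖)) := by ring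

/-! ### Holomorphy on the slit domain -/

lemma majorant_le {s : ℝ} (h0 : 0 < s) (h1 : s ≤ 1 / 2) : majorant s ≤ 4 / √s := by
  have hs : 0 < √s := Real.sqrt_pos.2 h0
  have : (1 / 2 : ℝ) ≤ √(1 - s) := Real.le_sqrt_of_sq_le (by linarith)
  unfold majorant
  rw [div_le_div_iff₀ (by have : 0 < 1 - s := by linarith
                          positivity) hs]
  have : (1 / 4 : ℝ) ≤ (1 - s) * √(1 - s) := by nlinarith
  nlinarith

/-- Differentiation of the integral of a holomorphic function along the segments from `0`. -/
lemma hasDerivAt_ray_integral {Ω : Set ℂ} (hΩ : IsOpen Ω)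
    (hstar : ∀ z ∈ Ω, ∀ t : ℝ, 0 < t → t ≤ 1 → (t : ℂ) * z ∈ Ω) {φ : ℂ → ℂ}
    (hφ : DifferentiableOn ℂ φ Ω) {C δ : ℝ} (hC : 0 ≤ C) (hδ : 0 < δ)
    (hb : ∀ z ∈ Ω, ‖z‖ ≤ δ → ‖φ z‖ ≤ C / √‖z‖) {z₀ : ℂ} (hz₀ : z₀ ∈ Ω) :
    HasDerivAt (fun z => ∫ t in (0 : ℝ)..1, z * φ (t * z)) (φ z₀) z₀ := by
  obtain ⟨ε, hε, hball⟩ := Metric.isOpen_iff.1 hΩ z₀ hz₀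
  -- The ball of radius `2R` leaves room for circles of radius `R` around all points of the ball of
  -- radius `R`.
  set R := ε / 4 with hR
  have hRpos : 0 < R := by positivity
  have hsub : Metric.closedBall z₀ (2 * R) ⊆ Ω := fun z hz =>
    hball (Metric.mem_ball.2 ((Metric.mem_closedBall.1 hz).trans_lt (by rw [hR]; linarith)))
  set A := ‖z₀‖ + 2 * R with hA
  have hApos : 0 < A := by positivity
  have hnA : ∀ z ∈ Metric.closedBall z₀ (2 * R), ‖z‖ ≤ A := fun z hz => by
    have h1 := Metric.mem_closedBall.1 hz
    rw [dist_eq_norm] at h1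
    have := norm_le_norm_add_norm_sub' z z₀
    linarith
  -- For `t ≥ τ` the integrand is bounded by compactness; for `t ≤ τ` the point `t z` lies in the
  -- region where the assumed bound at the origin applies.
  set τ := min 1 (δ / A) with hτ
  have hτpos : 0 < τ := lt_min one_pos (by positivity)
  have hcont : ContinuousOn (fun p : ℝ × ℂ => p.2 * φ (p.1 * p.2))
      (Set.Icc τ 1 ×ˢ Metric.closedBall z₀ (2 * R)) := by
    refine continuousOn_snd.mul (hφ.continuousOn.comp (by fun_prop) ?_)
    rintro ⟨t, z⟩ ⟨ht, hz⟩
    exact hstar z (hsub hz) t (hτpos.trans_le ht.1) ht.2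
  obtain ⟨M₁, hM₁⟩ := (isCompact_Icc.prod (isCompact_closedBall z₀ (2 * R))).exists_bound_of_continuousOn hcont
  set M := max M₁ (C * √A) with hM
  have hMnn : 0 ≤ M := le_max_of_le_right (by positivity)
  have hbd : ∀ t : ℝ, 0 < t → t ≤ 1 → ∀ z ∈ Metric.closedBall z₀ (2 * R),
      ‖z * φ (t * z)‖ ≤ M / √t := by
    intro t ht0 ht1 z hz
    have hst : 0 < √t := Real.sqrt_pos.2 ht0
    rcases le_total τ t with h | h
    · refine (hM₁ (t, z) ⟨⟨h, ht1⟩, hz⟩).trans ((le_max_left M₁ (C * √A)).trans ?_)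
      rw [le_div_iff₀ hst]
      exact mul_le_of_le_one_right hMnn (Real.sqrt_le_one.2 ht1)
    · by_cases hz0 : z = 0
      · subst hz0; simp only [zero_mul, norm_zero]; positivity
      have hzn : 0 < ‖z‖ := norm_pos_iff.2 hz0
      have hn := norm_ofReal_mul ht0.le z
      have h1 : ‖(t : ℂ) * z‖ ≤ δ := by
        rw [hn]
        calc t * ‖z‖ ≤ δ / A * A := by
              gcongr
              · exact h.trans (min_le_right _ _)
              · exact hnA z hz
          _ = δ := by field_simp
      have h2 := hb _ (hstar z (hsub hz) t ht0 ht1) h1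
      rw [hn, Real.sqrt_mul ht0.le] at h2
      have hsz : 0 < √‖z‖ := Real.sqrt_pos.2 hzn
      rw [norm_mul]
      calc ‖z‖ * ‖φ (t * z)‖ ≤ ‖z‖ * (C / (√t * √‖z‖)) := by gcongr
        _ = C * √‖z‖ / √t := by
            nth_rewrite 1 [← Real.sq_sqrt hzn.le]; field_simp
        _ ≤ M / √t := by
            gcongr
            refine le_trans ?_ (le_max_right _ _)
            gcongr
            exact hnA z hz
  have hφ' : ContinuousOn (deriv φ) Ω := (hφ.deriv hΩ).continuousOn
  have hder : ∀ w ∈ Ω, HasDerivAt φ (deriv φ w) w := fun w hw =>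
    (hφ.differentiableAt (hΩ.mem_nhds hw)).hasDerivAt
  set F' : ℂ → ℝ → ℂ := fun z t => φ (t * z) + z * (deriv φ (t * z) * t) with hF'
  have hd : ∀ t : ℝ, 0 < t → t ≤ 1 → ∀ z ∈ Ω,
      HasDerivAt (fun z => z * φ (t * z)) (F' z t) z := by
    intro t ht0 ht1 z hz
    have e1 : HasDerivAt (fun z : ℂ => (t : ℂ) * z) t z := by
      simpa using (hasDerivAt_id z).const_mul (t : ℂ)
    have e2 := (hder _ (hstar z hz t ht0 ht1)).comp z e1
    have e3 := (hasDerivAt_id z).mul e2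
    refine e3.congr_deriv ?_
    simp [hF']
  have hball2 : Metric.closedBall z₀ R ⊆ Metric.closedBall z₀ (2 * R) :=
    Metric.closedBall_subset_closedBall (by linarith)
  have hmeas : ∀ z ∈ Ω, MeasureTheory.AEStronglyMeasurable (fun t : ℝ => z * φ (t * z))
      (MeasureTheory.volume.restrict (Set.uIoc 0 1)) := by
    intro z hz
    rw [Set.uIoc_of_le zero_le_one]
    refine ContinuousOn.aestronglyMeasurable ?_ measurableSet_Ioc
    exact continuousOn_const.mul (hφ.continuousOn.comp (by fun_prop)
      fun t ht => hstar z hz t ht.1 ht.2)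
  have hsq : IntervalIntegrable (fun t : ℝ => M / √t) MeasureTheory.volume 0 1 := by
    have := (intervalIntegral.intervalIntegrable_rpow' (a := 0) (b := 1) (r := -(1 / 2))
      (by norm_num)).const_mul M
    refine this.congr ?_
    intro t ht
    rw [Set.uIoc_of_le zero_le_one] at ht
    simp only
    rw [Real.rpow_neg ht.1.le, ← Real.sqrt_eq_rpow]; rfl
  have main := intervalIntegral.hasDerivAt_integral_of_dominated_loc_of_deriv_le
    (μ := MeasureTheory.volume) (a := 0) (b := 1)
    (F := fun z (t : ℝ) => z * φ (t * z)) (F' := F') (x₀ := z₀) (s := Metric.closedBall z₀ R)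
    (bound := fun t => M / √t / R)
    (Metric.closedBall_mem_nhds z₀ hRpos)
    (by filter_upwards [hΩ.mem_nhds hz₀] with z hz using hmeas z hz)
    (by
      refine hsq.mono_fun (hmeas z₀ hz₀) ?_
      rw [Set.uIoc_of_le zero_le_one]
      refine (MeasureTheory.ae_restrict_iff' measurableSet_Ioc).2 (Eventually.of_forall ?_)
      intro t ht
      refine (hbd t ht.1 ht.2 z₀ (Metric.mem_closedBall_self (by positivity))).trans ?_
      exact le_abs_self _)
    (by
      rw [Set.uIoc_of_le zero_le_one]
      refine ContinuousOn.aestronglyMeasurable ?_ measurableSet_Ioc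
      have hm : Set.MapsTo (fun t : ℝ => (t : ℂ) * z₀) (Set.Ioc 0 1) Ω :=
        fun t ht => hstar z₀ hz₀ t ht.1 ht.2
      exact (hφ.continuousOn.comp (by fun_prop) hm).add (continuousOn_const.mul
        ((hφ'.comp (by fun_prop) hm).mul (by fun_prop))))
    (by
      rw [Set.uIoc_of_le zero_le_one]
      refine Eventually.of_forall fun t ht z hz => ?_
      rw [← (hd t ht.1 ht.2 z (hsub (hball2 hz))).deriv]
      have hsub2 : Metric.closedBall z R ⊆ Metric.closedBall z₀ (2 * R) := by
        refine Metric.closedBall_subset_closedBall' ?_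
        have := Metric.mem_closedBall.1 hz
        linarith
      -- Cauchy's estimate: the bound `M / √t` for the function dominates its derivative as well.
      refine Complex.norm_deriv_le_of_forall_mem_sphere_norm_le hRpos ?_ ?_
      · refine DifferentiableOn.diffContOnCl_ball (U := Ω) ?_ (hsub2.trans hsub)
        intro w hw
        exact (hd t ht.1 ht.2 w hw).differentiableAt.differentiableWithinAt
      · intro w hw
        exact hbd t ht.1 ht.2 w (hsub2 (Metric.sphere_subset_closedBall hw)))
    (hsq.div_const R)
    (by
      rw [Set.uIoc_of_le zero_le_one]
      exact Eventually.of_forall fun t ht z hz => hd t ht.1 ht.2 z (hsub (hball2 hz)))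
  refine main.2.congr_deriv ?_
  have hself : z₀ ∈ Metric.closedBall z₀ (2 * R) := Metric.mem_closedBall_self (by positivity)
  -- The derivative in `z` of `z φ(t z)` is also the derivative in `t` of `t φ(t z)`. Its integral
  -- over `[0, 1]` therefore telescopes to `φ(z₀)`, the boundary term at `t = 0` being killed by the
  -- bound.
  have hray : ∀ t : ℝ, 0 < t → t ≤ 1 → HasDerivAt (fun t : ℝ => (t : ℂ) * φ (t * z₀)) (F' z₀ t) t := by
    intro t ht0 ht1
    have e0 : HasDerivAt (fun t : ℝ => (t : ℂ)) 1 t := Complex.ofRealCLM.hasDerivAt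
    have e1 : HasDerivAt (fun t : ℝ => (t : ℂ) * z₀) z₀ t := by simpa using e0.mul_const z₀
    have e2 := HasDerivAt.comp_of_eq t (hder _ (hstar z₀ hz₀ t ht0 ht1)) e1 rfl
    have e3 := e0.mul e2
    refine e3.congr_deriv ?_
    simp [hF']
    ring
  have hlim : Tendsto (fun t : ℝ => (t : ℂ) * φ (t * z₀)) (𝓝[>] 0) (𝓝 0) := by
    by_cases hz0 : z₀ = 0
    · subst hz0
      have : Tendsto (fun t : ℝ => (t : ℂ) * φ (t * 0)) (𝓝 0) (𝓝 (((0 : ℝ) : ℂ) * φ 0)) := by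
        simp only [mul_zero]
        exact (Complex.continuous_ofReal.tendsto 0).mul_const _
      simpa using this.mono_left nhdsWithin_le_nhds
    have hzn : 0 < ‖z₀‖ := norm_pos_iff.2 hz0
    have hsl : Tendsto (fun t : ℝ => M / ‖z₀‖ * √t) (𝓝[>] 0) (𝓝 0) := by
      have : Tendsto (fun t : ℝ => M / ‖z₀‖ * √t) (𝓝 0) (𝓝 (M / ‖z₀‖ * √0)) :=
        (by fun_prop : Continuous fun t : ℝ => M / ‖z₀‖ * √t).tendsto 0
      simpa using this.mono_left nhdsWithin_le_nhds
    refine squeeze_zero_norm' ?_ hsl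
    filter_upwards [Ioc_mem_nhdsGT (zero_lt_one (α := ℝ))] with t ht
    have h1 := hbd t ht.1 ht.2 z₀ hself
    have hst : 0 < √t := Real.sqrt_pos.2 ht.1
    rw [norm_mul] at h1
    rw [norm_mul, Complex.norm_real, Real.norm_of_nonneg ht.1.le]
    have h2 : ‖φ (t * z₀)‖ ≤ M / √t / ‖z₀‖ := by rw [le_div_iff₀ hzn]; linarith
    calc t * ‖φ (t * z₀)‖ ≤ t * (M / √t / ‖z₀‖) := by gcongr; exact ht.1.le
      _ = M / ‖z₀‖ * √t := by
        nth_rewrite 1 [← Real.sq_sqrt ht.1.le]; field_simp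
  rw [intervalIntegral.integral_eq_sub_of_hasDerivAt_of_tendsto zero_lt_one
    (fun t ht => hray t ht.1 ht.2.le) main.1 hlim
    ((hray 1 one_pos le_rfl).continuousAt.tendsto.mono_left nhdsWithin_le_nhds)]
  simp

/-- The slit domain on which all polylogarithms with letters in `{0} ∪ μ_N` are holomorphic. -/
def Dom (N : ℕ) : Set ℂ := {z | z ∈ Complex.slitPlane ∧ 1 - z ^ N ∈ Complex.slitPlane}

lemma isOpen_Dom (N : ℕ) : IsOpen (Dom N) :=
  Complex.isOpen_slitPlane.inter
    (Complex.isOpen_slitPlane.preimage (by fun_prop : Continuous fun z : ℂ => 1 - z ^ N))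

lemma Dom.ne_zero {N : ℕ} {z : ℂ} (hz : z ∈ Dom N) : z ≠ 0 := Complex.slitPlane_ne_zero hz.1

lemma not_mem_slitPlane_one_sub {w : ℂ} : 1 - w ∉ Complex.slitPlane ↔ ∃ x : ℝ, 1 ≤ x ∧ w = x := by
  rw [Complex.mem_slitPlane_iff_not_le_zero, not_not, Complex.le_def]
  constructor
  · rintro ⟨h1, h2⟩
    simp only [Complex.sub_re, Complex.one_re, Complex.zero_re, Complex.sub_im, Complex.one_im,
      Complex.zero_im] at h1 h2
    exact ⟨w.re, by linarith, Complex.ext rfl (by simp only [Complex.ofReal_im]; linarith)⟩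
  · rintro ⟨x, hx, rfl⟩
    simp [hx]

/-- The cuts are the negative axis and the rays running outwards from the roots of unity, so the
domain is star-shaped about `0` and the defining segments stay inside. -/
lemma Dom.smul_mem {N : ℕ} {z : ℂ} (hz : z ∈ Dom N) {t : ℝ} (h0 : 0 < t) (h1 : t ≤ 1) :
    (t : ℂ) * z ∈ Dom N := by
  refine ⟨?_, ?_⟩
  · rw [Complex.mem_slitPlane_iff]
    rcases (Complex.mem_slitPlane_iff.1 hz.1) with h | h
    · left; simpa using mul_pos h0 h
    · right; simpa using ⟨h0.ne', h⟩
  · by_contra h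
    obtain ⟨x, hx, hxe⟩ := not_mem_slitPlane_one_sub.1 h
    refine not_mem_slitPlane_one_sub.2 ⟨x / t ^ N, ?_, ?_⟩ hz.2
    · have := pow_le_one₀ h0.le h1 (n := N)
      rw [le_div_iff₀ (by positivity)]; linarith
    · have : (t : ℂ) ≠ 0 := by exact_mod_cast h0.ne'
      push_cast
      rw [← hxe, mul_pow]; field_simp

lemma Dom.ne_letter {N : ℕ} {z α : ℂ} (hz : z ∈ Dom N) (hα : α = 0 ∨ α ^ N = 1) : z - α ≠ 0 := by
  intro h
  have h' := sub_eq_zero.1 h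
  subst h'
  rcases hα with h0 | h1
  · exact Dom.ne_zero hz h0
  · exact Complex.slitPlane_ne_zero hz.2 (by rw [h1, sub_self])

lemma mem_Dom_of_norm_lt {N : ℕ} (hN : 0 < N) {z : ℂ} (hz : z ∈ Complex.slitPlane) (h : ‖z‖ < 1) :
    z ∈ Dom N := by
  refine ⟨hz, ?_⟩
  by_contra h'
  obtain ⟨x, hx, hxe⟩ := not_mem_slitPlane_one_sub.1 h'
  have h2 : ‖z ^ N‖ < 1 := by
    rw [norm_pow]; exact pow_lt_one₀ (norm_nonneg _) h hN.ne'
  rw [hxe, Complex.norm_real, Real.norm_of_nonneg (by linarith)] at h2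
  linarith

/-- All-zero words are explicit powers of the logarithm. For any other word the integrand along the
segment is holomorphic by induction, and the growth bound makes it integrable at `0`, so the
integral along rays can be differentiated. -/
lemma hasDerivAt_GPL_cons {N : ℕ} (hN : 0 < N) {α : ℂ} {u : List ℂ} (hu : IsWord N (α :: u))
    {z : ℂ} (hz : z ∈ Dom N) : HasDerivAt (GPL (α :: u)) (GPL u z / (z - α)) z := by
  induction u generalizing α z with
  | nil =>
    by_cases hα : α = 0
    · have hzw : IsZeroWord [α] := by simp [IsZeroWord, hα]
      have : GPL [α] = Complex.log := by
        funext w; rw [GPL_of_isZeroWord hzw]; simp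
      rw [this, GPL_nil, hα, sub_zero, one_div]
      exact Complex.hasDerivAt_log hz.1
    · have hne : ¬ IsZeroWord [α] := by simp [IsZeroWord, hα]
      have hn1 := norm_eq_one_of_letter hN hu.head hα
      have e : GPL [α] = fun z => ∫ t in (0 : ℝ)..1, z * (fun w => GPL [] w / (w - α)) (t * z) := by
        funext w; rw [GPL_cons hne]; congr 1; funext t; ring
      rw [e]
      obtain ⟨C, hC, hb⟩ := exists_growthBound hN [] hu.tail
      refine hasDerivAt_ray_integral (isOpen_Dom N) (fun z hz t h0 h1 => Dom.smul_mem hz h0 h1)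
        (φ := fun w => GPL [] w / (w - α)) ?_ (C := C * 4) (δ := 1 / 2) (by positivity)
        (by norm_num) ?_ hz
      · intro w hw
        simp only [GPL_nil]
        exact ((differentiableAt_const _).div (differentiableAt_id.sub_const α)
          (Dom.ne_letter hw hu.head)).differentiableWithinAt
      · intro w hw h1
        have hwp : 0 < ‖w‖ := norm_pos_iff.2 (Dom.ne_zero hw)
        refine (hb.integrand hN hC hu.head hne (Dom.ne_zero hw) (by linarith)).trans ?_
        rw [mul_div_assoc]
        gcongr
        exact majorant_le hwp h1
  | cons β u ih =>
    by_cases hzw : IsZeroWord (α :: β :: u)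
    · have hα := (isZeroWord_cons.1 hzw).1
      have hzw' := (isZeroWord_cons.1 hzw).2
      set n := (β :: u).length with hn
      have : GPL (α :: β :: u) = fun w => Complex.log w ^ (n + 1) / ((n + 1).factorial : ℂ) := by
        funext w; rw [GPL_of_isZeroWord hzw]; simp [hn]
      rw [this, GPL_of_isZeroWord hzw', hα, sub_zero, ← hn]
      refine (((Complex.hasDerivAt_log hz.1).pow (n + 1)).div_const _).congr_deriv ?_
      have h1 : ((n.factorial : ℕ) : ℂ) ≠ 0 := by exact_mod_cast n.factorial_ne_zero
      have h2 : ((n : ℂ) + 1) ≠ 0 := by exact_mod_cast n.succ_ne_zero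
      have h3 := Dom.ne_zero hz
      rw [Nat.factorial_succ]
      push_cast
      field_simp
    · have e : GPL (α :: β :: u) =
          fun z => ∫ t in (0 : ℝ)..1, z * (fun w => GPL (β :: u) w / (w - α)) (t * z) := by
        funext w; rw [GPL_cons hzw]; congr 1; funext t; ring
      rw [e]
      obtain ⟨C, hC, hb⟩ := exists_growthBound hN (β :: u) hu.tail
      refine hasDerivAt_ray_integral (isOpen_Dom N) (fun z hz t h0 h1 => Dom.smul_mem hz h0 h1)
        (φ := fun w => GPL (β :: u) w / (w - α)) ?_ (C := C * 4) (δ := 1 / 2) (by positivity)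
        (by norm_num) ?_ hz
      · intro w hw
        exact ((ih hu.tail hw).differentiableAt.div (differentiableAt_id.sub_const α)
          (Dom.ne_letter hw hu.head)).differentiableWithinAt
      · intro w hw h1
        have hwp : 0 < ‖w‖ := norm_pos_iff.2 (Dom.ne_zero hw)
        refine (hb.integrand hN hC hu.head hzw (Dom.ne_zero hw) (by linarith)).trans ?_
        rw [mul_div_assoc]
        gcongr
        exact majorant_le hwp h1

lemma continuousOn_GPL {N : ℕ} (hN : 0 < N) {u : List ℂ} (hu : IsWord N u) :
    ContinuousOn (GPL u) (Dom N) := by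
  cases u with
  | nil =>
    have : GPL [] = fun _ => 1 := by funext z; exact GPL_nil z
    rw [this]; exact continuousOn_const
  | cons α u => exact fun z hz => (hasDerivAt_GPL_cons hN hu hz).continuousAt.continuousWithinAt

/-! ### The shuffle product -/

/-- The list of all shuffles of two words. -/
def shuffle : List ℂ → List ℂ → List (List ℂ)
  | [], v => [v]
  | a :: u, [] => [a :: u]
  | a :: u, b :: v =>
    (shuffle u (b :: v)).map (a :: ·) ++ (shuffle (a :: u) v).map (b :: ·)
termination_by u v => u.length + v.length

lemma shuffle_nil_left (v : List ℂ) : shuffle [] v = [v] := by rw [shuffle]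

lemma shuffle_nil_right (u : List ℂ) : shuffle u [] = [u] := by
  cases u <;> rw [shuffle]

lemma shuffle_cons_cons (a b : ℂ) (u v : List ℂ) : shuffle (a :: u) (b :: v) =
    (shuffle u (b :: v)).map (a :: ·) ++ (shuffle (a :: u) v).map (b :: ·) := by
  rw [shuffle]

lemma perm_of_mem_shuffle (u v : List ℂ) : ∀ x ∈ shuffle u v, x.Perm (u ++ v) := by
  induction u, v using shuffle.induct with
  | case1 v => intro x hx; rw [shuffle_nil_left, List.mem_singleton] at hx; simp [hx]
  | case2 a u => intro x hx; rw [shuffle_nil_right, List.mem_singleton] at hx; simp [hx]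
  | case3 a u b v ih1 ih2 =>
    intro x hx
    rw [shuffle_cons_cons, List.mem_append, List.mem_map, List.mem_map] at hx
    rcases hx with ⟨y, hy, rfl⟩ | ⟨y, hy, rfl⟩
    · exact (ih1 y hy).cons a
    · exact ((ih2 y hy).cons b).trans List.perm_middle.symm

/-- Needed for words of zeros, where the shuffle relation is `(log^m / m!)(log^n / n!) = binom(m+n,
m) log^{m+n} / (m+n)!`. -/
lemma length_shuffle (u v : List ℂ) :
    (shuffle u v).length = (u.length + v.length).choose u.length := by
  induction u, v using shuffle.induct with
  | case1 v => simp [shuffle_nil_left]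
  | case2 a u => simp [shuffle_nil_right]
  | case3 a u b v ih1 ih2 =>
    rw [shuffle_cons_cons, List.length_append, List.length_map, List.length_map, ih1, ih2]
    simp only [List.length_cons]
    rw [show u.length + 1 + (v.length + 1) = (u.length + (v.length + 1)) + 1 by ring,
      Nat.choose_succ_succ, show u.length + 1 + v.length = u.length + (v.length + 1) by ring]

/-- The last letter of a shuffle is the last letter of one of the factors. -/
lemma getLast_of_mem_shuffle (u v : List ℂ) (hu : u.getLast? ≠ some 0) (hv : v.getLast? ≠ some 0) :
    ∀ x ∈ shuffle u v, x.getLast? ≠ some 0 := by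
  induction u, v using shuffle.induct with
  | case1 v => intro x hx; rw [shuffle_nil_left, List.mem_singleton] at hx; rwa [hx]
  | case2 a u => intro x hx; rw [shuffle_nil_right, List.mem_singleton] at hx; rwa [hx]
  | case3 a u b v ih1 ih2 =>
    have key : ∀ (c : ℂ) (y : List ℂ), (c :: y).getLast? ≠ some 0 → y.getLast? ≠ some 0 := by
      intro c y h
      cases y with
      | nil => simp
      | cons d y => rwa [List.getLast?_cons_cons] at h
    intro x hx
    rw [shuffle_cons_cons, List.mem_append, List.mem_map, List.mem_map] at hx
    rcases hx with ⟨y, hy, rfl⟩ | ⟨y, hy, rfl⟩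
    · have h1 := ih1 (key a u hu) hv y hy
      have h2 := (perm_of_mem_shuffle _ _ y hy).length_eq
      cases y with
      | nil => simp at h2
      | cons d y => rwa [List.getLast?_cons_cons]
    · have h1 := ih2 hu (key b v hv) y hy
      have h2 := (perm_of_mem_shuffle _ _ y hy).length_eq
      cases y with
      | nil => simp at h2
      | cons d y => rwa [List.getLast?_cons_cons]

lemma head_of_mem_shuffle (u v : List ℂ) (c : ℂ) (hu : u.head? ≠ some c) (hv : v.head? ≠ some c) :
    ∀ x ∈ shuffle u v, x.head? ≠ some c := by
  intro x hx
  cases u with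
  | nil => rw [shuffle_nil_left, List.mem_singleton] at hx; rwa [hx]
  | cons a u =>
    cases v with
    | nil => rw [shuffle_nil_right, List.mem_singleton] at hx; rwa [hx]
    | cons b v =>
      rw [shuffle_cons_cons, List.mem_append, List.mem_map, List.mem_map] at hx
      rcases hx with ⟨y, hy, rfl⟩ | ⟨y, hy, rfl⟩
      · simpa using hu
      · simpa using hv

lemma IsWord.append {N : ℕ} {u v : List ℂ} (hu : IsWord N u) (hv : IsWord N v) :
    IsWord N (u ++ v) := fun α hα => (List.mem_append.1 hα).elim (hu α) (hv α)

lemma IsWord.of_perm {N : ℕ} {u v : List ℂ} (h : u.Perm v) (hv : IsWord N v) : IsWord N u :=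
  fun α hα => hv α (h.mem_iff.1 hα)

lemma IsWord.of_mem_shuffle {N : ℕ} {u v x : List ℂ} (hu : IsWord N u) (hv : IsWord N v)
    (hx : x ∈ shuffle u v) : IsWord N x := (hu.append hv).of_perm (perm_of_mem_shuffle u v x hx)

/-- A function with zero derivative on `(0, 1]` equals its limit at `0`. -/
lemma eq_of_hasDerivAt_zero_of_tendsto {f : ℝ → ℂ} {L : ℂ}
    (hd : ∀ t : ℝ, 0 < t → t ≤ 1 → HasDerivAt f 0 t) (hl : Tendsto f (𝓝[>] 0) (𝓝 L)) :
    f 1 = L := by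
  have h1 : ∀ᶠ t in 𝓝[>] (0 : ℝ), f t = f 1 := by
    filter_upwards [Ioc_mem_nhdsGT (zero_lt_one (α := ℝ))] with t ht
    have := constant_of_has_deriv_right_zero (f := f) (a := t) (b := 1)
      (fun s hs => (hd s (ht.1.trans_le hs.1) hs.2).continuousAt.continuousWithinAt)
      (fun s hs => (hd s (ht.1.trans_le hs.1) hs.2.le).hasDerivWithinAt)
    exact (this 1 ⟨ht.2, le_rfl⟩).symm
  exact tendsto_nhds_unique (tendsto_const_nhds.congr' (h1.mono fun t ht => ht.symm)) hl

/-- A weaker singularity than `1/√‖z‖` is needed, so that the factor `√‖z‖` of a word with a nonzero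
letter wins in products. For logarithms it comes from bounding the doubled power and taking a square
root. -/
lemma exists_norm_GPL_le_fourth_root {N : ℕ} (hN : 0 < N) {u : List ℂ} (hu : IsWord N u) :
    ∃ C : ℝ, 0 ≤ C ∧ ∀ z : ℂ, z ≠ 0 → ‖z‖ ≤ 1 / 2 → ‖GPL u z‖ ≤ C / √(√‖z‖) := by
  by_cases h : IsZeroWord u
  · obtain ⟨C, hC, hb⟩ := exists_norm_log_pow_le (u.length * 2)
    refine ⟨√C, by positivity, fun z hz h1 => ?_⟩
    have h2 := hb z hz (by linarith)
    rw [pow_mul] at h2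
    have h3 := Real.abs_le_sqrt h2
    rw [abs_of_nonneg (by positivity), Real.sqrt_div hC] at h3
    rw [GPL_of_isZeroWord h, norm_div, norm_pow]
    refine (div_le_self (by positivity) ?_).trans h3
    rw [Complex.norm_natCast]
    exact_mod_cast Nat.one_le_iff_ne_zero.2 (Nat.factorial_ne_zero _)
  · obtain ⟨C, hC, hb⟩ := exists_growthBound hN u hu
    refine ⟨C * 2, by positivity, fun z hz h1 => ?_⟩
    have hr : 0 < ‖z‖ := norm_pos_iff.2 hz
    refine ((hb z hz (by linarith)).2 h).trans ?_
    rw [mul_div_assoc]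
    refine mul_le_mul_of_nonneg_left ?_ hC
    have h2 : (1 / 2 : ℝ) ≤ √(1 - ‖z‖) := Real.le_sqrt_of_sq_le (by linarith)
    have h3 : √‖z‖ ≤ 1 := Real.sqrt_le_one.2 (by linarith)
    have h4 : √(√‖z‖) ≤ 1 := Real.sqrt_le_one.2 h3
    have h5 : 0 < √(√‖z‖) := by positivity
    rw [div_le_div_iff₀ (by linarith) h5]
    nlinarith [Real.sqrt_nonneg ‖z‖]

lemma exists_norm_GPL_le_sqrt {N : ℕ} (hN : 0 < N) {u : List ℂ} (hu : IsWord N u)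
    (h : ¬ IsZeroWord u) :
    ∃ C : ℝ, 0 ≤ C ∧ ∀ z : ℂ, z ≠ 0 → ‖z‖ ≤ 1 / 2 → ‖GPL u z‖ ≤ C * √‖z‖ := by
  obtain ⟨C, hC, hb⟩ := exists_growthBound hN u hu
  refine ⟨C * 2, by positivity, fun z hz h1 => ?_⟩
  have hr : 0 < ‖z‖ := norm_pos_iff.2 hz
  refine ((hb z hz (by linarith)).2 h).trans ?_
  rw [mul_assoc]
  gcongr
  have h2 : (1 / 2 : ℝ) ≤ √(1 - ‖z‖) := Real.le_sqrt_of_sq_le (by linarith)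
  rw [div_le_iff₀ (by linarith)]
  nlinarith [Real.sqrt_nonneg ‖z‖]

lemma tendsto_ray_zero {z : ℂ} : Tendsto (fun t : ℝ => (t : ℂ) * z) (𝓝[>] 0) (𝓝 0) := by
  have : Tendsto (fun t : ℝ => (t : ℂ) * z) (𝓝 0) (𝓝 (((0 : ℝ) : ℂ) * z)) :=
    (by fun_prop : Continuous fun t : ℝ => (t : ℂ) * z).tendsto 0
  simpa using this.mono_left nhdsWithin_le_nhds

/-- Polylogarithms of words with a nonzero letter vanish at `0`, even against other ones. -/
lemma tendsto_GPL_mul_zero {N : ℕ} (hN : 0 < N) {u v : List ℂ} (hu : IsWord N u)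
    (hv : IsWord N v) (h : ¬ IsZeroWord u) {ι : Type*} {l : Filter ι} {γ : ι → ℂ}
    (hγ : Tendsto γ l (𝓝 0)) (hγ0 : ∀ᶠ s in l, γ s ≠ 0) :
    Tendsto (fun s => GPL u (γ s) * GPL v (γ s)) l (𝓝 0) := by
  obtain ⟨C, hC, hb⟩ := exists_norm_GPL_le_sqrt hN hu h
  obtain ⟨D, hD, hb'⟩ := exists_norm_GPL_le_fourth_root hN hv
  have hsl : Tendsto (fun s => C * D * √(√‖γ s‖)) l (𝓝 0) := by
    have h1 : Tendsto (fun w : ℂ => C * D * √(√‖w‖)) (𝓝 0) (𝓝 (C * D * √(√‖(0 : ℂ)‖))) :=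
      (by fun_prop : Continuous fun w : ℂ => C * D * √(√‖w‖)).tendsto 0
    simpa [Function.comp_def] using h1.comp hγ
  refine squeeze_zero_norm' ?_ hsl
  have hsm : ∀ᶠ s in l, ‖γ s‖ ≤ 1 / 2 := by
    have := hγ (Metric.closedBall_mem_nhds (0 : ℂ) (by norm_num : (0 : ℝ) < 1 / 2))
    filter_upwards [this] with s hs
    simpa using hs
  filter_upwards [hγ0, hsm] with s h0 h1
  have hr : 0 < ‖γ s‖ := norm_pos_iff.2 h0
  have h5 : 0 < √(√‖γ s‖) := by positivity
  rw [norm_mul]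
  calc ‖GPL u (γ s)‖ * ‖GPL v (γ s)‖ ≤ (C * √‖γ s‖) * (D / √(√‖γ s‖)) := by
        gcongr
        · exact hb _ h0 h1
        · exact hb' _ h0 h1
    _ = C * D * √(√‖γ s‖) := by
        nth_rewrite 1 [← Real.sq_sqrt (Real.sqrt_nonneg ‖γ s‖)]
        field_simp

lemma tendsto_GPL_zero {N : ℕ} (hN : 0 < N) {u : List ℂ} (hu : IsWord N u)
    (h : ¬ IsZeroWord u) {ι : Type*} {l : Filter ι} {γ : ι → ℂ}
    (hγ : Tendsto γ l (𝓝 0)) (hγ0 : ∀ᶠ s in l, γ s ≠ 0) :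
    Tendsto (fun s => GPL u (γ s)) l (𝓝 0) := by
  have := tendsto_GPL_mul_zero hN hu (v := []) (by simp [IsWord]) h hγ hγ0
  simpa [GPL_nil] using this

lemma hasDerivAt_list_sum {ι : Type*} (L : List ι) {f : ι → ℂ → ℂ} {f' : ι → ℂ} {z : ℂ}
    (h : ∀ i ∈ L, HasDerivAt (f i) (f' i) z) :
    HasDerivAt (fun w => (L.map fun i => f i w).sum) ((L.map f').sum) z := by
  induction L with
  | nil => simpa using hasDerivAt_const z (0 : ℂ)
  | cons i L ih =>
    simp only [List.map_cons, List.sum_cons]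
    exact (h i List.mem_cons_self).add (ih fun j hj => h j (List.mem_cons_of_mem _ hj))

lemma tendsto_list_sum_zero {ι κ : Type*} (L : List ι) {f : ι → κ → ℂ} {l : Filter κ}
    (h : ∀ i ∈ L, Tendsto (f i) l (𝓝 0)) :
    Tendsto (fun w => (L.map fun i => f i w).sum) l (𝓝 0) := by
  induction L with
  | nil => simpa using tendsto_const_nhds
  | cons i L ih =>
    simp only [List.map_cons, List.sum_cons]
    simpa using (h i List.mem_cons_self).add (ih fun j hj => h j (List.mem_cons_of_mem _ hj))

lemma list_sum_map_div {ι : Type*} (L : List ι) (f : ι → ℂ) (c : ℂ) :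
    (L.map fun i => f i / c).sum = (L.map f).sum / c := by
  simp only [div_eq_mul_inv, List.sum_map_mul_right]

/-- The shuffle product of generalized polylogarithms. -/
theorem GPL_mul_GPL {N : ℕ} (hN : 0 < N) (u v : List ℂ) (hu : IsWord N u) (hv : IsWord N v) :
    ∀ z ∈ Dom N, GPL u z * GPL v z = ((shuffle u v).map fun x => GPL x z).sum := by
  induction u, v using shuffle.induct with
  | case1 v => intro z hz; simp [shuffle_nil_left, GPL_nil]
  | case2 a u => intro z hz; simp [shuffle_nil_right, GPL_nil]
  | case3 a u b v ih1 ih2 =>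
    intro z hz
    -- Both sides will be compared through their limits at `0`; words of zeros have no finite limit
    -- there and are computed directly.
    by_cases hzero : IsZeroWord ((a :: u) ++ (b :: v))
    · have hu0 : IsZeroWord (a :: u) := fun β hβ => hzero β (List.mem_append_left _ hβ)
      have hv0 : IsZeroWord (b :: v) := fun β hβ => hzero β (List.mem_append_right _ hβ)
      set m := (a :: u).length with hm
      set n := (b :: v).length with hn
      have h1 : ∀ x ∈ shuffle (a :: u) (b :: v),
          GPL x z = Complex.log z ^ (m + n) / ((m + n).factorial : ℂ) := by
        intro x hx
        have hp := perm_of_mem_shuffle _ _ x hx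
        rw [GPL_of_isZeroWord (fun β hβ => hzero β (hp.mem_iff.1 hβ)), hp.length_eq,
          List.length_append]
      rw [List.map_congr_left h1, List.map_const', List.sum_replicate, length_shuffle,
        GPL_of_isZeroWord hu0, GPL_of_isZeroWord hv0, ← hm, ← hn, nsmul_eq_mul]
      have hf := Nat.add_choose_mul_factorial_mul_factorial m n
      rw [← Nat.choose_symm_add] at hf
      have h2 : ((m.factorial : ℕ) : ℂ) ≠ 0 := by exact_mod_cast m.factorial_ne_zero
      have h3 : ((n.factorial : ℕ) : ℂ) ≠ 0 := by exact_mod_cast n.factorial_ne_zero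
      rw [← hf]
      have h4 : (((m + n).choose m : ℕ) : ℂ) ≠ 0 := by
        exact_mod_cast (Nat.choose_pos (Nat.le_add_right m n)).ne'
      push_cast
      rw [pow_add]
      field_simp
    -- By the product rule and the two induction hypotheses, the difference of the two sides has
    -- derivative zero. It tends to `0` at the origin because some letter is nonzero.
    · have hd : ∀ w ∈ Dom N, HasDerivAt (fun w => GPL (a :: u) w * GPL (b :: v) w -
          ((shuffle (a :: u) (b :: v)).map fun x => GPL x w).sum) 0 w := by
        intro w hw
        have e1 := (hasDerivAt_GPL_cons hN hu hw).mul (hasDerivAt_GPL_cons hN hv hw)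
        have e2 := hasDerivAt_list_sum (shuffle u (b :: v)) (f := fun x => GPL (a :: x))
          (f' := fun x => GPL x w / (w - a)) (z := w)
          (fun x hx => hasDerivAt_GPL_cons hN ((hu.tail.of_mem_shuffle hv hx).cons hu.head) hw)
        have e3 := hasDerivAt_list_sum (shuffle (a :: u) v) (f := fun x => GPL (b :: x))
          (f' := fun x => GPL x w / (w - b)) (z := w)
          (fun x hx => hasDerivAt_GPL_cons hN ((hu.of_mem_shuffle hv.tail hx).cons hv.head) hw)
        have e4 := e1.sub (e2.add e3)
        rw [list_sum_map_div, list_sum_map_div, ← ih1 hu.tail hv w hw, ← ih2 hu hv.tail w hw] at e4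
        have e5 : GPL u w / (w - a) * GPL (b :: v) w + GPL (a :: u) w * (GPL v w / (w - b)) -
            (GPL u w * GPL (b :: v) w / (w - a) + GPL (a :: u) w * GPL v w / (w - b)) = 0 := by
          ring
        rw [e5] at e4
        refine e4.congr_of_eventuallyEq (Eventually.of_forall fun x => ?_)
        simp only [shuffle_cons_cons, List.map_append, List.map_map, List.sum_append,
          Pi.sub_apply, Pi.add_apply, Pi.mul_apply]
        rfl
      have hray : ∀ t : ℝ, 0 < t → t ≤ 1 → HasDerivAt (fun t : ℝ => GPL (a :: u) (t * z) *
          GPL (b :: v) (t * z) - ((shuffle (a :: u) (b :: v)).map fun x => GPL x (t * z)).sum)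
          0 t := by
        intro t h0 h1
        have e0 : HasDerivAt (fun t : ℝ => (t : ℂ)) 1 t := Complex.ofRealCLM.hasDerivAt
        have e1 : HasDerivAt (fun t : ℝ => (t : ℂ) * z) z t := by simpa using e0.mul_const z
        have e2 := HasDerivAt.comp_of_eq t (hd _ (Dom.smul_mem hz h0 h1)) e1 rfl
        exact e2.congr_deriv (by simp)
      have hz0 : ∀ᶠ t : ℝ in 𝓝[>] 0, (t : ℂ) * z ≠ 0 := by
        filter_upwards [self_mem_nhdsWithin] with t ht
        exact mul_ne_zero (by exact_mod_cast (ne_of_gt ht)) (Dom.ne_zero hz)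
      have hlim : Tendsto (fun t : ℝ => GPL (a :: u) (t * z) * GPL (b :: v) (t * z) -
          ((shuffle (a :: u) (b :: v)).map fun x => GPL x (t * z)).sum) (𝓝[>] 0) (𝓝 0) := by
        have l1 : Tendsto (fun t : ℝ => GPL (a :: u) (t * z) * GPL (b :: v) (t * z))
            (𝓝[>] 0) (𝓝 0) := by
          by_cases h : IsZeroWord (a :: u)
          · have h' : ¬ IsZeroWord (b :: v) := fun h' =>
              hzero fun β hβ => (List.mem_append.1 hβ).elim (h β) (h' β)
            refine (tendsto_GPL_mul_zero hN hv hu h' tendsto_ray_zero hz0).congr fun t => ?_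
            ring
          · exact tendsto_GPL_mul_zero hN hu hv h tendsto_ray_zero hz0
        have l2 := tendsto_list_sum_zero (shuffle (a :: u) (b :: v))
          (f := fun x (t : ℝ) => GPL x (t * z)) (l := 𝓝[>] 0) (by
            intro x hx
            refine tendsto_GPL_zero hN (hu.of_mem_shuffle hv hx) (fun h => hzero fun β hβ => ?_)
              tendsto_ray_zero hz0
            exact h β ((perm_of_mem_shuffle _ _ x hx).mem_iff.2 hβ))
        simpa using l1.sub l2
      have := eq_of_hasDerivAt_zero_of_tendsto hray hlim
      simp only [Complex.ofReal_one, one_mul] at this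
      exact sub_eq_zero.1 this

/-! ### Behaviour at the end point 1 -/

lemma sqrt_prod_pos {t : ℝ} (h0 : 0 < t) (h1 : t < 1) : 0 < √t * √(1 - t) :=
  mul_pos (Real.sqrt_pos.2 h0) (Real.sqrt_pos.2 (by linarith))

/-- The weight dominating the integrands of polylogarithms near the end point `1`. -/
noncomputable def weight (t : ℝ) : ℝ := t ^ (-(1 / 2 : ℝ)) + (1 - t) ^ (-(3 / 4 : ℝ))

lemma intervalIntegrable_weight : IntervalIntegrable weight MeasureTheory.volume 0 1 := by
  have i1 : IntervalIntegrable (fun t : ℝ => t ^ (-(1 / 2 : ℝ))) MeasureTheory.volume 0 1 :=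
    intervalIntegral.intervalIntegrable_rpow' (by norm_num)
  have i2 : IntervalIntegrable (fun t : ℝ => (1 - t) ^ (-(3 / 4 : ℝ)))
      MeasureTheory.volume 0 1 := by
    have := (intervalIntegral.intervalIntegrable_rpow' (a := 0) (b := 1) (r := -(3 / 4 : ℝ))
      (by norm_num)).comp_sub_left 1
    simpa using this.symm
  exact i1.add i2

lemma weight_nonneg {t : ℝ} (h0 : 0 ≤ t) (h1 : t ≤ 1) : 0 ≤ weight t := by
  have : 0 ≤ 1 - t := by linarith
  unfold weight; positivity

lemma rpow_neg_le_two {t a : ℝ} (h : 1 / 2 ≤ t) (ha0 : 0 ≤ a) (ha : a ≤ 1) : t ^ (-a) ≤ 2 := by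
  calc t ^ (-a) ≤ (1 / 2 : ℝ) ^ (-a) :=
        Real.rpow_le_rpow_of_nonpos (by norm_num) h (by linarith)
    _ = 2 ^ a := by rw [Real.rpow_neg (by norm_num), one_div, Real.inv_rpow (by norm_num), inv_inv]
    _ ≤ 2 ^ (1 : ℝ) := Real.rpow_le_rpow_of_exponent_le (by norm_num) ha
    _ = 2 := Real.rpow_one 2

/-- On each half of `(0, 1)` only one of the two factors is singular, and the other is at most `2`.
-/
lemma one_div_sqrt_mul_le_weight {t : ℝ} (h0 : 0 < t) (h1 : t < 1) :
    1 / (√t * √(1 - t)) * (1 - t) ^ (-(1 / 4 : ℝ)) ≤ 2 * weight t := by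
  have hk : 0 < 1 - t := by linarith
  have e : 1 / (√t * √(1 - t)) * (1 - t) ^ (-(1 / 4 : ℝ)) =
      t ^ (-(1 / 2 : ℝ)) * (1 - t) ^ (-(3 / 4 : ℝ)) := by
    rw [show -(3 / 4 : ℝ) = -(1 / 2) + -(1 / 4) by norm_num, Real.rpow_add hk,
      Real.rpow_neg h0.le, Real.rpow_neg hk.le (1 / 2), ← Real.sqrt_eq_rpow, ← Real.sqrt_eq_rpow]
    rw [one_div, mul_inv, mul_assoc]
  rw [e]
  have p1 : 0 ≤ t ^ (-(1 / 2 : ℝ)) := by positivity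
  have p2 : 0 ≤ (1 - t) ^ (-(3 / 4 : ℝ)) := by positivity
  unfold weight
  rcases le_total t (1 / 2) with h | h
  · have := rpow_neg_le_two (t := 1 - t) (a := 3 / 4) (by linarith) (by norm_num) (by norm_num)
    nlinarith
  · have := rpow_neg_le_two (t := t) (a := 1 / 2) h (by norm_num) (by norm_num)
    nlinarith

lemma one_div_sqrt_le_weight {t : ℝ} (h0 : 0 < t) (h1 : t < 1) :
    1 / (√t * √(1 - t)) ≤ 2 * weight t := by
  refine le_trans ?_ (one_div_sqrt_mul_le_weight h0 h1)
  refine le_mul_of_one_le_right (by positivity) ?_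
  exact Real.one_le_rpow_of_pos_of_le_one_of_nonpos (by linarith) (by linarith) (by norm_num)

/-- The growth bound made uniform in the end point `q`, which may lie on the unit circle itself;
this permits domination of the integrals while `q` tends to `1`. -/
lemma exists_norm_GPL_ray_le {N : ℕ} (hN : 0 < N) {u : List ℂ} (hu : IsWord N u) :
    ∃ C : ℝ, 0 ≤ C ∧ ∀ q : ℂ, 1 / 2 ≤ ‖q‖ → ‖q‖ ≤ 1 → ∀ t : ℝ, 0 < t → t < 1 →
      ‖GPL u (t * q)‖ ≤ C * (1 / (√t * √(1 - t))) ∧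
      (¬ IsZeroWord u → ‖GPL u (t * q)‖ / t ≤ C * (1 / (√t * √(1 - t)))) := by
  obtain ⟨C, hC, hb⟩ := exists_growthBound hN u hu
  refine ⟨C * 2, by positivity, fun q h1 h2 t h0 ht => ?_⟩
  have hq0 : q ≠ 0 := norm_pos_iff.1 (by linarith)
  have hn := norm_ofReal_mul h0.le q
  have htq : (t : ℂ) * q ≠ 0 := mul_ne_zero (by exact_mod_cast h0.ne') hq0
  have hle : t * ‖q‖ ≤ t := mul_le_of_le_one_right h0.le h2
  have hb' := hb _ htq (by rw [hn]; linarith)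
  rw [hn] at hb'
  have hst : 0 < √t := Real.sqrt_pos.2 h0
  have hst1 : √t ≤ 1 := Real.sqrt_le_one.2 ht.le
  have hk : 0 < √(1 - t) := Real.sqrt_pos.2 (by linarith)
  have hk1 : √(1 - t) ≤ 1 := Real.sqrt_le_one.2 (by linarith)
  have hn1 : √(t * ‖q‖) / √(1 - t * ‖q‖) ≤ √t / √(1 - t) := by gcongr
  have key : ¬ IsZeroWord u → ‖GPL u (t * q)‖ ≤ C * (√t / √(1 - t)) := fun h =>
    (hb'.2 h).trans (by gcongr)
  refine ⟨?_, fun h => ?_⟩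
  · by_cases h : IsZeroWord u
    · refine (hb'.1 h).trans ?_
      have h3 : √t / 2 ≤ √(t * ‖q‖) := by
        apply Real.le_sqrt_of_sq_le
        rw [div_pow, Real.sq_sqrt h0.le]; nlinarith
      calc C / √(t * ‖q‖) ≤ C / (√t / 2) := by gcongr
        _ = C * 2 * (1 / (√t * 1)) := by field_simp
        _ ≤ C * 2 * (1 / (√t * √(1 - t))) := by gcongr
    · refine (key h).trans ?_
      rw [mul_assoc]
      refine mul_le_mul_of_nonneg_left ?_ hC
      have h3 : √t / √(1 - t) ≤ 1 / (√t * √(1 - t)) := by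
        rw [div_le_div_iff₀ hk (by positivity), ← mul_assoc, Real.mul_self_sqrt h0.le]
        nlinarith
      have : 0 < 1 / (√t * √(1 - t)) := by positivity
      linarith
  · have h3 := key h
    calc ‖GPL u (t * q)‖ / t ≤ C * (√t / √(1 - t)) / t := by gcongr
      _ = C * (1 / (√t * √(1 - t))) := by
        have : √t / √(1 - t) / t = 1 / (√t * √(1 - t)) := by
          field_simp; exact Real.sq_sqrt h0.le
        rw [← this]; ring
      _ ≤ C * 2 * (1 / (√t * √(1 - t))) := by
        rw [mul_assoc]
        refine mul_le_mul_of_nonneg_left ?_ hC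
        have : 0 < 1 / (√t * √(1 - t)) := by positivity
        linarith

/-- A letter of modulus one other than `1` lies off the compact segment `[0, 1]`. -/
lemma exists_dist_letter_pos {α : ℂ} (hα : ‖α‖ = 1) (h1 : α ≠ 1) :
    ∃ d : ℝ, 0 < d ∧ ∀ t : ℝ, 0 ≤ t → t ≤ 1 → d ≤ ‖(t : ℂ) - α‖ := by
  obtain ⟨s, hs, hmin⟩ := isCompact_Icc.exists_isMinOn (Set.nonempty_Icc.2 (zero_le_one (α := ℝ)))
    (f := fun t : ℝ => ‖(t : ℂ) - α‖) (by fun_prop)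
  refine ⟨‖(s : ℂ) - α‖, ?_, fun t h0 h1 => hmin ⟨h0, h1⟩⟩
  rw [norm_pos_iff, sub_ne_zero]
  rintro rfl
  rw [Complex.norm_real, Real.norm_of_nonneg hs.1] at hα
  exact h1 (by rw [hα]; simp)

/-- Domination of the integrand when the first letter is not `1`. -/
lemma exists_norm_integrand_le {N : ℕ} (hN : 0 < N) {α : ℂ} {u : List ℂ}
    (hu : IsWord N (α :: u)) (hne : ¬ IsZeroWord (α :: u)) (hα1 : α ≠ 1) :
    ∃ C δ : ℝ, 0 ≤ C ∧ 0 < δ ∧ δ ≤ 1 / 2 ∧ ∀ q : ℂ, ‖q‖ ≤ 1 → ‖q - 1‖ ≤ δ → ∀ t : ℝ,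
      0 < t → t < 1 → ‖q / (t * q - α) * GPL u (t * q)‖ ≤ C * (1 / (√t * √(1 - t))) := by
  obtain ⟨C, hC, hb⟩ := exists_norm_GPL_ray_le hN hu.tail
  have hhalf : ∀ q : ℂ, ‖q - 1‖ ≤ 1 / 2 → 1 / 2 ≤ ‖q‖ := fun q hq => by
    have := norm_sub_norm_le (1 : ℂ) q
    rw [norm_one, norm_sub_rev] at this
    linarith
  by_cases hα : α = 0
  · subst hα
    refine ⟨C, 1 / 2, hC, by norm_num, le_rfl, fun q h1 h2 t h0 ht => ?_⟩
    have hq := hhalf q h2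
    have hq0 : q ≠ 0 := norm_pos_iff.1 (by linarith)
    have htc : (t : ℂ) ≠ 0 := by exact_mod_cast h0.ne'
    have h3 := (hb q hq h1 t h0 ht).2 (fun h => hne (isZeroWord_cons.2 ⟨rfl, h⟩))
    have e : q / (t * q - 0) * GPL u (t * q) = GPL u (t * q) / t := by field_simp; ring
    rw [e, norm_div, Complex.norm_real, Real.norm_of_nonneg h0.le]
    exact h3
  · obtain ⟨d, hd, hdb⟩ := exists_dist_letter_pos (norm_eq_one_of_letter hN hu.head hα) hα1
    refine ⟨2 / d * C, min (1 / 2) (d / 2), by positivity, by positivity, min_le_left _ _,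
      fun q h1 h2 t h0 ht => ?_⟩
    have hq := hhalf q (h2.trans (min_le_left _ _))
    have h3 := (hb q hq h1 t h0 ht).1
    have h4 : d / 2 ≤ ‖(t : ℂ) * q - α‖ := by
      have e : (t : ℂ) - α = (t * q - α) - t * (q - 1) := by ring
      have h5 := norm_sub_le ((t : ℂ) * q - α) (t * (q - 1))
      rw [← e, norm_ofReal_mul h0.le] at h5
      have h6 := hdb t h0.le ht.le
      have h7 : t * ‖q - 1‖ ≤ 1 * (d / 2) :=
        mul_le_mul ht.le (h2.trans (min_le_right _ _)) (norm_nonneg _) zero_le_one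
      linarith
    rw [norm_mul, norm_div, mul_assoc]
    refine mul_le_mul ?_ h3 (norm_nonneg _) (by positivity)
    calc ‖q‖ / ‖(t : ℂ) * q - α‖ ≤ 1 / (d / 2) := by gcongr
      _ = 2 / d := by field_simp

lemma norm_one_sub_le {q : ℂ} (hq : ‖q‖ ≤ 1) {t : ℝ} (h0 : 0 ≤ t) (h1 : t ≤ 1) :
    1 - t ≤ ‖(t : ℂ) * q - 1‖ ∧ ‖q - 1‖ / 2 ≤ ‖(t : ℂ) * q - 1‖ := by
  have a1 : 1 - t ≤ ‖(t : ℂ) * q - 1‖ := by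
    have := norm_sub_norm_le (1 : ℂ) ((t : ℂ) * q)
    rw [norm_one, norm_sub_rev, norm_ofReal_mul h0] at this
    nlinarith
  refine ⟨a1, ?_⟩
  have e : q - 1 = (t * q - 1) + ((1 - t : ℝ) : ℂ) * q := by push_cast; ring
  have h2 := norm_add_le ((t : ℂ) * q - 1) (((1 - t : ℝ) : ℂ) * q)
  rw [← e, norm_ofReal_mul (by linarith)] at h2
  nlinarith [norm_nonneg q]

/-- Growth of polylogarithms near `1` in the closed unit disc. -/
lemma exists_norm_GPL_le_near_one {N : ℕ} (hN : 0 < N) {u : List ℂ} (hu : IsWord N u) :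
    ∃ C δ : ℝ, 0 ≤ C ∧ 0 < δ ∧ δ ≤ 1 / 2 ∧ ∀ q : ℂ, ‖q‖ ≤ 1 → ‖q - 1‖ ≤ δ → q ≠ 1 →
      ‖GPL u q‖ ≤ C * ‖q - 1‖ ^ (-(3 / 4 : ℝ)) := by
  have hone : ∀ q : ℂ, ‖q - 1‖ ≤ 1 / 2 → q ≠ 1 → 1 ≤ ‖q - 1‖ ^ (-(3 / 4 : ℝ)) := fun q hq h1 =>
    Real.one_le_rpow_of_pos_of_le_one_of_nonpos (norm_pos_iff.2 (sub_ne_zero.2 h1))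
      (by linarith) (by norm_num)
  have hhalf : ∀ q : ℂ, ‖q - 1‖ ≤ 1 / 2 → 1 / 2 ≤ ‖q‖ := fun q hq => by
    have := norm_sub_norm_le (1 : ℂ) q
    rw [norm_one, norm_sub_rev] at this
    linarith
  have hinteg := intervalIntegrable_weight
  have hwnn : 0 ≤ ∫ t in (0 : ℝ)..1, weight t :=
    intervalIntegral.integral_nonneg zero_le_one fun t ht => weight_nonneg ht.1 ht.2
  by_cases hz : IsZeroWord u
  · obtain ⟨C, hC, hb⟩ := exists_norm_log_pow_le u.length
    refine ⟨C * 2, 1 / 2, by positivity, by norm_num, le_rfl, fun q h1 h2 h3 => ?_⟩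
    have hq := hhalf q h2
    have hq0 : q ≠ 0 := norm_pos_iff.1 (by linarith)
    have h4 : (1 / 2 : ℝ) ≤ √‖q‖ := Real.le_sqrt_of_sq_le (by linarith)
    calc ‖GPL u q‖ ≤ ‖Complex.log q‖ ^ u.length := by
          rw [GPL_of_isZeroWord hz, norm_div, norm_pow]
          refine div_le_self (by positivity) ?_
          rw [Complex.norm_natCast]
          exact_mod_cast Nat.one_le_iff_ne_zero.2 (Nat.factorial_ne_zero _)
      _ ≤ C / √‖q‖ := hb q hq0 h1
      _ ≤ C / (1 / 2) := by gcongr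
      _ = C * 2 * 1 := by ring
      _ ≤ C * 2 * ‖q - 1‖ ^ (-(3 / 4 : ℝ)) := by gcongr; exact hone q h2 h3
  · cases u with
    | nil => exact absurd isZeroWord_nil hz
    | cons α u =>
      by_cases hα : α = 1
      · subst hα
        obtain ⟨C, hC, hb⟩ := exists_norm_GPL_ray_le hN hu.tail
        refine ⟨C * 2 * (∫ t in (0 : ℝ)..1, weight t) * 2, 1 / 2, by positivity, by norm_num,
          le_rfl, fun q h1 h2 h3 => ?_⟩
        have hq := hhalf q h2
        have hp : 0 < ‖q - 1‖ := norm_pos_iff.2 (sub_ne_zero.2 h3)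
        set K := ‖q - 1‖ ^ (-(3 / 4 : ℝ)) with hK
        have hKp : 0 < K := by positivity
        rw [GPL_cons hz]
        have : C * 2 * (∫ t in (0 : ℝ)..1, weight t) * 2 * K =
            ∫ t in (0 : ℝ)..1, (C * 2 * 2 * K) * weight t := by
          rw [intervalIntegral.integral_const_mul]; ring
        rw [this]
        refine intervalIntegral.norm_integral_le_of_norm_le zero_le_one ?_ (hinteg.const_mul _)
        have hne1 : ∀ᵐ t : ℝ, t ≠ 1 := MeasureTheory.Measure.ae_ne _ _
        filter_upwards [hne1] with t ht1 ht
        have htlt : t < 1 := lt_of_le_of_ne ht.2 ht1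
        have hk : 0 < 1 - t := by linarith
        obtain ⟨d1, d2⟩ := norm_one_sub_le h1 ht.1.le ht.2
        have hdp : 0 < ‖(t : ℂ) * q - 1‖ := by linarith
        -- Interpolation between the two lower bounds for `‖t q - 1‖`: the power `1/4` goes to `1 -
        -- t`, which together with `1/√(1-t)` stays integrable, and the power `3/4` goes to `‖q -
        -- 1‖` and leaves the integral.
        have d3 : 1 / ‖(t : ℂ) * q - 1‖ ≤ (1 - t) ^ (-(1 / 4 : ℝ)) * (2 * K) := by
          have e : 1 / ‖(t : ℂ) * q - 1‖ =
              ‖(t : ℂ) * q - 1‖ ^ (-(1 / 4 : ℝ)) * ‖(t : ℂ) * q - 1‖ ^ (-(3 / 4 : ℝ)) := by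
            rw [← Real.rpow_add hdp, show -(1 / 4 : ℝ) + -(3 / 4) = -1 by norm_num,
              Real.rpow_neg_one, one_div]
          rw [e]
          have f1 : ‖(t : ℂ) * q - 1‖ ^ (-(1 / 4 : ℝ)) ≤ (1 - t) ^ (-(1 / 4 : ℝ)) :=
            Real.rpow_le_rpow_of_nonpos hk d1 (by norm_num)
          have f2 : ‖(t : ℂ) * q - 1‖ ^ (-(3 / 4 : ℝ)) ≤ 2 * K := by
            calc _ ≤ (‖q - 1‖ / 2) ^ (-(3 / 4 : ℝ)) :=
                  Real.rpow_le_rpow_of_nonpos (by positivity) d2 (by norm_num)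
              _ = (1 / 2 : ℝ) ^ (-(3 / 4 : ℝ)) * K := by
                  rw [div_eq_mul_one_div, mul_comm, Real.mul_rpow (by norm_num) hp.le]
              _ ≤ 2 * K := by
                  gcongr
                  exact rpow_neg_le_two le_rfl (by norm_num) (by norm_num)
          exact mul_le_mul f1 f2 (by positivity) (by positivity)
        have h4 := (hb q hq h1 t ht.1 htlt).1
        have h5 := one_div_sqrt_mul_le_weight ht.1 htlt
        have hsp := sqrt_prod_pos ht.1 htlt
        calc ‖q / (t * q - 1) * GPL u (t * q)‖
            = ‖q‖ * (1 / ‖(t : ℂ) * q - 1‖) * ‖GPL u (t * q)‖ := by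
              rw [norm_mul, norm_div]; ring
          _ ≤ 1 * ((1 - t) ^ (-(1 / 4 : ℝ)) * (2 * K)) * (C * (1 / (√t * √(1 - t)))) := by gcongr
          _ = C * (2 * K) * (1 / (√t * √(1 - t)) * (1 - t) ^ (-(1 / 4 : ℝ))) := by ring
          _ ≤ C * (2 * K) * (2 * weight t) := by gcongr
          _ = C * 2 * 2 * K * weight t := by ring
      · obtain ⟨C, δ, hC, hδ, hδ2, hb⟩ := exists_norm_integrand_le hN hu hz hα
        refine ⟨C * 2 * ∫ t in (0 : ℝ)..1, weight t, δ, by positivity, hδ, hδ2,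
          fun q h1 h2 h3 => ?_⟩
        refine le_trans ?_ (le_mul_of_one_le_right (by positivity) (hone q (h2.trans hδ2) h3))
        rw [GPL_cons hz, ← intervalIntegral.integral_const_mul]
        refine intervalIntegral.norm_integral_le_of_norm_le zero_le_one ?_ (hinteg.const_mul _)
        have hne1 : ∀ᵐ t : ℝ, t ≠ 1 := MeasureTheory.Measure.ae_ne _ _
        filter_upwards [hne1] with t ht1 ht
        have htlt : t < 1 := lt_of_le_of_ne ht.2 ht1
        refine (hb q h1 h2 t ht.1 htlt).trans ?_
        rw [mul_assoc]
        gcongr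
        exact one_div_sqrt_le_weight ht.1 htlt

lemma ray_mem_Dom {N : ℕ} (hN : 0 < N) {q : ℂ} (h1 : ‖q‖ ≤ 1) (h2 : q ∈ Complex.slitPlane)
    {t : ℝ} (h0 : 0 < t) (ht : t < 1) : (t : ℂ) * q ∈ Dom N := by
  refine mem_Dom_of_norm_lt hN ?_ ?_
  · rw [Complex.mem_slitPlane_iff]
    rcases (Complex.mem_slitPlane_iff.1 h2) with h | h
    · left; simpa using mul_pos h0 h
    · right; simpa using ⟨h0.ne', h⟩
  · rw [norm_ofReal_mul h0.le]; nlinarith [norm_nonneg q]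

/-- Continuity at `1`, from within the closed disc, for words whose first letter is not `1`. -/
lemma continuousWithinAt_GPL_one {N : ℕ} (hN : 0 < N) {u : List ℂ} (hu : IsWord N u)
    (hhead : u.head? ≠ some 1) : ContinuousWithinAt (GPL u) {q | ‖q‖ ≤ 1} 1 := by
  have hslit : Complex.slitPlane ∈ 𝓝 (1 : ℂ) :=
    Complex.isOpen_slitPlane.mem_nhds Complex.one_mem_slitPlane
  by_cases hz : IsZeroWord u
  · have : GPL u = fun z => Complex.log z ^ u.length / (u.length.factorial : ℂ) := by
      funext z; exact GPL_of_isZeroWord hz z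
    rw [this]
    exact (((continuousAt_clog Complex.one_mem_slitPlane).pow _).div_const _).continuousWithinAt
  · cases u with
    | nil => exact absurd isZeroWord_nil hz
    | cons α u =>
      have hα : α ≠ 1 := by simpa using hhead
      obtain ⟨C, δ, hC, hδ, hδ2, hb⟩ := exists_norm_integrand_le hN hu hz hα
      have e : GPL (α :: u) = fun q => ∫ t in (0 : ℝ)..1, q / (t * q - α) * GPL u (t * q) := by
        funext q; exact GPL_cons hz q
      unfold ContinuousWithinAt
      rw [e]
      have hball : ∀ᶠ q in 𝓝[{q : ℂ | ‖q‖ ≤ 1}] (1 : ℂ), ‖q - 1‖ ≤ δ := by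
        filter_upwards [mem_nhdsWithin_of_mem_nhds (Metric.closedBall_mem_nhds (1 : ℂ) hδ)]
          with q hq
        rwa [Metric.mem_closedBall, dist_eq_norm] at hq
      have hne1 : ∀ᵐ t : ℝ, t ≠ 1 := MeasureTheory.Measure.ae_ne _ _
      refine intervalIntegral.tendsto_integral_filter_of_dominated_convergence
        (fun t => C * 2 * weight t) ?_ ?_ (intervalIntegrable_weight.const_mul _) ?_
      · filter_upwards [self_mem_nhdsWithin, mem_nhdsWithin_of_mem_nhds hslit] with q h1 h2
        -- At `t = 1` the ray reaches `q`, which may be a root of unity and so outside the domain;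
        -- the end point is discarded as a null set.
        rw [Set.uIoc_of_le zero_le_one, ← MeasureTheory.Measure.restrict_congr_set
          MeasureTheory.Ioo_ae_eq_Ioc]
        refine ContinuousOn.aestronglyMeasurable ?_ measurableSet_Ioo
        have hm : Set.MapsTo (fun t : ℝ => (t : ℂ) * q) (Set.Ioo 0 1) (Dom N) :=
          fun t ht => ray_mem_Dom hN h1 h2 ht.1 ht.2
        refine ContinuousOn.mul (continuousOn_const.div (by fun_prop) ?_)
          ((continuousOn_GPL hN hu.tail).comp (by fun_prop) hm)
        intro t ht
        exact Dom.ne_letter (hm ht) hu.head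
      · filter_upwards [self_mem_nhdsWithin, hball] with q h1 h2
        filter_upwards [hne1] with t ht1 ht
        rw [Set.uIoc_of_le zero_le_one] at ht
        have htlt : t < 1 := lt_of_le_of_ne ht.2 ht1
        refine (hb q h1 h2 t ht.1 htlt).trans ?_
        rw [mul_assoc]
        gcongr
        exact one_div_sqrt_le_weight ht.1 htlt
      · filter_upwards [hne1] with t ht1 ht
        rw [Set.uIoc_of_le zero_le_one] at ht
        have htlt : t < 1 := lt_of_le_of_ne ht.2 ht1
        have hD : (t : ℂ) * 1 ∈ Dom N :=
          ray_mem_Dom hN (by simp) Complex.one_mem_slitPlane ht.1 htlt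
        have hc : ContinuousAt (fun q : ℂ => q / (t * q - α) * GPL u (t * q)) 1 := by
          have c1 : ContinuousAt (fun q : ℂ => (t : ℂ) * q) 1 := by fun_prop
          have c2 : ContinuousAt (fun q : ℂ => GPL u (t * q)) 1 :=
            ContinuousAt.comp (f := fun q : ℂ => (t : ℂ) * q) (g := GPL u)
              ((continuousOn_GPL hN hu.tail).continuousAt ((isOpen_Dom N).mem_nhds hD)) c1
          exact (continuousAt_id.div (c1.sub continuousAt_const) (Dom.ne_letter hD hu.head)).mul c2
        exact hc.tendsto.mono_left nhdsWithin_le_nhds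

/-- Hölder continuity at `1`, from within the closed disc, for words whose first letter is
not `1`. -/
lemma exists_norm_GPL_sub_le {N : ℕ} (hN : 0 < N) {α : ℂ} {u : List ℂ} (hu : IsWord N (α :: u))
    (hα : α ≠ 1) : ∃ C δ : ℝ, 0 ≤ C ∧ 0 < δ ∧ ∀ q : ℂ, ‖q‖ ≤ 1 → ‖q - 1‖ ≤ δ → q ∈ Dom N →
      ‖GPL (α :: u) q - GPL (α :: u) 1‖ ≤ C * ‖q - 1‖ ^ (1 / 4 : ℝ) := by
  obtain ⟨C, δ, hC, hδ, hδ2, hb⟩ := exists_norm_GPL_le_near_one hN hu.tail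
  set d := ‖1 - α‖ with hd
  have hdp : 0 < d := norm_pos_iff.2 (sub_ne_zero.2 hα.symm)
  refine ⟨4 * (C * (2 / d)), min δ (d / 2), by positivity, by positivity, fun q h1 h2 hq => ?_⟩
  by_cases hq1 : q = 1
  · subst hq1; simp
  have hp : 0 < ‖q - 1‖ := norm_pos_iff.2 (sub_ne_zero.2 hq1)
  -- The segment from `1` to `q` runs inside the open disc by strict convexity, except at its ends.
  -- Along it the derivative is `O(‖q - 1‖^{1/4} τ^{-3/4})`, which is integrable at `τ = 0`.
  set z : ℝ → ℂ := fun τ => 1 + τ * (q - 1) with hz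
  have hzn : ∀ τ : ℝ, 0 < τ → ‖z τ - 1‖ = τ * ‖q - 1‖ := fun τ h0 => by
    rw [hz]; simp only [add_sub_cancel_left]; exact norm_ofReal_mul h0.le _
  have hz1 : z 1 = q := by simp [hz]
  have hzD : ∀ τ : ℝ, 0 < τ → τ ≤ 1 → ‖z τ‖ ≤ 1 ∧ z τ ∈ Dom N := by
    intro τ h0 hτ
    rcases hτ.eq_or_lt with rfl | hτ
    · rw [hz1]; exact ⟨h1, hq⟩
    · have e : z τ = (1 - τ) • (1 : ℂ) + τ • q := by
        simp only [hz, Complex.real_smul]; push_cast; ring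
      have hlt : ‖z τ‖ < 1 := by
        rw [e]
        exact norm_combo_lt_of_ne (by simp) h1 (Ne.symm hq1) (by linarith) h0 (by ring)
      refine ⟨hlt.le, mem_Dom_of_norm_lt hN ?_ hlt⟩
      rw [Complex.mem_slitPlane_iff]; left
      have h3 := Complex.abs_re_le_norm (z τ - 1)
      rw [hzn τ h0] at h3
      have h4 : τ * ‖q - 1‖ ≤ 1 * (1 / 2) :=
        mul_le_mul hτ.le ((h2.trans (min_le_left _ _)).trans hδ2) (norm_nonneg _) zero_le_one
      have h5 := neg_abs_le (z τ - 1).re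
      rw [Complex.sub_re, Complex.one_re] at h3 h5
      linarith
  have hderiv : ∀ τ : ℝ, 0 < τ → τ ≤ 1 →
      HasDerivAt (fun τ => GPL (α :: u) (z τ)) (GPL u (z τ) / (z τ - α) * (q - 1)) τ := by
    intro τ h0 hτ
    have e0 : HasDerivAt (fun t : ℝ => (t : ℂ)) 1 τ := Complex.ofRealCLM.hasDerivAt
    have e1 : HasDerivAt z (q - 1) τ := by
      have := (e0.mul_const (q - 1)).const_add 1
      rwa [one_mul] at this
    exact HasDerivAt.comp_of_eq τ (hasDerivAt_GPL_cons hN hu (hzD τ h0 hτ).2) e1 rfl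
  have hbound : ∀ τ : ℝ, 0 < τ → τ ≤ 1 → ‖GPL u (z τ) / (z τ - α) * (q - 1)‖ ≤
      C * (2 / d) * ‖q - 1‖ ^ (1 / 4 : ℝ) * τ ^ (-(3 / 4 : ℝ)) := by
    intro τ h0 hτ
    have hle : τ * ‖q - 1‖ ≤ ‖q - 1‖ := mul_le_of_le_one_left hp.le hτ
    have hn := hzn τ h0
    have hne : z τ ≠ 1 := by
      rw [← sub_ne_zero, ← norm_pos_iff, hn]; positivity
    have h3 := hb (z τ) (hzD τ h0 hτ).1 (by rw [hn]; exact hle.trans (h2.trans (min_le_left _ _))) hne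
    rw [hn, Real.mul_rpow h0.le hp.le] at h3
    have h4 : d / 2 ≤ ‖z τ - α‖ := by
      have e : 1 - α = (z τ - α) - (z τ - 1) := by ring
      have h5 := norm_sub_le (z τ - α) (z τ - 1)
      rw [← e, hn] at h5
      have := h2.trans (min_le_right _ _)
      linarith
    have e4 : ‖q - 1‖ ^ (1 / 4 : ℝ) = ‖q - 1‖ ^ (-(3 / 4 : ℝ)) * ‖q - 1‖ := by
      nth_rewrite 3 [← Real.rpow_one ‖q - 1‖]
      rw [← Real.rpow_add hp]; norm_num
    rw [norm_mul, norm_div, e4]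
    calc ‖GPL u (z τ)‖ / ‖z τ - α‖ * ‖q - 1‖
        ≤ C * (τ ^ (-(3 / 4 : ℝ)) * ‖q - 1‖ ^ (-(3 / 4 : ℝ))) / (d / 2) * ‖q - 1‖ := by gcongr
      _ = C * (2 / d) * (‖q - 1‖ ^ (-(3 / 4 : ℝ)) * ‖q - 1‖) * τ ^ (-(3 / 4 : ℝ)) := by
        field_simp
  set K := C * (2 / d) * ‖q - 1‖ ^ (1 / 4 : ℝ) with hK
  have hKnn : 0 ≤ K := by positivity
  have hseg : ∀ ε : ℝ, 0 < ε → ε ≤ 1 → ‖GPL (α :: u) q - GPL (α :: u) (z ε)‖ ≤ 4 * K := by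
    intro ε h0 hε
    have := image_norm_le_of_norm_deriv_right_le_deriv_boundary'
      (f := fun τ => GPL (α :: u) (z τ) - GPL (α :: u) (z ε))
      (f' := fun τ => GPL u (z τ) / (z τ - α) * (q - 1)) (a := ε) (b := 1)
      -- The primitive of the bound `K τ^{-3/4}` of the derivative.
      (B := fun τ => 4 * K * τ ^ (1 / 4 : ℝ)) (B' := fun τ => K * τ ^ (-(3 / 4 : ℝ)))
      (fun τ hτ => ((hderiv τ (h0.trans_le hτ.1) hτ.2).sub_const _).continuousAt.continuousWithinAt)
      (fun τ hτ => ((hderiv τ (h0.trans_le hτ.1) hτ.2.le).sub_const _).hasDerivWithinAt)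
      (by simp only [sub_self, norm_zero]; positivity)
      (fun τ hτ => by
        have hτ0 : 0 < τ := h0.trans_le hτ.1
        exact (continuousAt_const.mul (Real.continuousAt_rpow_const τ _ (Or.inl hτ0.ne'))).continuousWithinAt)
      (fun τ hτ => by
        have hτ0 : 0 < τ := h0.trans_le hτ.1
        have e := ((Real.hasDerivAt_rpow_const (p := 1 / 4) (Or.inl hτ0.ne')).const_mul (4 * K))
        refine (e.congr_deriv ?_).hasDerivWithinAt
        norm_num
        ring)
      (fun τ hτ => hbound τ (h0.trans_le hτ.1) hτ.2.le) (x := 1) ⟨hε, le_rfl⟩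
    simpa [hz1] using this
  -- The derivative is not available at `τ = 0`; continuity at `1` replaces the lower end `z ε` by
  -- `1`.
  have hlim : Tendsto (fun ε : ℝ => GPL (α :: u) (z ε)) (𝓝[>] 0) (𝓝 (GPL (α :: u) 1)) := by
    have hc := continuousWithinAt_GPL_one hN hu (by simpa using hα)
    refine hc.tendsto.comp (tendsto_nhdsWithin_iff.2 ⟨?_, ?_⟩)
    · have : Tendsto z (𝓝 0) (𝓝 (z 0)) := (by fun_prop : Continuous z).tendsto 0
      simpa [hz] using this.mono_left nhdsWithin_le_nhds
    · filter_upwards [Ioc_mem_nhdsGT (zero_lt_one (α := ℝ))] with ε hε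
      exact (hzD ε hε.1 hε.2).1
  have := le_of_tendsto (tendsto_const_nhds.sub hlim).norm (by
    filter_upwards [Ioc_mem_nhdsGT (zero_lt_one (α := ℝ))] with ε hε
    exact hseg ε hε.1 hε.2)
  calc _ ≤ 4 * K := this
    _ = _ := by rw [hK]; ring

/-! ### The graded ring of convergent values -/

/-- Words of convergent cyclotomic multiple zeta values of level `N`. -/
def Adm (N : ℕ) (u : List ℂ) : Prop :=
  IsWord N u ∧ u.head? ≠ some 1 ∧ u.getLast? ≠ some 0

/-- The span of the convergent iterated integrals from `0` to `1` of weight `w`. -/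
noncomputable def Zsp (N w : ℕ) : Submodule ℚ ℂ :=
  Submodule.span ℚ {x | ∃ u, Adm N u ∧ u.length = w ∧ x = GPL u 1}

lemma GPL_one_mem_Zsp {N : ℕ} {u : List ℂ} (hu : Adm N u) : GPL u 1 ∈ Zsp N u.length :=
  Submodule.subset_span ⟨u, hu, rfl, rfl⟩

lemma adm_nil (N : ℕ) : Adm N [] := ⟨by simp [IsWord], by simp, by simp⟩

lemma one_mem_Zsp (N : ℕ) : (1 : ℂ) ∈ Zsp N 0 := by
  have := GPL_one_mem_Zsp (adm_nil N)
  rwa [GPL_nil] at this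

/-- Reading a word from the left, a zero raises the first index of the remaining list, and a nonzero
letter opens a new index `1`. The absence of a trailing zero guarantees that there is an index to
raise. -/
lemma exists_mplWord_eq {N : ℕ} (u : List ℂ) (hu : IsWord N u) (hlast : u.getLast? ≠ some 0)
    (P : ℂ) (hP : P ^ N = 1) (hP0 : P ≠ 0) : ∃ s : List (ℕ × ℂ), mplWord P s = u ∧
      (∀ p ∈ s, 0 < p.1 ∧ p.2 ^ N = 1) ∧ (s.map Prod.fst).sum = u.length := by
  induction u generalizing P with
  | nil => exact ⟨[], by simp [mplWord]⟩
  | cons α u ih =>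
    have hlast' : u.getLast? ≠ some 0 := by
      cases u with
      | nil => simp
      | cons β u => rwa [List.getLast?_cons_cons] at hlast
    by_cases hα : α = 0
    · subst hα
      obtain ⟨s, hs1, hs2, hs3⟩ := ih hu.tail hlast' P hP hP0
      cases s with
      | nil =>
        rw [mplWord] at hs1
        subst hs1
        simp at hlast
      | cons p s =>
        obtain ⟨a, z⟩ := p
        have ha : 0 < a ∧ z ^ N = 1 := hs2 (a, z) List.mem_cons_self
        refine ⟨(a + 1, z) :: s, ?_, ?_, ?_⟩
        · rw [mplWord] at hs1 ⊢
          rw [← hs1, Nat.add_sub_cancel]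
          obtain ⟨b, rfl⟩ : ∃ b, a = b + 1 := ⟨a - 1, by omega⟩
          simp [List.replicate_succ]
        · intro p hp
          rcases List.mem_cons.1 hp with rfl | hp
          · exact ⟨Nat.succ_pos _, ha.2⟩
          · exact hs2 p (List.mem_cons_of_mem _ hp)
        · simp only [List.map_cons, List.sum_cons, List.length_cons] at hs3 ⊢
          omega
    · have hαN := hu.head.resolve_left hα
      obtain ⟨s, hs1, hs2, hs3⟩ := ih hu.tail hlast' (1 / α) (by rw [div_pow, hαN]; simp)
        (by simpa using hα)
      -- This argument turns the running product `P` into `1/α`, whose reciprocal is the letter `α`.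
      refine ⟨(1, 1 / (α * P)) :: s, ?_, ?_, ?_⟩
      · have e : P * (1 / (α * P)) = 1 / α := by field_simp
        rw [mplWord, e, hs1]
        simp
      · intro p hp
        rcases List.mem_cons.1 hp with rfl | hp
        · refine ⟨one_pos, ?_⟩
          simp only
          rw [div_pow, mul_pow, hαN, hP]; simp
        · exact hs2 p hp
      · simp only [List.map_cons, List.sum_cons, List.length_cons, hs3]; ring

/-- The sign `(-1)^n` is rational, and a list starting with `(1, 1)` would give a word starting with
the letter `1`, which admissibility excludes. -/
lemma Zsp_le_CMZV (N w : ℕ) : Zsp N w ≤ CMZV w N := by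
  refine Submodule.span_le.2 ?_
  rintro x ⟨u, hu, rfl, rfl⟩
  obtain ⟨s, hs1, hs2, hs3⟩ := exists_mplWord_eq u hu.1 hu.2.2 1 (one_pow N) one_ne_zero
  have hmem : MPL s ∈ CMZV u.length N := by
    refine Submodule.subset_span ⟨s, hs2, ?_, hs3, rfl⟩
    intro h
    cases s with
    | nil => simp at h
    | cons p s =>
      simp only [List.head?_cons, Option.some.injEq] at h
      subst h
      refine hu.2.1 ?_
      rw [← hs1, mplWord]
      simp
  have e : GPL u 1 = ((-1) ^ s.length : ℚ) • MPL s := by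
    rw [MPL, hs1, Rat.smul_def]
    push_cast
    rw [← mul_assoc, ← mul_pow]; simp
  rw [SetLike.mem_coe, e]
  exact Submodule.smul_mem _ _ hmem

lemma tendsto_ofReal_one : Tendsto (fun t : ℝ => (t : ℂ)) (𝓝[<] 1) (𝓝[{q | ‖q‖ ≤ 1}] 1) := by
  refine tendsto_nhdsWithin_iff.2 ⟨?_, ?_⟩
  · have := Complex.continuous_ofReal.tendsto 1
    simpa using this.mono_left nhdsWithin_le_nhds
  · filter_upwards [Ioo_mem_nhdsLT (zero_lt_one (α := ℝ))] with t ht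
    simp only [Complex.norm_real, Real.norm_of_nonneg ht.1.le]
    exact ht.2.le

lemma ofReal_mem_Dom {N : ℕ} (hN : 0 < N) {t : ℝ} (h0 : 0 < t) (h1 : t < 1) : (t : ℂ) ∈ Dom N :=
  mem_Dom_of_norm_lt hN (Complex.ofReal_mem_slitPlane.2 h0)
    (by rwa [Complex.norm_real, Real.norm_of_nonneg h0.le])

lemma tendsto_sum_map {ι κ : Type*} (L : List ι) {f : ι → κ → ℂ} {g : ι → ℂ} {l : Filter κ}
    (h : ∀ i ∈ L, Tendsto (f i) l (𝓝 (g i))) :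
    Tendsto (fun w => (L.map fun i => f i w).sum) l (𝓝 (L.map g).sum) := by
  induction L with
  | nil => simpa using tendsto_const_nhds
  | cons i L ih =>
    simp only [List.map_cons, List.sum_cons]
    exact (h i List.mem_cons_self).add (ih fun j hj => h j (List.mem_cons_of_mem _ hj))

lemma sum_map_mem {ι M : Type*} [AddCommGroup M] [Module ℚ M] (S : Submodule ℚ M) (L : List ι)
    (f : ι → M) (h : ∀ i ∈ L, f i ∈ S) : (L.map f).sum ∈ S := by
  induction L with
  | nil => simp
  | cons i L ih =>
    simp only [List.map_cons, List.sum_cons]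
    exact S.add_mem (h i List.mem_cons_self) (ih fun j hj => h j (List.mem_cons_of_mem _ hj))

lemma Adm.of_mem_shuffle {N : ℕ} {u v x : List ℂ} (hu : Adm N u) (hv : Adm N v)
    (hx : x ∈ shuffle u v) : Adm N x :=
  ⟨hu.1.of_mem_shuffle hv.1 hx, head_of_mem_shuffle u v 1 hu.2.1 hv.2.1 x hx,
    getLast_of_mem_shuffle u v hu.2.2 hv.2.2 x hx⟩

lemma GPL_one_mul {N : ℕ} (hN : 0 < N) {u v : List ℂ} (hu : Adm N u) (hv : Adm N v) :
    GPL u 1 * GPL v 1 = ((shuffle u v).map fun x => GPL x 1).sum := by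
  have lim : ∀ x, Adm N x → Tendsto (fun t : ℝ => GPL x t) (𝓝[<] 1) (𝓝 (GPL x 1)) := fun x hx =>
    (continuousWithinAt_GPL_one hN hx.1 hx.2.1).tendsto.comp tendsto_ofReal_one
  refine tendsto_nhds_unique ((lim u hu).mul (lim v hv)) ?_
  refine (tendsto_sum_map (shuffle u v) (fun x hx => lim x (hu.of_mem_shuffle hv hx))).congr' ?_
  filter_upwards [Ioo_mem_nhdsLT (zero_lt_one (α := ℝ))] with t ht
  exact (GPL_mul_GPL hN u v hu.1 hv.1 t (ofReal_mem_Dom hN ht.1 ht.2)).symm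

/-- Shuffles of admissible words are admissible, because neither the first nor the last letter of a
shuffle is new. -/
lemma mul_mem_Zsp {N : ℕ} (hN : 0 < N) {a b : ℕ} {x y : ℂ} (hx : x ∈ Zsp N a)
    (hy : y ∈ Zsp N b) : x * y ∈ Zsp N (a + b) := by
  have h : Zsp N a * Zsp N b ≤ Zsp N (a + b) := by
    rw [Zsp, Zsp, Submodule.span_mul_span, Submodule.span_le]
    rintro _ ⟨_, ⟨u, hu, rfl, rfl⟩, _, ⟨v, hv, rfl, rfl⟩, rfl⟩
    simp only [SetLike.mem_coe]
    rw [GPL_one_mul hN hu hv]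
    refine sum_map_mem _ _ _ fun x hx => ?_
    have := GPL_one_mem_Zsp (hu.of_mem_shuffle hv hx)
    rwa [(perm_of_mem_shuffle u v x hx).length_eq, List.length_append] at this
  exact h (Submodule.mul_mem_mul hx hy)

/-! ### Shuffle regularization of trailing zeros and leading ones -/

/-- The polylogarithm of a word, cut off outside the domain of holomorphy. -/
noncomputable def G (N : ℕ) (u : List ℂ) : ℂ → ℂ := (Dom N).indicator (GPL u)

lemma G_apply {N : ℕ} {u : List ℂ} {z : ℂ} (hz : z ∈ Dom N) : G N u z = GPL u z :=
  Set.indicator_of_mem hz _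

lemma list_sum_apply {ι : Type*} (L : List ι) (f : ι → ℂ → ℂ) (z : ℂ) :
    (L.map f).sum z = (L.map fun i => f i z).sum := by
  induction L with
  | nil => simp
  | cons i L ih => simp [ih]

/-- Thanks to the cut-off the shuffle relation holds in the ring of all functions `ℂ → ℂ`, so
regularization becomes linear algebra in that ring. -/
lemma G_mul_G {N : ℕ} (hN : 0 < N) {u v : List ℂ} (hu : IsWord N u) (hv : IsWord N v) :
    G N u * G N v = ((shuffle u v).map (G N)).sum := by
  funext z
  rw [Pi.mul_apply, list_sum_apply]
  by_cases hz : z ∈ Dom N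
  · simp only [G_apply hz]
    exact GPL_mul_GPL hN u v hu hv z hz
  · simp [G, hz]

/-- Insertions of the letter `0` in front of the letters of a word. -/
def insertZero : List ℂ → List (List ℂ)
  | [] => []
  | a :: u => (0 :: a :: u) :: (insertZero u).map (a :: ·)

lemma mem_insertZero (u : List ℂ) : ∀ x ∈ insertZero u,
    x.Perm (0 :: u) ∧ x.getLast? = u.getLast? := by
  induction u with
  | nil => simp [insertZero]
  | cons a u ih =>
    intro x hx
    rw [insertZero, List.mem_cons, List.mem_map] at hx
    rcases hx with rfl | ⟨y, hy, rfl⟩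
    · exact ⟨List.Perm.refl _, List.getLast?_cons_cons⟩
    · obtain ⟨h1, h2⟩ := ih y hy
      refine ⟨(h1.cons a).trans (List.Perm.swap 0 a u), ?_⟩
      have hl := h1.length_eq
      cases u with
      | nil => simp [insertZero] at hy
      | cons b u =>
        cases y with
        | nil => simp at hl
        | cons c y => rw [List.getLast?_cons_cons, h2, List.getLast?_cons_cons]

/-- The extra `0` either lands in front of a letter of `u`, or in the trailing block, where all `n +
1` positions give the same word. -/
lemma sum_shuffle_zero {M : Type*} [AddCommMonoid M] (u : List ℂ) (n : ℕ) (f : List ℂ → M) :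
    ((shuffle (u ++ List.replicate n 0) [0]).map f).sum =
      ((insertZero u).map fun x => f (x ++ List.replicate n 0)).sum +
        (n + 1) • f (u ++ List.replicate (n + 1) 0) := by
  induction u generalizing f with
  | nil =>
    induction n generalizing f with
    | zero => simp [shuffle_nil_left, insertZero]
    | succ n ih =>
      have h := ih (fun x => f (0 :: x))
      simp only [List.nil_append, insertZero, List.map_nil, List.sum_nil, zero_add] at h ⊢
      rw [List.replicate_succ, shuffle_cons_cons, shuffle_nil_right, List.map_append,
        List.sum_append, List.map_map]
      rw [show (f ∘ fun x => 0 :: x) = fun x => f (0 :: x) from rfl, h]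
      simp only [List.map_cons, List.map_nil, List.sum_cons, List.sum_nil, add_zero,
        ← List.replicate_succ]
      rw [succ_nsmul _ (n + 1)]
  | cons a u ih =>
    rw [List.cons_append, shuffle_cons_cons, shuffle_nil_right, List.map_append,
      List.sum_append, List.map_map, show (f ∘ fun x => a :: x) = fun x => f (a :: x) from rfl,
      ih (fun x => f (a :: x))]
    simp only [insertZero, List.map_cons, List.map_nil, List.sum_cons, List.sum_nil, add_zero,
      List.map_map, List.cons_append]
    rw [add_right_comm, add_comm (List.sum _)]
    rfl

/-- Insertions of the letter `1` behind the letters of a word. -/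
def insertOne : List ℂ → List (List ℂ)
  | [] => []
  | b :: y => (shuffle [1] y).map (b :: ·)

/-- The mirror image at the front: the extra `1` either lands behind a letter of `v`, or in the
leading block, in `n + 1` equal ways. -/
lemma sum_shuffle_one {M : Type*} [AddCommMonoid M] (v : List ℂ) (n : ℕ) (f : List ℂ → M) :
    ((shuffle [1] (List.replicate n 1 ++ v)).map f).sum =
      ((insertOne v).map fun x => f (List.replicate n 1 ++ x)).sum +
        (n + 1) • f (List.replicate (n + 1) 1 ++ v) := by
  induction n generalizing f with
  | zero =>
    cases v with
    | nil => simp [shuffle_nil_right, insertOne]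
    | cons b y =>
      simp [shuffle_cons_cons, shuffle_nil_left, insertOne, add_comm]
  | succ n ih =>
    rw [List.replicate_succ, List.cons_append, shuffle_cons_cons, shuffle_nil_left,
      List.map_append, List.sum_append, List.map_map, List.map_map,
      show (f ∘ fun x => (1 : ℂ) :: x) = fun x => f (1 :: x) from rfl, ih (fun x => f (1 :: x))]
    simp only [List.map_cons, List.map_nil, List.sum_cons, List.sum_nil, add_zero,
      ← List.replicate_succ, ← List.cons_append]
    rw [succ_nsmul _ (n + 1)]
    abel

/-- Combinations of products of a power of the logarithm and a polylogarithm without trailing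
zeros, of total weight `n`. -/
noncomputable def TrailSpan (N n : ℕ) : Submodule ℚ (ℂ → ℂ) :=
  Submodule.span ℚ {f | ∃ (k : ℕ) (u : List ℂ), IsWord N u ∧ u.getLast? ≠ some 0 ∧
    k + u.length = n ∧ f = G N [0] ^ k * G N u}

/-- Combinations of products of a power of `log (1 - z)` and a polylogarithm of an admissible word,
of total weight `n`. -/
noncomputable def LeadSpan (N n : ℕ) : Submodule ℚ (ℂ → ℂ) :=
  Submodule.span ℚ {f | ∃ (m : ℕ) (u : List ℂ), Adm N u ∧
    m + u.length = n ∧ f = G N [1] ^ m * G N u}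

lemma mul_mem_trailSpan {N n : ℕ} {f : ℂ → ℂ} (hf : f ∈ TrailSpan N n) :
    f * G N [0] ∈ TrailSpan N (n + 1) := by
  induction hf using Submodule.span_induction with
  | mem f hf =>
    obtain ⟨k, u, h1, h2, h3, rfl⟩ := hf
    exact Submodule.subset_span ⟨k + 1, u, h1, h2, by omega, by rw [pow_succ]; ring⟩
  | zero => rw [zero_mul]; exact Submodule.zero_mem _
  | add f g _ _ hf hg => rw [add_mul]; exact Submodule.add_mem _ hf hg
  | smul c f _ hf => rw [smul_mul_assoc]; exact Submodule.smul_mem _ _ hf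

lemma mul_mem_leadSpan {N n : ℕ} {f : ℂ → ℂ} (hf : f ∈ LeadSpan N n) :
    G N [1] * f ∈ LeadSpan N (n + 1) := by
  induction hf using Submodule.span_induction with
  | mem f hf =>
    obtain ⟨k, u, h1, h3, rfl⟩ := hf
    exact Submodule.subset_span ⟨k + 1, u, h1, by omega, by rw [pow_succ]; ring⟩
  | zero => rw [mul_zero]; exact Submodule.zero_mem _
  | add f g _ _ hf hg => rw [mul_add]; exact Submodule.add_mem _ hf hg
  | smul c f _ hf => rw [mul_smul_comm]; exact Submodule.smul_mem _ _ hf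

lemma isWord_replicate_zero (N n : ℕ) : IsWord N (List.replicate n 0) := fun _ hα =>
  Or.inl (List.eq_of_mem_replicate hα)

lemma isWord_replicate_one (N n : ℕ) : IsWord N (List.replicate n 1) := fun α hα => by
  rw [List.eq_of_mem_replicate hα]; right; simp

/-- The regularization relations are solved by dividing by `n + 1`; this is where rational rather
than integral coefficients are used. -/
lemma mem_of_succ_nsmul_add {M : Type*} [AddCommGroup M] [Module ℚ M] {S : Submodule ℚ M}
    {n : ℕ} {x y z : M} (h : z = y + (n + 1) • x) (hz : z ∈ S) (hy : y ∈ S) : x ∈ S := by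
  have h1 : ((n + 1 : ℕ) : ℚ) • x ∈ S := by
    have : ((n + 1 : ℕ) : ℚ) • x = z - y := by rw [h, Nat.cast_smul_eq_nsmul]; abel
    rw [this]; exact S.sub_mem hz hy
  have h2 := S.smul_mem (((n + 1 : ℕ) : ℚ)⁻¹) h1
  rwa [smul_smul, inv_mul_cancel₀ (by positivity), one_smul] at h2

/-- Multiply the word with `n` trailing zeros by `G(0; ·)`. The shuffle relation expresses `n + 1`
times the word with one more zero through words having only `n` trailing zeros, so induction on `n`
applies. -/
lemma G_append_replicate_mem_trailSpan {N : ℕ} (hN : 0 < N) (n : ℕ) (u : List ℂ)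
    (hu : IsWord N u) (hl : u.getLast? ≠ some 0) :
    G N (u ++ List.replicate n 0) ∈ TrailSpan N (u.length + n) := by
  induction n generalizing u with
  | zero => exact Submodule.subset_span ⟨0, u, hu, hl, by simp, by simp⟩
  | succ n ih =>
    have h0 : IsWord N [0] := by simp [IsWord]
    have h := G_mul_G hN (hu.append (isWord_replicate_zero N n)) h0
    rw [sum_shuffle_zero] at h
    refine mem_of_succ_nsmul_add h (mul_mem_trailSpan (ih u hu hl)) ?_
    refine sum_map_mem _ _ _ fun x hx => ?_
    obtain ⟨h1, h2⟩ := mem_insertZero u x hx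
    have h3 := ih x ((hu.cons (Or.inl rfl)).of_perm h1) (by rwa [h2])
    rwa [h1.length_eq, List.length_cons, show u.length + 1 + n = u.length + (n + 1) by ring] at h3

lemma exists_eq_append_replicate_zero (w : List ℂ) :
    ∃ u n, w = u ++ List.replicate n 0 ∧ u.getLast? ≠ some (0 : ℂ) := by
  induction w using List.reverseRecOn with
  | nil => exact ⟨[], 0, by simp⟩
  | append_singleton w a ih =>
    by_cases ha : a = 0
    · obtain ⟨u, n, h1, h2⟩ := ih
      refine ⟨u, n + 1, ?_, h2⟩
      rw [List.replicate_succ', ← List.append_assoc, ← h1, ha]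
    · exact ⟨w ++ [a], 0, by simp, by simpa using ha⟩

lemma G_mem_trailSpan {N : ℕ} (hN : 0 < N) {w : List ℂ} (hw : IsWord N w) :
    G N w ∈ TrailSpan N w.length := by
  obtain ⟨u, n, rfl, h2⟩ := exists_eq_append_replicate_zero w
  have := G_append_replicate_mem_trailSpan hN n u
    (fun α hα => hw α (List.mem_append_left _ hα)) h2
  simpa using this

/-- The same recursion for leading ones. The words with an inserted `1` keep the first letter of
`v`, and no trailing zero is created, so they remain of the form covered by the induction
hypothesis. -/
lemma G_replicate_append_mem_leadSpan {N : ℕ} (hN : 0 < N) (n : ℕ) (v : List ℂ)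
    (hv : Adm N v) : G N (List.replicate n 1 ++ v) ∈ LeadSpan N (n + v.length) := by
  induction n generalizing v with
  | zero => exact Submodule.subset_span ⟨0, v, hv, by simp, by simp⟩
  | succ n ih =>
    have h0 : IsWord N [1] := isWord_replicate_one N 1
    have h := G_mul_G hN h0 ((isWord_replicate_one N n).append hv.1)
    rw [sum_shuffle_one] at h
    refine mem_of_succ_nsmul_add h ?_ ?_
    · have := mul_mem_leadSpan (ih v hv)
      rwa [show n + v.length + 1 = n + 1 + v.length by ring] at this
    · refine sum_map_mem _ _ _ fun x hx => ?_
      cases v with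
      | nil => simp [insertOne] at hx
      | cons b y =>
        rw [insertOne, List.mem_map] at hx
        obtain ⟨y', hy', rfl⟩ := hx
        have hlen := (perm_of_mem_shuffle _ _ y' hy').length_eq
        have hA : Adm N (b :: y') := by
          refine ⟨(h0.of_mem_shuffle hv.1.tail hy').cons hv.1.head, by simpa using hv.2.1, ?_⟩
          have hy0 : y.getLast? ≠ some 0 := by
            have := hv.2.2
            cases y with
            | nil => simp
            | cons c y => rwa [List.getLast?_cons_cons] at this
          have h2 := getLast_of_mem_shuffle [1] y (by simp) hy0 y' hy'
          cases y' with
          | nil => simp at hlen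
          | cons c y' => rwa [List.getLast?_cons_cons]
        have h3 := ih _ hA
        have e : n + (b :: y').length = n + 1 + (b :: y).length := by
          simp only [List.length_cons, hlen, List.length_append, List.length_nil]; ring
        rwa [e] at h3

lemma exists_eq_replicate_one_append (w : List ℂ) :
    ∃ n v, w = List.replicate n 1 ++ v ∧ v.head? ≠ some (1 : ℂ) := by
  induction w with
  | nil => exact ⟨0, [], by simp⟩
  | cons a w ih =>
    by_cases ha : a = 1
    · obtain ⟨n, v, h1, h2⟩ := ih
      exact ⟨n + 1, v, by rw [List.replicate_succ, List.cons_append, ← h1, ha], h2⟩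
    · exact ⟨0, a :: w, by simp, by simpa using ha⟩

lemma G_mem_leadSpan {N : ℕ} (hN : 0 < N) {w : List ℂ} (hw : IsWord N w)
    (hl : w.getLast? ≠ some 0) : G N w ∈ LeadSpan N w.length := by
  obtain ⟨n, v, rfl, h2⟩ := exists_eq_replicate_one_append w
  have := G_replicate_append_mem_leadSpan hN n v
    ⟨fun α hα => hw α (List.mem_append_right _ hα), h2, fun h => hl (by
      rw [List.getLast?_append, h]; rfl)⟩
  simpa using this

/-! ### Expansions in a divergent logarithm with coefficients graded by weight -/

section Expansions

variable {ι : Type*} {l : Filter ι} {Λ : ι → ℂ}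

/-- `f` tends to zero faster than any power of `Λ` can compensate. -/
def Rapid (l : Filter ι) (Λ f : ι → ℂ) : Prop :=
  ∀ m : ℕ, Tendsto (fun s => f s * Λ s ^ m) l (𝓝 0)

lemma Rapid.add {f g : ι → ℂ} (hf : Rapid l Λ f) (hg : Rapid l Λ g) :
    Rapid l Λ (fun s => f s + g s) := fun m => by
  simpa [add_mul] using (hf m).add (hg m)

lemma Rapid.const_mul {f : ι → ℂ} (hf : Rapid l Λ f) (c : ℂ) : Rapid l Λ (fun s => c * f s) :=
  fun m => by simpa [mul_assoc] using (hf m).const_mul c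

lemma Rapid.mul {f g : ι → ℂ} (hf : Rapid l Λ f) (hg : Rapid l Λ g) :
    Rapid l Λ (fun s => f s * g s) := fun m => by
  have := (hf m).mul (hg 0)
  simp only [pow_zero, mul_one, mul_zero] at this
  exact this.congr fun s => by ring

lemma Rapid.mul_pow {f : ι → ℂ} (hf : Rapid l Λ f) (k : ℕ) : Rapid l Λ (fun s => f s * Λ s ^ k) :=
  fun m => (hf (k + m)).congr fun s => by rw [pow_add]; ring

lemma Rapid.mul_eval {f : ι → ℂ} (hf : Rapid l Λ f) (P : Polynomial ℂ) :
    Rapid l Λ (fun s => f s * P.eval (Λ s)) := by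
  induction P using Polynomial.induction_on' with
  | add P Q hP hQ => simpa [mul_add] using hP.add hQ
  | monomial k c =>
    have := (hf.mul_pow k).const_mul c
    intro m
    refine (this m).congr fun s => ?_
    simp only [Polynomial.eval_monomial]; ring

lemma Rapid.zero : Rapid l Λ (fun _ => 0) := fun m => by simpa using tendsto_const_nhds

lemma Rapid.congr' {f g : ι → ℂ} (hf : Rapid l Λ f) (h : f =ᶠ[l] g) : Rapid l Λ g := fun m =>
  (hf m).congr' (h.mono fun s hs => by simp only [hs])

/-- Polynomials whose `k`-th coefficient has weight `w - k`. -/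
def WeightPoly (N w : ℕ) (P : Polynomial ℂ) : Prop :=
  (∀ k ≤ w, P.coeff k ∈ Zsp N (w - k)) ∧ ∀ k, w < k → P.coeff k = 0

/-- `F` has an expansion in powers of `Λ` along `l` with coefficients of total weight `w`. -/
def HasExp (N w : ℕ) (l : Filter ι) (Λ F : ι → ℂ) : Prop :=
  ∃ P : Polynomial ℂ, WeightPoly N w P ∧ Rapid l Λ (fun s => F s - P.eval (Λ s))

variable {N w w' : ℕ} {F F' : ι → ℂ}

lemma HasExp.congr' (h : HasExp N w l Λ F) (he : F =ᶠ[l] F') : HasExp N w l Λ F' := by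
  obtain ⟨P, hP, hr⟩ := h
  exact ⟨P, hP, hr.congr' (he.mono fun s hs => by simp only [hs])⟩

lemma HasExp.of_rapid (h : Rapid l Λ F) : HasExp N w l Λ F :=
  ⟨0, ⟨fun k _ => by simp, fun k _ => by simp⟩, by simpa using h⟩

lemma HasExp.add (h : HasExp N w l Λ F) (h' : HasExp N w l Λ F') :
    HasExp N w l Λ (fun s => F s + F' s) := by
  obtain ⟨P, hP, hr⟩ := h
  obtain ⟨Q, hQ, hr'⟩ := h'
  refine ⟨P + Q, ⟨fun k hk => ?_, fun k hk => ?_⟩, (hr.add hr').congr' ?_⟩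
  · rw [Polynomial.coeff_add]; exact Submodule.add_mem _ (hP.1 k hk) (hQ.1 k hk)
  · rw [Polynomial.coeff_add, hP.2 k hk, hQ.2 k hk, add_zero]
  · exact Eventually.of_forall fun s => by simp only [Polynomial.eval_add]; ring

lemma HasExp.smul (h : HasExp N w l Λ F) (c : ℚ) : HasExp N w l Λ (fun s => (c : ℂ) * F s) := by
  obtain ⟨P, hP, hr⟩ := h
  refine ⟨Polynomial.C (c : ℂ) * P, ⟨fun k hk => ?_, fun k hk => ?_⟩, (hr.const_mul c).congr' ?_⟩
  · rw [Polynomial.coeff_C_mul, ← Rat.smul_def]; exact Submodule.smul_mem _ _ (hP.1 k hk)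
  · rw [Polynomial.coeff_C_mul, hP.2 k hk, mul_zero]
  · exact Eventually.of_forall fun s => by
      simp only [Polynomial.eval_mul, Polynomial.eval_C]; ring

lemma HasExp.mul (hN : 0 < N) (h : HasExp N w l Λ F) (h' : HasExp N w' l Λ F') :
    HasExp N (w + w') l Λ (fun s => F s * F' s) := by
  obtain ⟨P, hP, hr⟩ := h
  obtain ⟨Q, hQ, hr'⟩ := h'
  refine ⟨P * Q, ⟨fun k hk => ?_, fun k hk => ?_⟩,
    ((hr.mul hr').add ((hr.mul_eval Q).add (hr'.mul_eval P))).congr' ?_⟩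
  · rw [Polynomial.coeff_mul]
    refine Submodule.sum_mem _ fun x hx => ?_
    have hx' := Finset.HasAntidiagonal.mem_antidiagonal.1 hx
    by_cases h1 : w < x.1
    · rw [hP.2 _ h1, zero_mul]; exact Submodule.zero_mem _
    by_cases h2 : w' < x.2
    · rw [hQ.2 _ h2, mul_zero]; exact Submodule.zero_mem _
    have := mul_mem_Zsp hN (hP.1 x.1 (by omega)) (hQ.1 x.2 (by omega))
    rwa [show w - x.1 + (w' - x.2) = w + w' - k by omega] at this
  · rw [Polynomial.coeff_mul]
    refine Finset.sum_eq_zero fun x hx => ?_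
    have hx' := Finset.HasAntidiagonal.mem_antidiagonal.1 hx
    by_cases h1 : w < x.1
    · rw [hP.2 _ h1, zero_mul]
    · rw [hQ.2 x.2 (by omega), mul_zero]
  · exact Eventually.of_forall fun s => by simp only [Polynomial.eval_mul]; ring

lemma HasExp.const {c : ℂ} (hc : c ∈ Zsp N w) : HasExp N w l Λ (fun _ => c) := by
  refine ⟨Polynomial.C c, ⟨fun k hk => ?_, fun k hk => ?_⟩, ?_⟩
  · rw [Polynomial.coeff_C]
    split_ifs with h
    · rw [h]; exact hc
    · exact Submodule.zero_mem _
  · rw [Polynomial.coeff_C, if_neg (by omega)]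
  · simpa using Rapid.zero

lemma HasExp.self : HasExp N 1 l Λ Λ := by
  refine ⟨Polynomial.X, ⟨fun k hk => ?_, fun k hk => ?_⟩, ?_⟩
  · rw [Polynomial.coeff_X]
    split_ifs with h
    · rw [← h]; exact one_mem_Zsp N
    · exact Submodule.zero_mem _
  · rw [Polynomial.coeff_X, if_neg (by omega)]
  · simpa using Rapid.zero

lemma HasExp.pow (hN : 0 < N) (h : HasExp N w l Λ F) (k : ℕ) :
    HasExp N (k * w) l Λ (fun s => F s ^ k) := by
  induction k with
  | zero => simpa using HasExp.const (one_mem_Zsp N)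
  | succ k ih =>
    have := ih.mul hN h
    rw [show k * w + w = (k + 1) * w by ring] at this
    exact this.congr' (Eventually.of_forall fun s => by simp only [pow_succ])

/-- If `F` converges while `Λ` blows up, the limit has weight `w`. -/
lemma HasExp.limit_mem [l.NeBot] (h : HasExp N w l Λ F) (hΛ : Tendsto (fun s => ‖Λ s‖) l atTop)
    {L : ℂ} (hF : Tendsto F l (𝓝 L)) : L ∈ Zsp N w := by
  obtain ⟨P, hP, hr⟩ := h
  have h1 : Tendsto (fun s => P.eval (Λ s)) l (𝓝 L) := by
    have h0 := hr 0
    simp only [pow_zero, mul_one] at h0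
    simpa using hF.sub h0
  -- A nonconstant polynomial would be unbounded along `Λ`, contradicting convergence.
  have hdeg : P.natDegree = 0 := by
    by_contra hd
    have hd' : 0 < P.degree := Polynomial.natDegree_pos_iff_degree_pos.1 (Nat.pos_of_ne_zero hd)
    exact not_tendsto_nhds_of_tendsto_atTop (Polynomial.tendsto_norm_atTop P hd' hΛ) _ h1.norm
  rw [Polynomial.eq_C_of_natDegree_eq_zero hdeg] at h1
  simp only [Polynomial.eval_C] at h1
  rw [← tendsto_nhds_unique tendsto_const_nhds h1]
  exact hP.1 0 (Nat.zero_le w)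

/-- Change of the expansion variable. -/
lemma HasExp.change {Λ' : ι → ℂ} (hN : 0 < N) (h : HasExp N w l Λ F) (hΛ : HasExp N 1 l Λ' Λ)
    {A : ℝ} (hA : ∀ᶠ s in l, ‖Λ' s‖ ≤ A * (1 + ‖Λ s‖)) : HasExp N w l Λ' F := by
  obtain ⟨P, hP, hr⟩ := h
  have h1 : HasExp N w l Λ' (fun s => P.eval (Λ s)) := by
    have h2 : ∀ n ≤ w + 1, HasExp N w l Λ'
        (fun s => ∑ k ∈ Finset.range n, P.coeff k * Λ s ^ k) := by
      intro n
      induction n with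
      | zero => intro _; simpa using HasExp.of_rapid Rapid.zero
      | succ n ih =>
        intro hn
        have := (HasExp.const (l := l) (Λ := Λ') (hP.1 n (by omega))).mul hN (hΛ.pow hN n)
        rw [show w - n + n * 1 = w by omega] at this
        simpa [Finset.sum_range_succ] using (ih (by omega)).add this
    refine (h2 (w + 1) le_rfl).congr' (Eventually.of_forall fun s => ?_)
    refine (Polynomial.eval_eq_sum_range' ?_ _).symm
    by_contra hd
    have h3 : P.coeff P.natDegree = 0 := hP.2 _ (by omega)
    rw [Polynomial.coeff_natDegree, Polynomial.leadingCoeff_eq_zero] at h3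
    simp [h3] at hd
  -- The remainder is rapid with respect to `Λ`. The bound `hA` controls powers of `Λ'` by powers of
  -- `Λ`, which carries rapidity over.
  have h4 : Rapid l Λ' (fun s => F s - P.eval (Λ s)) := by
    intro m
    set f := fun s => F s - P.eval (Λ s) with hf
    have h5 : Tendsto (fun s => (|A| * 2) ^ m * (‖f s * Λ s ^ 0‖ + ‖f s * Λ s ^ m‖)) l (𝓝 0) := by
      simpa using ((hr 0).norm.add (hr m).norm).const_mul ((|A| * 2) ^ m)
    refine squeeze_zero_norm' ?_ h5
    filter_upwards [hA] with s hs
    rw [norm_mul, norm_pow, norm_mul, norm_pow, norm_mul, norm_pow, pow_zero, mul_one, ← mul_one_add,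
      mul_left_comm]
    refine mul_le_mul_of_nonneg_left ?_ (norm_nonneg _)
    have hn := norm_nonneg (Λ s)
    have h6 : ‖Λ' s‖ ≤ |A| * 2 * max 1 ‖Λ s‖ := by
      refine hs.trans ?_
      have h7 : 1 + ‖Λ s‖ ≤ 2 * max 1 ‖Λ s‖ := by
        linarith [le_max_left 1 ‖Λ s‖, le_max_right 1 ‖Λ s‖]
      calc A * (1 + ‖Λ s‖) ≤ |A| * (1 + ‖Λ s‖) := by gcongr; exact le_abs_self A
        _ ≤ |A| * (2 * max 1 ‖Λ s‖) := by gcongr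
        _ = _ := by ring
    calc ‖Λ' s‖ ^ m ≤ (|A| * 2 * max 1 ‖Λ s‖) ^ m := by gcongr
      _ = (|A| * 2) ^ m * max 1 ‖Λ s‖ ^ m := by rw [_root_.mul_pow]
      _ ≤ (|A| * 2) ^ m * (1 + ‖Λ s‖ ^ m) := by
        gcongr
        rcases le_total 1 ‖Λ s‖ with h | h
        · rw [max_eq_right h]; linarith
        · rw [max_eq_left h]; simp
  simpa using h1.add (HasExp.of_rapid h4)

end Expansions

/-! ### Polylogarithmic functions and logarithmic forms -/

/-- The space of polylogarithmic functions of weight `w` and level `N`. -/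
noncomputable def V (N w : ℕ) : Submodule ℚ (ℂ → ℂ) :=
  Submodule.span ℚ {f | ∃ (j : ℕ) (c : ℂ) (u : List ℂ), c ∈ Zsp N j ∧ IsWord N u ∧
    j + u.length = w ∧ f = fun z => c * G N u z}

/-- The space of logarithmic forms `dz / (z - α)` of level `N`. -/
noncomputable def Forms (N : ℕ) : Submodule ℚ (ℂ → ℂ) :=
  Submodule.span ℚ {f | ∃ α : ℂ, (α = 0 ∨ α ^ N = 1) ∧ f = fun z => 1 / (z - α)}

lemma mul_mem_V {N : ℕ} (hN : 0 < N) {a b : ℕ} {f g : ℂ → ℂ} (hf : f ∈ V N a) (hg : g ∈ V N b) :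
    f * g ∈ V N (a + b) := by
  have h : V N a * V N b ≤ V N (a + b) := by
    rw [V, V, Submodule.span_mul_span, Submodule.span_le]
    rintro _ ⟨_, ⟨i, c, u, hc, hu, rfl, rfl⟩, _, ⟨j, d, v, hd, hv, rfl, rfl⟩, rfl⟩
    have e : (fun z => c * G N u z) * (fun z => d * G N v z) =
        ((shuffle u v).map fun x z => (c * d) * G N x z).sum := by
      funext z
      have h := congrFun (G_mul_G hN hu hv) z
      rw [Pi.mul_apply, list_sum_apply] at h
      rw [list_sum_apply, Pi.mul_apply, List.sum_map_mul_left, ← h]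
      ring
    simp only [SetLike.mem_coe]
    rw [e]
    refine sum_map_mem _ _ _ fun x hx => Submodule.subset_span
      ⟨i + j, c * d, x, mul_mem_Zsp hN hc hd, hu.of_mem_shuffle hv hx, ?_, rfl⟩
    rw [(perm_of_mem_shuffle u v x hx).length_eq, List.length_append]; ring
  exact h (Submodule.mul_mem_mul hf hg)

/-- Integration against `dz/(z - α)` prepends the letter `α`; both arguments are handled by
linearity. -/
lemma exists_primitive {N : ℕ} (hN : 0 < N) {w : ℕ} {f R : ℂ → ℂ} (hf : f ∈ V N w)
    (hR : R ∈ Forms N) : ∃ g ∈ V N (w + 1), ∀ z ∈ Dom N, HasDerivAt g (f z * R z) z := by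
  induction hR using Submodule.span_induction with
  | mem R hR =>
    obtain ⟨α, hα, rfl⟩ := hR
    induction hf using Submodule.span_induction with
    | mem f hf =>
      obtain ⟨j, c, u, hc, hu, rfl, rfl⟩ := hf
      refine ⟨_, Submodule.subset_span ⟨j, c, α :: u, hc, hu.cons hα, ?_, rfl⟩, fun z hz => ?_⟩
      · rw [List.length_cons]; ring
      · have h1 := (hasDerivAt_GPL_cons hN (hu.cons hα) hz).const_mul c
        refine (h1.congr_of_eventuallyEq ?_).congr_deriv ?_
        · filter_upwards [(isOpen_Dom N).mem_nhds hz] with y hy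
          rw [G_apply hy]
        · simp only [G_apply hz]; ring
    | zero => exact ⟨0, Submodule.zero_mem _, fun z _ => by simp⟩
    | add f f' _ _ hf hf' =>
      obtain ⟨g, hg, h⟩ := hf
      obtain ⟨g', hg', h'⟩ := hf'
      exact ⟨g + g', Submodule.add_mem _ hg hg', fun z hz =>
        ((h z hz).add (h' z hz)).congr_deriv (by simp only [Pi.add_apply]; ring)⟩
    | smul c f _ hf =>
      obtain ⟨g, hg, h⟩ := hf
      refine ⟨c • g, Submodule.smul_mem _ _ hg, fun z hz => ?_⟩
      have := (h z hz).const_mul (c : ℂ)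
      refine (this.congr_of_eventuallyEq (Eventually.of_forall fun y => ?_)).congr_deriv ?_
      · simp [Rat.smul_def]
      · simp only [Pi.smul_apply, Rat.smul_def]; ring
  | zero => exact ⟨0, Submodule.zero_mem _, fun z _ => by simp⟩
  | add R R' _ _ hR hR' =>
    obtain ⟨g, hg, h⟩ := hR
    obtain ⟨g', hg', h'⟩ := hR'
    exact ⟨g + g', Submodule.add_mem _ hg hg', fun z hz =>
      ((h z hz).add (h' z hz)).congr_deriv (by simp only [Pi.add_apply]; ring)⟩
  | smul c R _ hR =>
    obtain ⟨g, hg, h⟩ := hR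
    refine ⟨c • g, Submodule.smul_mem _ _ hg, fun z hz => ?_⟩
    have := (h z hz).const_mul (c : ℂ)
    refine (this.congr_of_eventuallyEq (Eventually.of_forall fun y => ?_)).congr_deriv ?_
    · simp [Rat.smul_def]
    · simp only [Pi.smul_apply, Rat.smul_def]; ring

/-- The logarithmic derivative of `p` is the sum of `1/(z - α)` over the roots, with multiplicity.
-/
lemma logDeriv_mem_Forms {N : ℕ} {p : Polynomial ℂ} (hp : p ≠ 0)
    (hroots : ∀ α, p.eval α = 0 → α = 0 ∨ α ^ N = 1) :
    ∃ R ∈ Forms N, ∀ z ∈ Dom N, R z = p.derivative.eval z / p.eval z := by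
  refine ⟨(p.roots.toList.map fun α z => 1 / (z - α)).sum, ?_, fun z hz => ?_⟩
  · refine sum_map_mem _ _ _ fun α hα => Submodule.subset_span ⟨α, hroots α ?_, rfl⟩
    exact (Polynomial.mem_roots hp).1 (Multiset.mem_toList.1 hα)
  · have hz0 : p.eval z ≠ 0 := fun h => Dom.ne_letter hz (hroots z h) (sub_self z)
    rw [(IsAlgClosed.splits p).eval_derivative_div_eval_of_ne_zero hz0, list_sum_apply]
    conv_rhs => rw [← Multiset.coe_toList p.roots]
    rw [Multiset.map_coe, Multiset.sum_coe]

lemma one_sub_div_mem_slitPlane {N : ℕ} {α z : ℂ} (hα : α ^ N = 1) (h0 : α ≠ 0)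
    (hz : z ∈ Dom N) : 1 - z / α ∈ Complex.slitPlane := by
  by_contra h
  obtain ⟨x, hx, hxe⟩ := not_mem_slitPlane_one_sub.1 h
  refine not_mem_slitPlane_one_sub.2 ⟨x ^ N, one_le_pow₀ hx, ?_⟩ hz.2
  rw [div_eq_iff h0] at hxe
  rw [hxe, mul_pow, hα]; push_cast; ring

lemma GPL_singleton {N : ℕ} (hN : 0 < N) {α z : ℂ} (hα : α ^ N = 1) (hz : z ∈ Dom N) :
    GPL [α] z = Complex.log (1 - z / α) := by
  have h0 : α ≠ 0 := by rintro rfl; simp [hN.ne'] at hα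
  have hw : IsWord N [α] := by simpa [IsWord] using Or.inr hα
  have hne : ¬ IsZeroWord [α] := by simpa [IsZeroWord] using h0
  have hd : ∀ w ∈ Dom N, HasDerivAt (fun w => GPL [α] w - Complex.log (1 - w / α)) 0 w := by
    intro w hwD
    have e1 := hasDerivAt_GPL_cons hN hw hwD
    have e2 : HasDerivAt (fun w : ℂ => 1 - w / α) (-(1 / α)) w := by
      simpa using ((hasDerivAt_id w).div_const α).const_sub 1
    refine (e1.sub (e2.clog (one_sub_div_mem_slitPlane hα h0 hwD))).congr_deriv ?_
    have h3 : w - α ≠ 0 := Dom.ne_letter hwD (Or.inr hα)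
    have h4 : α - w ≠ 0 := fun h => h3 (by linear_combination -h)
    rw [GPL_nil, one_sub_div h0]
    field_simp
    ring
  have hray : ∀ t : ℝ, 0 < t → t ≤ 1 →
      HasDerivAt (fun t : ℝ => GPL [α] (t * z) - Complex.log (1 - t * z / α)) 0 t := by
    intro t ht0 ht1
    have e0 : HasDerivAt (fun t : ℝ => (t : ℂ)) 1 t := Complex.ofRealCLM.hasDerivAt
    have e1 : HasDerivAt (fun t : ℝ => (t : ℂ) * z) z t := by simpa using e0.mul_const z
    exact (HasDerivAt.comp_of_eq t (hd _ (Dom.smul_mem hz ht0 ht1)) e1 rfl).congr_deriv (by simp)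
  have hz0 : ∀ᶠ t : ℝ in 𝓝[>] 0, (t : ℂ) * z ≠ 0 := by
    filter_upwards [self_mem_nhdsWithin] with t ht
    exact mul_ne_zero (by exact_mod_cast (ne_of_gt ht)) (Dom.ne_zero hz)
  have hlim : Tendsto (fun t : ℝ => GPL [α] (t * z) - Complex.log (1 - t * z / α))
      (𝓝[>] 0) (𝓝 0) := by
    have l1 := tendsto_GPL_zero hN hw hne (tendsto_ray_zero (z := z)) hz0
    have l2 : Tendsto (fun w : ℂ => Complex.log (1 - w / α)) (𝓝 0) (𝓝 (Complex.log (1 - 0 / α))) := by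
      refine ContinuousAt.tendsto ?_
      exact ContinuousAt.clog (by fun_prop) (by simp)
    have l3 := l1.sub (l2.comp (tendsto_ray_zero (z := z)))
    simpa [Function.comp_def] using l3
  have := eq_of_hasDerivAt_zero_of_tendsto hray hlim
  simp only [Complex.ofReal_one, one_mul] at this
  exact sub_eq_zero.1 this

lemma re_lt_one_of_norm {β : ℂ} (hβ : ‖β‖ = 1) (h1 : β ≠ 1) : β.re < 1 := by
  refine lt_of_le_of_ne ((Complex.re_le_norm β).trans hβ.le) fun h => h1 ?_
  have h2 := Complex.sq_norm β
  rw [Complex.normSq_apply, hβ, h] at h2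
  have h3 : β.im * β.im = 0 := by linarith
  have : β.im = 0 := mul_self_eq_zero.1 h3
  exact Complex.ext (by simpa using h) (by simpa using this)

/-- The value is `G(β⁻¹; 1)`, reached as a radial limit of the closed form of `GPL_singleton`,
because `1` itself is not in the slit domain. -/
lemma log_one_sub_mem_Zsp {N : ℕ} (hN : 0 < N) {β : ℂ} (hβ : β ^ N = 1) (h1 : β ≠ 1) :
    Complex.log (1 - β) ∈ Zsp N 1 := by
  have h0 : β ≠ 0 := by rintro rfl; simp [hN.ne'] at hβ
  have hα : (β⁻¹) ^ N = 1 := by rw [inv_pow, hβ, inv_one]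
  have hA : Adm N [β⁻¹] := by
    refine ⟨by simpa [IsWord] using Or.inr hβ, ?_, by simpa using h0⟩
    simpa using h1
  have hlim : Tendsto (fun t : ℝ => GPL [β⁻¹] t) (𝓝[<] 1) (𝓝 (GPL [β⁻¹] 1)) :=
    (continuousWithinAt_GPL_one hN hA.1 hA.2.1).tendsto.comp tendsto_ofReal_one
  have hlim2 : Tendsto (fun t : ℝ => Complex.log (1 - t * β)) (𝓝[<] 1)
      (𝓝 (Complex.log (1 - ((1 : ℝ) : ℂ) * β))) := by
    refine (ContinuousAt.tendsto ?_).mono_left nhdsWithin_le_nhds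
    refine ContinuousAt.clog (by fun_prop) ?_
    rw [Complex.mem_slitPlane_iff]; left
    have := re_lt_one_of_norm (Complex.norm_eq_one_of_pow_eq_one hβ hN.ne') h1
    simpa using this
  have e : GPL [β⁻¹] 1 = Complex.log (1 - β) := by
    rw [Complex.ofReal_one, one_mul] at hlim2
    refine tendsto_nhds_unique hlim (hlim2.congr' ?_)
    filter_upwards [Ioo_mem_nhdsLT (zero_lt_one (α := ℝ))] with t ht
    rw [GPL_singleton hN hα (ofReal_mem_Dom hN ht.1 ht.2), div_inv_eq_mul]
  have hmem := GPL_one_mem_Zsp hA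
  rwa [List.length_singleton, e] at hmem

/-! ### Expansions at the ends 0, 1 and other roots of unity -/

section Ends

variable {ι : Type*} {l : Filter ι} {Λ γ : ι → ℂ} {N : ℕ}

/-- All polylogarithms of level `N` have expansions in `Λ` along the path `γ`. -/
def GoodEnd (N : ℕ) (l : Filter ι) (Λ γ : ι → ℂ) : Prop :=
  ∀ u, IsWord N u → HasExp N u.length l Λ (fun s => G N u (γ s))

lemma hasExp_of_mem_span {w : ℕ} {S : Set (ℂ → ℂ)}
    (h : ∀ f ∈ S, HasExp N w l Λ (fun s => f (γ s))) {f : ℂ → ℂ} (hf : f ∈ Submodule.span ℚ S) :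
    HasExp N w l Λ (fun s => f (γ s)) := by
  induction hf using Submodule.span_induction with
  | mem f hf => exact h f hf
  | zero => exact HasExp.of_rapid Rapid.zero
  | add f g _ _ hf hg => exact hf.add hg
  | smul c f _ hf => exact (hf.smul c).congr' (Eventually.of_forall fun s => by simp [Rat.smul_def])

lemma GoodEnd.hasExp (h : GoodEnd N l Λ γ) (hN : 0 < N) {w : ℕ} {f : ℂ → ℂ} (hf : f ∈ V N w) :
    HasExp N w l Λ (fun s => f (γ s)) := by
  refine hasExp_of_mem_span ?_ hf
  rintro _ ⟨j, c, u, hc, hu, rfl, rfl⟩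
  exact (HasExp.const hc).mul hN (h u hu)

lemma GoodEnd.change {Λ' : ι → ℂ} (h : GoodEnd N l Λ γ) (hN : 0 < N) (hΛ : HasExp N 1 l Λ' Λ)
    {A : ℝ} (hA : ∀ᶠ s in l, ‖Λ' s‖ ≤ A * (1 + ‖Λ s‖)) : GoodEnd N l Λ' γ :=
  fun u hu => (h u hu).change hN hΛ hA

/-- Words of zeros are monomials in the logarithm. Any other word is rapid: multiplied by `log^m`,
which is up to a factorial the polylogarithm of `m` zeros, it still tends to `0`. -/
lemma goodEnd_zero (hN : 0 < N) (hγ : Tendsto γ l (𝓝 0)) (hD : ∀ᶠ s in l, γ s ∈ Dom N) :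
    GoodEnd N l (fun s => Complex.log (γ s)) γ := by
  intro u hu
  by_cases hz : IsZeroWord u
  · have h1 := ((HasExp.self (N := N) (l := l)
      (Λ := fun s => Complex.log (γ s))).pow hN u.length).smul (1 / (u.length.factorial : ℚ))
    rw [mul_one] at h1
    refine h1.congr' ?_
    filter_upwards [hD] with s hs
    rw [G_apply hs, GPL_of_isZeroWord hz]
    push_cast; ring
  · refine HasExp.of_rapid fun m => ?_
    have h1 := (tendsto_GPL_mul_zero hN hu (isWord_replicate_zero N m) hz hγ
      (hD.mono fun s hs => Dom.ne_zero hs)).mul_const ((m.factorial : ℕ) : ℂ)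
    rw [zero_mul] at h1
    refine h1.congr' ?_
    filter_upwards [hD] with s hs
    have hm : ((m.factorial : ℕ) : ℂ) ≠ 0 := by exact_mod_cast m.factorial_ne_zero
    rw [G_apply hs, GPL_of_isZeroWord (u := List.replicate m 0)
      (fun β hβ => List.eq_of_mem_replicate hβ), List.length_replicate]
    field_simp

/-- Paths tending to `1` inside the closed disc and the domain of holomorphy. -/
structure PathToOne (N : ℕ) (l : Filter ι) (γ : ι → ℂ) : Prop where
  tendsto : Tendsto γ l (𝓝 1)
  norm_le : ∀ᶠ s in l, ‖γ s‖ ≤ 1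
  mem : ∀ᶠ s in l, γ s ∈ Dom N

lemma one_not_mem_Dom : (1 : ℂ) ∉ Dom N := fun h =>
  Complex.slitPlane_ne_zero h.2 (by simp)

lemma PathToOne.norm_tendsto (h : PathToOne N l γ) : Tendsto (fun s => ‖γ s - 1‖) l (𝓝 0) := by
  simpa using (h.tendsto.sub_const 1).norm

lemma PathToOne.eventually_le (h : PathToOne N l γ) {δ : ℝ} (hδ : 0 < δ) :
    ∀ᶠ s in l, ‖γ s - 1‖ ≤ δ :=
  (h.norm_tendsto.eventually (gt_mem_nhds hδ)).mono fun _ hs => le_of_lt hs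

/-- A Hölder exponent `1/4` beats every power of the logarithm. Fourth powers are taken so that the
bound `|log|^{4m} = O(‖γ - 1‖^{-1/2})` can be used. -/
lemma PathToOne.rapid (h : PathToOne N l γ) {f : ι → ℂ} {C : ℝ}
    (hf : ∀ᶠ s in l, ‖f s‖ ≤ C * ‖γ s - 1‖ ^ (1 / 4 : ℝ)) :
    Rapid l (fun s => Complex.log (1 - γ s)) f := by
  intro m
  obtain ⟨K, hK, hb⟩ := exists_norm_log_pow_le (m * 4)
  have hsl : Tendsto (fun s => √(√(C ^ 4 * K * √‖γ s - 1‖))) l (𝓝 0) := by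
    have h1 : Tendsto (fun r : ℝ => √(√(C ^ 4 * K * √r))) (𝓝 0) (𝓝 (√(√(C ^ 4 * K * √0)))) :=
      (by fun_prop : Continuous fun r : ℝ => √(√(C ^ 4 * K * √r))).tendsto 0
    have h2 := h1.comp h.norm_tendsto
    simpa [Function.comp_def] using h2
  refine squeeze_zero_norm' ?_ hsl
  filter_upwards [hf, h.mem, h.eventually_le one_pos] with s h1 h2 h3
  have hne : γ s - 1 ≠ 0 := sub_ne_zero.2 fun h' => one_not_mem_Dom (N := N) (h' ▸ h2)
  have hr : 0 < ‖γ s - 1‖ := norm_pos_iff.2 hne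
  have h4 := hb (1 - γ s) (by rw [← neg_sub]; exact neg_ne_zero.2 hne)
    (by rw [norm_sub_rev]; exact h3)
  rw [norm_sub_rev (1 : ℂ)] at h4
  refine Real.le_sqrt_of_sq_le (Real.le_sqrt_of_sq_le ?_)
  rw [← pow_mul, norm_mul, mul_pow, norm_pow, ← pow_mul]
  have h5 : ‖f s‖ ^ 4 ≤ C ^ 4 * ‖γ s - 1‖ := by
    calc ‖f s‖ ^ 4 ≤ (C * ‖γ s - 1‖ ^ (1 / 4 : ℝ)) ^ 4 := by gcongr
      _ = C ^ 4 * ‖γ s - 1‖ := by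
        rw [mul_pow, ← Real.rpow_natCast (‖γ s - 1‖ ^ (1 / 4 : ℝ)), ← Real.rpow_mul hr.le]
        norm_num
  calc ‖f s‖ ^ (2 * 2) * ‖Complex.log (1 - γ s)‖ ^ (m * (2 * 2))
      ≤ (C ^ 4 * ‖γ s - 1‖) * (K / √‖γ s - 1‖) := by
        norm_num; gcongr
    _ = C ^ 4 * K * √‖γ s - 1‖ := by
        have hs : 0 < √‖γ s - 1‖ := Real.sqrt_pos.2 hr
        nth_rewrite 1 [← Real.sq_sqrt hr.le]
        field_simp

/-- An admissible word has no divergence at `1`: its expansion is its value there, with a Hölder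
remainder. -/
lemma PathToOne.hasExp_adm (h : PathToOne N l γ) (hN : 0 < N) {u : List ℂ} (hu : Adm N u) :
    HasExp N u.length l (fun s => Complex.log (1 - γ s)) (fun s => G N u (γ s)) := by
  cases u with
  | nil =>
    refine (HasExp.const (one_mem_Zsp N)).congr' ?_
    filter_upwards [h.mem] with s hs
    rw [G_apply hs, GPL_nil]
  | cons α u =>
    obtain ⟨C, δ, hC, hδ, hb⟩ := exists_norm_GPL_sub_le hN hu.1 (by simpa using hu.2.1)
    have h1 : Rapid l (fun s => Complex.log (1 - γ s))
        (fun s => GPL (α :: u) (γ s) - GPL (α :: u) 1) := by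
      refine h.rapid (C := C) ?_
      filter_upwards [h.mem, h.norm_le, h.eventually_le hδ] with s h2 h3 h4
      exact hb _ h3 h4 h2
    have h5 := (HasExp.of_rapid (N := N) (w := (α :: u).length) h1).add
      (HasExp.const (GPL_one_mem_Zsp hu))
    refine h5.congr' ?_
    filter_upwards [h.mem] with s hs
    rw [G_apply hs]; ring

lemma PathToOne.hasExp_log (h : PathToOne N l γ) :
    HasExp N 1 l (fun s => Complex.log (1 - γ s)) (fun s => Complex.log (γ s)) := by
  have h1 : (fun q : ℂ => Complex.log q - Complex.log 1) =O[𝓝 1] fun q => q - 1 :=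
    (Complex.hasDerivAt_log Complex.one_mem_slitPlane).differentiableAt.isBigO_sub
  obtain ⟨C, hC, h2⟩ := (h1.comp_tendsto h.tendsto).exists_nonneg
  refine HasExp.of_rapid (h.rapid (C := C) ?_)
  filter_upwards [h2.bound, h.eventually_le one_pos] with s h3 h4
  simp only [Function.comp, Complex.log_one, sub_zero] at h3
  refine h3.trans (mul_le_mul_of_nonneg_left ?_ hC)
  nth_rewrite 1 [← Real.rpow_one ‖γ s - 1‖]
  rcases eq_or_lt_of_le (norm_nonneg (γ s - 1)) with h5 | h5
  · rw [← h5]; simp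
  · exact Real.rpow_le_rpow_of_exponent_ge h5 h4 (by norm_num)

/-- Regularization of leading ones reduces to admissible words times powers of `G(1; q) = log(1 -
q)`, which is the expansion variable itself. -/
lemma PathToOne.hasExp_noTrail (h : PathToOne N l γ) (hN : 0 < N) {u : List ℂ}
    (hu : IsWord N u) (hl : u.getLast? ≠ some 0) :
    HasExp N u.length l (fun s => Complex.log (1 - γ s)) (fun s => G N u (γ s)) := by
  refine hasExp_of_mem_span ?_ (G_mem_leadSpan hN hu hl)
  rintro _ ⟨m, v, hv, hlen, rfl⟩
  have h1 : HasExp N 1 l (fun s => Complex.log (1 - γ s)) (fun s => G N [1] (γ s)) := by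
    refine HasExp.self.congr' ?_
    filter_upwards [h.mem] with s hs
    rw [G_apply hs, GPL_singleton hN (one_pow N) hs, div_one]
  have h2 := (h1.pow hN m).mul hN (h.hasExp_adm hN hv)
  rw [mul_one, hlen] at h2
  exact h2

lemma PathToOne.goodEnd (h : PathToOne N l γ) (hN : 0 < N) :
    GoodEnd N l (fun s => Complex.log (1 - γ s)) γ := by
  intro u hu
  refine hasExp_of_mem_span ?_ (G_mem_trailSpan hN hu)
  rintro _ ⟨k, v, hv, hl, hlen, rfl⟩
  have h1 : HasExp N 1 l (fun s => Complex.log (1 - γ s)) (fun s => G N [0] (γ s)) := by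
    refine h.hasExp_log.congr' ?_
    filter_upwards [h.mem] with s hs
    rw [G_apply hs, GPL_of_isZeroWord (by simp [IsZeroWord])]; simp
  have h2 := (h1.pow hN k).mul hN (h.hasExp_noTrail hN hv hl)
  rw [mul_one, hlen] at h2
  exact h2

/-- Homogeneity of the iterated integral. It needs a word without trailing zeros, because `log` is
not homogeneous. -/
lemma GPL_rotate {ζ : ℂ} (hζ : ζ ≠ 0) (u : List ℂ) (hl : u.getLast? ≠ some 0) (q : ℂ) :
    GPL u (ζ * q) = GPL (u.map fun α => ζ⁻¹ * α) q := by
  induction u generalizing q with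
  | nil => simp [GPL_nil]
  | cons α u ih =>
    have hl' : u.getLast? ≠ some 0 := by
      cases u with
      | nil => simp
      | cons β u => rwa [List.getLast?_cons_cons] at hl
    have hne : ¬ IsZeroWord (α :: u) := by
      intro h
      have hmem : (α :: u).getLast (by simp) ∈ α :: u := List.getLast_mem _
      apply hl
      rw [List.getLast?_eq_getLast_of_ne_nil (by simp), h _ hmem]
    have hne' : ¬ IsZeroWord ((α :: u).map fun α => ζ⁻¹ * α) := by
      intro h
      refine hne fun β hβ => ?_
      have := h _ (List.mem_map_of_mem hβ)
      simpa [hζ] using this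
    rw [GPL_cons hne]
    rw [List.map_cons] at hne' ⊢
    rw [GPL_cons hne']
    congr 1
    funext t
    have e : (t : ℂ) * (ζ * q) = ζ * (t * q) := by ring
    rw [e, ih hl']
    congr 1
    rw [show ζ * (t * q) - α = ζ * (t * q - ζ⁻¹ * α) by field_simp]
    rw [mul_div_mul_left _ _ hζ]

/-- Trailing zeros are split off first, as the resulting powers of `log` do not rotate; for them
`hadd` excludes a jump of the branch and `hlog` gives the constant `log ζ` its weight. The remaining
words are rotated to the end point `1`. -/
lemma goodEnd_rotate {q : ι → ℂ} {ζ : ℂ} (hN : 0 < N) (hζ : ζ ^ N = 1)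
    (hlog : Complex.log ζ ∈ Zsp N 1) (hq : PathToOne N l q)
    (hγ : ∀ᶠ s in l, γ s = ζ * q s) (hD : ∀ᶠ s in l, γ s ∈ Dom N)
    (hadd : ∀ᶠ s in l, Complex.log (γ s) = Complex.log ζ + Complex.log (q s)) :
    GoodEnd N l (fun s => Complex.log (1 - q s)) γ := by
  have h0 : ζ ≠ 0 := by rintro rfl; simp [hN.ne'] at hζ
  intro u hu
  refine hasExp_of_mem_span ?_ (G_mem_trailSpan hN hu)
  rintro _ ⟨k, v, hv, hl, hlen, rfl⟩
  have h1 : HasExp N 1 l (fun s => Complex.log (1 - q s)) (fun s => G N [0] (γ s)) := by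
    refine ((HasExp.const hlog).add hq.hasExp_log).congr' ?_
    filter_upwards [hD, hadd] with s hs h2
    rw [G_apply hs, GPL_of_isZeroWord (by simp [IsZeroWord]), h2]; simp
  have hv' : IsWord N (v.map fun α => ζ⁻¹ * α) := by
    intro β hβ
    obtain ⟨α, hα, rfl⟩ := List.mem_map.1 hβ
    rcases hv α hα with rfl | h
    · left; simp
    · right; rw [mul_pow, inv_pow, hζ, h]; simp
  have hl' : (v.map fun α => ζ⁻¹ * α).getLast? ≠ some 0 := by
    rw [List.getLast?_map]
    intro h
    cases hvl : v.getLast? with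
    | none => rw [hvl] at h; simp at h
    | some β =>
      rw [hvl] at h hl
      simp [h0] at h
      exact hl (by rw [h])
  have h3 : HasExp N v.length l (fun s => Complex.log (1 - q s)) (fun s => G N v (γ s)) := by
    have := hq.hasExp_noTrail hN hv' hl'
    rw [List.length_map] at this
    refine this.congr' ?_
    filter_upwards [hD, hq.mem, hγ] with s h4 h5 h6
    rw [G_apply h4, G_apply h5, h6, GPL_rotate h0 v hl]
  have h2 := (h1.pow hN k).mul hN h3
  rw [mul_one, hlen] at h2
  exact h2

end Ends

/-! ### Arcs and classes of functions stable under integration -/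

/-- A path on `(a, b)` in the domain of holomorphy along which the polylogarithms have expansions
at both ends. -/
structure Arc (N : ℕ) (a b : ℝ) (Λa Λb : ℝ → ℂ) (γ γ' : ℝ → ℂ) : Prop where
  hasDerivAt : ∀ s ∈ Set.Ioo a b, HasDerivAt γ (γ' s) s
  mem : ∀ s ∈ Set.Ioo a b, γ s ∈ Dom N
  left : GoodEnd N (𝓝[>] a) Λa γ
  right : GoodEnd N (𝓝[<] b) Λb γ

/-- Pullbacks of polylogarithmic functions of weight `w` to a path. -/
noncomputable def PathFn (N : ℕ) (a b : ℝ) (γ : ℝ → ℂ) (w : ℕ) : Submodule ℚ (ℝ → ℂ) where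
  carrier := {Φ | ∃ f ∈ V N w, ∀ s ∈ Set.Ioo a b, Φ s = f (γ s)}
  add_mem' := by
    rintro Φ Ψ ⟨f, hf, h⟩ ⟨g, hg, h'⟩
    exact ⟨f + g, Submodule.add_mem _ hf hg, fun s hs => by simp [h s hs, h' s hs]⟩
  zero_mem' := ⟨0, Submodule.zero_mem _, fun s _ => by simp⟩
  smul_mem' := by
    rintro c Φ ⟨f, hf, h⟩
    exact ⟨c • f, Submodule.smul_mem _ _ hf, fun s hs => by simp [h s hs]⟩

/-- Pullbacks of logarithmic forms to a path. -/
noncomputable def PathForm (N : ℕ) (a b : ℝ) (γ γ' : ℝ → ℂ) : Submodule ℚ (ℝ → ℂ) where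
  carrier := {ω | ∃ R ∈ Forms N, ∀ s ∈ Set.Ioo a b, ω s = R (γ s) * γ' s}
  add_mem' := by
    rintro Φ Ψ ⟨f, hf, h⟩ ⟨g, hg, h'⟩
    exact ⟨f + g, Submodule.add_mem _ hf hg, fun s hs => by simp [h s hs, h' s hs, add_mul]⟩
  zero_mem' := ⟨0, Submodule.zero_mem _, fun s _ => by simp⟩
  smul_mem' := by
    rintro c Φ ⟨f, hf, h⟩
    exact ⟨c • f, Submodule.smul_mem _ _ hf, fun s hs => by simp [h s hs]⟩

lemma PathFn.congr {N : ℕ} {a b : ℝ} {γ : ℝ → ℂ} {w : ℕ} {Φ Ψ : ℝ → ℂ}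
    (hΦ : Φ ∈ PathFn N a b γ w) (h : ∀ s ∈ Set.Ioo a b, Ψ s = Φ s) : Ψ ∈ PathFn N a b γ w := by
  obtain ⟨f, hf, hf'⟩ := hΦ
  exact ⟨f, hf, fun s hs => by rw [h s hs, hf' s hs]⟩

lemma PathForm.congr {N : ℕ} {a b : ℝ} {γ γ' : ℝ → ℂ} {Φ Ψ : ℝ → ℂ}
    (hΦ : Φ ∈ PathForm N a b γ γ') (h : ∀ s ∈ Set.Ioo a b, Ψ s = Φ s) :
    Ψ ∈ PathForm N a b γ γ' := by
  obtain ⟨f, hf, hf'⟩ := hΦ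
  exact ⟨f, hf, fun s hs => by rw [h s hs, hf' s hs]⟩

/-- A graded class of functions on `(a, b)` that is stable under integration against the forms `Ω`
and under multiplication by the logarithms `Lg`, and whose limits at the ends are cyclotomic
multiple zeta values. -/
structure PolyClass (N : ℕ) (a b : ℝ) (D : ℕ → Submodule ℚ (ℝ → ℂ))
    (Ω Lg : Submodule ℚ (ℝ → ℂ)) : Prop where
  lt : a < b
  congr : ∀ {w Φ Ψ}, Φ ∈ D w → (∀ s ∈ Set.Ioo a b, Ψ s = Φ s) → Ψ ∈ D w
  form_congr : ∀ {ω ω'}, ω ∈ Ω → (∀ s ∈ Set.Ioo a b, ω' s = ω s) → ω' ∈ Ω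
  const : ∀ {w c}, c ∈ Zsp N w → (fun _ => c) ∈ D w
  prim : ∀ {w Φ ω}, Φ ∈ D w → ω ∈ Ω →
    ∃ Ψ ∈ D (w + 1), ∀ s ∈ Set.Ioo a b, HasDerivAt Ψ (Φ s * ω s) s
  left : ∀ {w Φ L}, Φ ∈ D w → Tendsto Φ (𝓝[>] a) (𝓝 L) → L ∈ Zsp N w
  right : ∀ {w Φ L}, Φ ∈ D w → Tendsto Φ (𝓝[<] b) (𝓝 L) → L ∈ Zsp N w
  mul : ∀ {w Φ g}, Φ ∈ D w → g ∈ Lg → (fun s => Φ s * g s) ∈ D (w + 1)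

lemma one_mem_V {N : ℕ} {w : ℕ} {c : ℂ} (hc : c ∈ Zsp N w) :
    ∃ f ∈ V N w, ∀ z ∈ Dom N, f z = c :=
  ⟨_, Submodule.subset_span ⟨w, c, [], hc, by simp [IsWord], by simp, rfl⟩,
    fun z hz => by rw [G_apply hz, GPL_nil, mul_one]⟩

lemma Arc.prim {N : ℕ} (hN : 0 < N) {a b : ℝ} {Λa Λb γ γ' : ℝ → ℂ} (h : Arc N a b Λa Λb γ γ')
    {w : ℕ} {Φ ω : ℝ → ℂ} (hΦ : Φ ∈ PathFn N a b γ w) (hω : ω ∈ PathForm N a b γ γ') :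
    ∃ Ψ ∈ PathFn N a b γ (w + 1), ∀ s ∈ Set.Ioo a b, HasDerivAt Ψ (Φ s * ω s) s := by
  obtain ⟨f, hf, hf'⟩ := hΦ
  obtain ⟨R, hR, hR'⟩ := hω
  obtain ⟨g, hg, hg'⟩ := exists_primitive hN hf hR
  refine ⟨fun s => g (γ s), ⟨g, hg, fun s _ => rfl⟩, fun s hs => ?_⟩
  have := HasDerivAt.comp_of_eq s (hg' (γ s) (h.mem s hs)) (h.hasDerivAt s hs) rfl
  refine this.congr_deriv ?_
  rw [hf' s hs, hR' s hs]; ring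

lemma PathFn.mul {N : ℕ} (hN : 0 < N) {a b : ℝ} {γ : ℝ → ℂ} {w w' : ℕ} {Φ Ψ : ℝ → ℂ}
    (hΦ : Φ ∈ PathFn N a b γ w) (hΨ : Ψ ∈ PathFn N a b γ w') :
    (fun s => Φ s * Ψ s) ∈ PathFn N a b γ (w + w') := by
  obtain ⟨f, hf, hf'⟩ := hΦ
  obtain ⟨g, hg, hg'⟩ := hΨ
  exact ⟨f * g, mul_mem_V hN hf hg, fun s hs => by simp [hf' s hs, hg' s hs]⟩

/-- The class generated by two arcs with common expansion variables. -/
theorem polyClass_of_arcs {N : ℕ} (hN : 0 < N) {a b : ℝ} (hab : a < b)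
    {Λa Λb γ γ' δ δ' : ℝ → ℂ} (hγ : Arc N a b Λa Λb γ γ') (hδ : Arc N a b Λa Λb δ δ')
    (ha : Tendsto (fun s => ‖Λa s‖) (𝓝[>] a) atTop)
    (hb : Tendsto (fun s => ‖Λb s‖) (𝓝[<] b) atTop) :
    PolyClass N a b (fun w => PathFn N a b γ w ⊔ PathFn N a b δ w)
      (PathForm N a b γ γ' ⊓ PathForm N a b δ δ') (PathFn N a b γ 1 ⊓ PathFn N a b δ 1) where
  lt := hab
  congr := by
    intro w Φ Ψ hΦ h
    obtain ⟨Φ₁, h1, Φ₂, h2, rfl⟩ := Submodule.mem_sup.1 hΦ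
    refine Submodule.mem_sup.2 ⟨fun s => Ψ s - Φ₂ s, PathFn.congr h1 fun s hs => ?_, Φ₂, h2, ?_⟩
    · rw [h s hs]; simp
    · funext s; simp
  form_congr := fun hω h => ⟨PathForm.congr hω.1 h, PathForm.congr hω.2 h⟩
  const := by
    intro w c hc
    obtain ⟨f, hf, hf'⟩ := one_mem_V hc
    exact Submodule.mem_sup_left ⟨f, hf, fun s hs => (hf' _ (hγ.mem s hs)).symm⟩
  prim := by
    intro w Φ ω hΦ hω
    obtain ⟨Φ₁, h1, Φ₂, h2, rfl⟩ := Submodule.mem_sup.1 hΦ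
    obtain ⟨Ψ₁, k1, e1⟩ := hγ.prim hN h1 hω.1
    obtain ⟨Ψ₂, k2, e2⟩ := hδ.prim hN h2 hω.2
    exact ⟨Ψ₁ + Ψ₂, Submodule.add_mem_sup k1 k2, fun s hs =>
      ((e1 s hs).add (e2 s hs)).congr_deriv (by simp only [Pi.add_apply]; ring)⟩
  -- The two summands may diverge separately. Since both arcs share the variable `Λa`, their sum has
  -- one expansion, and the limit is read off from that.
  left := by
    intro w Φ L hΦ hL
    obtain ⟨Φ₁, ⟨f, hf, hf'⟩, Φ₂, ⟨g, hg, hg'⟩, rfl⟩ := Submodule.mem_sup.1 hΦ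
    refine (((hγ.left.hasExp hN hf).add (hδ.left.hasExp hN hg)).congr' ?_).limit_mem ha hL
    filter_upwards [Ioo_mem_nhdsGT hab] with s hs
    simp [hf' s hs, hg' s hs]
  right := by
    intro w Φ L hΦ hL
    obtain ⟨Φ₁, ⟨f, hf, hf'⟩, Φ₂, ⟨g, hg, hg'⟩, rfl⟩ := Submodule.mem_sup.1 hΦ
    refine (((hγ.right.hasExp hN hf).add (hδ.right.hasExp hN hg)).congr' ?_).limit_mem hb hL
    filter_upwards [Ioo_mem_nhdsLT hab] with s hs
    simp [hf' s hs, hg' s hs]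
  mul := by
    -- A function pulled back along one arc can only be multiplied inside the class of that arc, so
    -- the logarithm must be expressible along both.
    intro w Φ g hΦ hg
    obtain ⟨Φ₁, h1, Φ₂, h2, rfl⟩ := Submodule.mem_sup.1 hΦ
    refine Submodule.mem_sup.2 ⟨_, PathFn.mul hN h1 hg.1, _, PathFn.mul hN h2 hg.2, ?_⟩
    funext s
    simp only [Pi.add_apply]; ring

section PolyClass

variable {N : ℕ} {a b : ℝ} {D : ℕ → Submodule ℚ (ℝ → ℂ)} {Ω Lg : Submodule ℚ (ℝ → ℂ)}

lemma exists_const_of_hasDerivAt_zero {f : ℝ → ℂ} (hab : a < b)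
    (h : ∀ s ∈ Set.Ioo a b, HasDerivAt f 0 s) : ∃ c, ∀ s ∈ Set.Ioo a b, f s = c := by
  obtain ⟨m, hm⟩ := Set.nonempty_Ioo.2 hab
  refine ⟨f m, fun s hs => ?_⟩
  exact isOpen_Ioo.is_const_of_deriv_eq_zero (convex_Ioo a b).isPreconnected
    (fun x hx => (h x hx).differentiableAt.differentiableWithinAt) (fun x hx => (h x hx).deriv) hs hm

/-- The primitive inside the class differs from `Ψ` by a constant. That constant is a difference of
limits at one end, hence of the correct weight. -/
lemma PolyClass.mem_of_hasDerivAt (hD : PolyClass N a b D Ω Lg) {w : ℕ} {Φ ω Ψ : ℝ → ℂ} {L : ℂ}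
    (hΦ : Φ ∈ D w) (hω : ω ∈ Ω) (hΨ : ∀ s ∈ Set.Ioo a b, HasDerivAt Ψ (Φ s * ω s) s)
    (hL : L ∈ Zsp N (w + 1))
    (hlim : Tendsto Ψ (𝓝[>] a) (𝓝 L) ∨ Tendsto Ψ (𝓝[<] b) (𝓝 L)) : Ψ ∈ D (w + 1) := by
  obtain ⟨Ψ₀, h0, hd⟩ := hD.prim hΦ hω
  obtain ⟨c, hc⟩ := exists_const_of_hasDerivAt_zero hD.lt (f := fun s => Ψ s - Ψ₀ s)
    (fun s hs => ((hΨ s hs).sub (hd s hs)).congr_deriv (sub_self _))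
  have hcm : c ∈ Zsp N (w + 1) := by
    rcases hlim with hl | hl
    · have h1 : Tendsto Ψ₀ (𝓝[>] a) (𝓝 (L - c)) := by
        refine (hl.sub_const c).congr' ?_
        filter_upwards [Ioo_mem_nhdsGT hD.lt] with s hs
        rw [← hc s hs]; ring
      have := Submodule.sub_mem _ hL (hD.left h0 h1)
      rwa [sub_sub_cancel] at this
    · have h1 : Tendsto Ψ₀ (𝓝[<] b) (𝓝 (L - c)) := by
        refine (hl.sub_const c).congr' ?_
        filter_upwards [Ioo_mem_nhdsLT hD.lt] with s hs
        rw [← hc s hs]; ring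
      have := Submodule.sub_mem _ hL (hD.right h0 h1)
      rwa [sub_sub_cancel] at this
  refine hD.congr (Submodule.add_mem _ h0 (hD.const hcm)) fun s hs => ?_
  have := hc s hs
  simp only [Pi.add_apply, ← this]; ring

/-- Integrability forces the primitive to converge at both ends, so the integral is a difference of
two limits of weight `w + 1`. -/
lemma PolyClass.integral_mem (hD : PolyClass N a b D Ω Lg) {w : ℕ} {Φ ω : ℝ → ℂ}
    (hΦ : Φ ∈ D w) (hω : ω ∈ Ω)
    (hinteg : IntervalIntegrable (fun s => Φ s * ω s) MeasureTheory.volume a b) :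
    ∫ s in a..b, Φ s * ω s ∈ Zsp N (w + 1) := by
  obtain ⟨Ψ, h0, hd⟩ := hD.prim hΦ hω
  have hab := hD.lt
  obtain ⟨m, hm⟩ := Set.nonempty_Ioo.2 hab
  set f := fun s => Φ s * ω s with hf
  have hsub : ∀ x ∈ Set.Icc a b, ∀ y ∈ Set.Icc a b,
      IntervalIntegrable f MeasureTheory.volume x y := fun x hx y hy =>
    hinteg.mono_set (by rw [Set.uIcc_of_le hab.le]; exact Set.uIcc_subset_Icc hx hy)
  have hftc : ∀ s ∈ Set.Ioo a b, Ψ s = Ψ m + ((∫ x in a..s, f x) - ∫ x in a..m, f x) := by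
    intro s hs
    have h1 : ∫ x in m..s, f x = Ψ s - Ψ m := by
      refine intervalIntegral.integral_eq_sub_of_hasDerivAt (fun x hx => hd x ?_)
        (hsub m ⟨hm.1.le, hm.2.le⟩ s ⟨hs.1.le, hs.2.le⟩)
      have := Set.ordConnected_Ioo.uIcc_subset hm hs hx
      exact this
    rw [intervalIntegral.integral_interval_sub_left (hsub a ⟨le_rfl, hab.le⟩ s ⟨hs.1.le, hs.2.le⟩)
      (hsub a ⟨le_rfl, hab.le⟩ m ⟨hm.1.le, hm.2.le⟩), h1]
    ring
  have hcont : ContinuousOn (fun s => ∫ x in a..s, f x) (Set.Icc a b) := by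
    have := intervalIntegral.continuousOn_primitive_interval
      (a := a) (b := b) (f := f) (μ := MeasureTheory.volume) (by
        rw [Set.uIcc_of_le hab.le]
        exact (intervalIntegrable_iff_integrableOn_Icc_of_le hab.le).1 hinteg)
    rwa [Set.uIcc_of_le hab.le] at this
  have hla : Tendsto Ψ (𝓝[>] a) (𝓝 (Ψ m + ((∫ x in a..a, f x) - ∫ x in a..m, f x))) := by
    have h1 := ((hcont a ⟨le_rfl, hab.le⟩).tendsto.mono_left
      (nhdsWithin_le_of_mem (Icc_mem_nhdsGT hab)))
    refine ((h1.sub_const (∫ x in a..m, f x)).const_add (Ψ m)).congr' ?_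
    filter_upwards [Ioo_mem_nhdsGT hab] with s hs using (hftc s hs).symm
  have hlb : Tendsto Ψ (𝓝[<] b) (𝓝 (Ψ m + ((∫ x in a..b, f x) - ∫ x in a..m, f x))) := by
    have h1 := ((hcont b ⟨hab.le, le_rfl⟩).tendsto.mono_left
      (nhdsWithin_le_of_mem (Icc_mem_nhdsLT hab)))
    refine ((h1.sub_const (∫ x in a..m, f x)).const_add (Ψ m)).congr' ?_
    filter_upwards [Ioo_mem_nhdsLT hab] with s hs using (hftc s hs).symm
  have := Submodule.sub_mem _ (hD.right h0 hlb) (hD.left h0 hla)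
  rw [intervalIntegral.integral_same] at this
  convert this using 1
  ring

end PolyClass

/-! ### Power series of polylogarithmic type -/

/-- The power series `∑_{k ≥ 1} h_k x^k / k^r`. -/
noncomputable def pser (h : ℕ → ℝ) (r : ℕ) (x : ℝ) : ℝ :=
  ∑' k : ℕ, h (k + 1) * x ^ (k + 1) / ((k + 1 : ℕ) : ℝ) ^ r

section pser

variable {h : ℕ → ℝ}

lemma norm_pser_term_le (hh : ∀ k, |h k| ≤ k) (r k : ℕ) (x : ℝ) :
    ‖h (k + 1) * x ^ (k + 1) / ((k + 1 : ℕ) : ℝ) ^ r‖ ≤ ((k + 1 : ℕ) : ℝ) * |x| ^ (k + 1) := by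
  have h1 : (1 : ℝ) ≤ ((k + 1 : ℕ) : ℝ) ^ r :=
    one_le_pow₀ (by push_cast; linarith [k.cast_nonneg (α := ℝ)])
  rw [norm_div, norm_mul, norm_pow, Real.norm_eq_abs, Real.norm_eq_abs, Real.norm_eq_abs,
    abs_of_pos (lt_of_lt_of_le one_pos h1)]
  exact (div_le_self (by positivity) h1).trans
    (mul_le_mul_of_nonneg_right (hh (k + 1)) (by positivity))

lemma summable_succ_mul_pow {ρ : ℝ} (h0 : 0 ≤ ρ) (h1 : ρ < 1) :
    Summable fun k : ℕ => ((k + 1 : ℕ) : ℝ) * ρ ^ k := by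
  have a1 := summable_pow_mul_geometric_of_norm_lt_one 1 (r := ρ)
    (by rwa [Real.norm_eq_abs, abs_of_nonneg h0])
  have a2 := summable_geometric_of_lt_one h0 h1
  refine (a1.add a2).congr fun k => ?_
  push_cast; ring

lemma summable_pser (hh : ∀ k, |h k| ≤ k) (r : ℕ) {x : ℝ} (hx : |x| < 1) :
    Summable fun k : ℕ => h (k + 1) * x ^ (k + 1) / ((k + 1 : ℕ) : ℝ) ^ r := by
  refine Summable.of_norm_bounded
    ((summable_succ_mul_pow (abs_nonneg x) hx).mul_right |x|) fun k => ?_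
  refine (norm_pser_term_le hh r k x).trans (le_of_eq ?_)
  rw [pow_succ, mul_assoc]

/-- The operator `x d/dx` lowers `r` by one; the bound `|h k| ≤ k` suffices for locally uniform
convergence of the derived series. -/
lemma hasDerivAt_pser (hh : ∀ k, |h k| ≤ k) (r : ℕ) {x : ℝ} (h0 : 0 < x) (h1 : x < 1) :
    HasDerivAt (pser h (r + 1)) (pser h r x / x) x := by
  obtain ⟨ρ, hρ, hρ1⟩ := exists_between h1
  have hρ0 : 0 < ρ := h0.trans hρ
  have key := hasDerivAt_tsum_of_isPreconnected
    (g := fun k y => h (k + 1) * y ^ (k + 1) / ((k + 1 : ℕ) : ℝ) ^ (r + 1))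
    (g' := fun k y => (h (k + 1) * y ^ (k + 1) / ((k + 1 : ℕ) : ℝ) ^ r) / y)
    (t := Set.Ioo 0 ρ) (y₀ := x) (y := x) (summable_succ_mul_pow hρ0.le hρ1) isOpen_Ioo
    isPreconnected_Ioo ?_ ?_ ⟨h0, hρ⟩
    (summable_pser hh (r + 1) (by rwa [abs_of_pos h0])) ⟨h0, hρ⟩
  · refine key.congr_deriv ?_
    rw [tsum_div_const, pser]
  · intro k y hy
    have hk : ((k + 1 : ℕ) : ℝ) ≠ 0 := by positivity
    refine (((hasDerivAt_pow (k + 1) y).const_mul (h (k + 1))).div_const _).congr_deriv ?_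
    have := hy.1.ne'
    rw [Nat.add_sub_cancel]
    field_simp
    ring
  · intro k y hy
    rw [norm_div, div_le_iff₀ (norm_pos_iff.2 hy.1.ne')]
    refine (norm_pser_term_le hh r k y).trans ?_
    rw [Real.norm_eq_abs, pow_succ, ← mul_assoc]
    refine mul_le_mul_of_nonneg_right (mul_le_mul_of_nonneg_left ?_ (by positivity)) (abs_nonneg y)
    rw [abs_of_pos hy.1]
    exact pow_le_pow_left₀ hy.1.le hy.2.le k

lemma tendsto_pser_zero (hh : ∀ k, |h k| ≤ k) (r : ℕ) : Tendsto (pser h r) (𝓝 0) (𝓝 0) := by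
  have hs := summable_succ_mul_pow (ρ := 1 / 2) (by norm_num) (by norm_num)
  refine squeeze_zero_norm' (a := fun x => (∑' k : ℕ, ((k + 1 : ℕ) : ℝ) * (1 / 2) ^ k) * |x|) ?_ ?_
  · have : ∀ᶠ x : ℝ in 𝓝 0, |x| < 1 / 2 := by
      have := (continuous_abs (G := ℝ)).tendsto 0
      rw [abs_zero] at this
      exact this.eventually_lt_const (by norm_num)
    filter_upwards [this] with x hx
    refine tsum_of_norm_bounded (hs.hasSum.mul_right |x|) fun k => ?_
    refine (norm_pser_term_le hh r k x).trans ?_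
    rw [pow_succ, ← mul_assoc]
    refine mul_le_mul_of_nonneg_right (mul_le_mul_of_nonneg_left ?_ (by positivity)) (abs_nonneg x)
    exact pow_le_pow_left₀ (abs_nonneg x) hx.le k
  · have := ((continuous_abs (G := ℝ)).tendsto 0).const_mul
      (∑' k : ℕ, ((k + 1 : ℕ) : ℝ) * (1 / 2) ^ k)
    simpa using this

end pser

lemma abs_ite_eq_zero_le (k : ℕ) : |(if k = 0 then (0 : ℝ) else 1)| ≤ k := by
  rcases Nat.eq_zero_or_pos k with rfl | hk
  · simp
  · rw [if_neg hk.ne', abs_one]; exact_mod_cast hk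

/-- The polylogarithm `∑_{k ≥ 1} x^k / k^r`. -/
noncomputable abbrev pserOne : ℕ → ℝ → ℝ := pser fun k => if k = 0 then 0 else 1

lemma pserOne_one {x : ℝ} (hx : |x| < 1) : pserOne 1 x = -Real.log (1 - x) := by
  rw [← (Real.hasSum_pow_div_log_of_abs_lt_one hx).tsum_eq]
  exact tsum_congr fun k => by simp

lemma Hn_nonneg (k : ℕ) : 0 ≤ Hn k := by
  unfold Hn harmonic
  push_cast
  positivity

lemma Hn_succ (k : ℕ) : Hn (k + 1) = Hn k + 1 / ((k : ℝ) + 1) := by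
  unfold Hn
  rw [harmonic_succ]
  push_cast
  rw [one_div]

lemma Hn_zero : Hn 0 = 0 := by simp [Hn]

lemma abs_Hn_le (k : ℕ) : |Hn k| ≤ k := by
  rw [abs_of_nonneg (Hn_nonneg k)]
  induction k with
  | zero => simp [Hn_zero]
  | succ k ih =>
    rw [Hn_succ]
    push_cast
    refine add_le_add ih ?_
    rw [div_le_one (by positivity)]
    linarith [k.cast_nonneg (α := ℝ)]

/-- Multiplying the generating function by `1 - x` replaces each `H_k` by the difference `1/k`. -/
lemma pser_Hn_zero {x : ℝ} (hx : |x| < 1) : pser Hn 0 x = -Real.log (1 - x) / (1 - x) := by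
  have h1 : (1 : ℝ) - x ≠ 0 := by linarith [(abs_lt.1 hx).2]
  rw [eq_div_iff h1]
  have hs := summable_pser abs_Hn_le 0 hx
  have hL := Real.hasSum_pow_div_log_of_abs_lt_one hx
  have hs' : Summable fun k : ℕ => Hn k * x ^ (k + 1) := by
    refine (summable_nat_add_iff 1).1 ((hs.mul_right x).congr fun k => ?_)
    rw [pow_zero, div_one]; ring
  have e1 : pser Hn 0 x = (∑' k : ℕ, Hn k * x ^ (k + 1)) + -Real.log (1 - x) := by
    rw [← hL.tsum_eq, ← hs'.tsum_add hL.summable]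
    refine tsum_congr fun k => ?_
    rw [Hn_succ, pow_zero, div_one]; ring
  have e2 : (∑' k : ℕ, Hn k * x ^ (k + 1)) = pser Hn 0 x * x := by
    rw [hs'.tsum_eq_zero_add, Hn_zero, zero_mul, zero_add, pser, ← tsum_mul_right]
    refine tsum_congr fun k => ?_
    rw [pow_zero, div_one]; ring
  rw [e2] at e1
  linarith

section PolyClass

variable {N : ℕ} {a b : ℝ} {D : ℕ → Submodule ℚ (ℝ → ℂ)} {Ω Lg : Submodule ℚ (ℝ → ℂ)}
  {X X' : ℝ → ℝ}

/-- Each step integrates against `dX/X`. The constant of integration is zero because `X` tends to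
`0` at one of the ends and the series has no constant term. -/
lemma PolyClass.pser_comp_mem (hD : PolyClass N a b D Ω Lg) {h : ℕ → ℝ} (hh : ∀ k, |h k| ≤ k)
    (hX : ∀ s ∈ Set.Ioo a b, X s ∈ Set.Ioo (0 : ℝ) 1)
    (hX' : ∀ s ∈ Set.Ioo a b, HasDerivAt X (X' s) s)
    (hω : (fun s => ((X' s / X s : ℝ) : ℂ)) ∈ Ω)
    (hlim : Tendsto X (𝓝[>] a) (𝓝 0) ∨ Tendsto X (𝓝[<] b) (𝓝 0)) {w r : ℕ}
    (hbase : (fun s => ((pser h r (X s) : ℝ) : ℂ)) ∈ D w) (n : ℕ) :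
    (fun s => ((pser h (r + n) (X s) : ℝ) : ℂ)) ∈ D (w + n) := by
  induction n with
  | zero => exact hbase
  | succ n ih =>
    refine hD.mem_of_hasDerivAt (w := w + n) (L := 0) ih hω (fun s hs => ?_)
      (Submodule.zero_mem _) ?_
    · have := ((hasDerivAt_pser hh (r + n) (hX s hs).1 (hX s hs).2).comp s (hX' s hs)).ofReal_comp
      refine this.congr_deriv ?_
      push_cast; ring
    · have ht : Tendsto (fun x : ℝ => (x : ℂ)) (𝓝 0) (𝓝 0) := Complex.continuous_ofReal.tendsto 0
      exact hlim.imp (fun h => ht.comp ((tendsto_pser_zero hh _).comp h))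
        (fun h => ht.comp ((tendsto_pser_zero hh _).comp h))

lemma PolyClass.pserOne_comp_mem (hD : PolyClass N a b D Ω Lg)
    (hX : ∀ s ∈ Set.Ioo a b, X s ∈ Set.Ioo (0 : ℝ) 1)
    (hX' : ∀ s ∈ Set.Ioo a b, HasDerivAt X (X' s) s)
    (hω : (fun s => ((X' s / X s : ℝ) : ℂ)) ∈ Ω)
    (hlim : Tendsto X (𝓝[>] a) (𝓝 0) ∨ Tendsto X (𝓝[<] b) (𝓝 0))
    (hlog : (fun s => ((Real.log (1 - X s) : ℝ) : ℂ)) ∈ D 1) {r : ℕ} (hr : 1 ≤ r) :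
    (fun s => ((pserOne r (X s) : ℝ) : ℂ)) ∈ D r := by
  obtain ⟨n, rfl⟩ := Nat.exists_eq_add_of_le hr
  refine hD.pser_comp_mem abs_ite_eq_zero_le hX hX' hω hlim
    (hD.congr (Submodule.neg_mem _ hlog) fun s hs => ?_) n
  rw [show pser _ 1 (X s) = _ from
    pserOne_one (abs_lt.2 ⟨by linarith [(hX s hs).1], (hX s hs).2⟩)]
  simp

/-- The first integration uses `-log(1-X) dX / (X(1-X))`, that is the sum of the forms `dX/X` and
`dX/(1-X)`; afterwards `dX/X` suffices. This is why `H_k` needs the additional form `hω'`. -/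
lemma PolyClass.pserHn_comp_mem (hD : PolyClass N a b D Ω Lg)
    (hX : ∀ s ∈ Set.Ioo a b, X s ∈ Set.Ioo (0 : ℝ) 1)
    (hX' : ∀ s ∈ Set.Ioo a b, HasDerivAt X (X' s) s)
    (hω : (fun s => ((X' s / X s : ℝ) : ℂ)) ∈ Ω)
    (hω' : (fun s => ((X' s / (1 - X s) : ℝ) : ℂ)) ∈ Ω)
    (hlim : Tendsto X (𝓝[>] a) (𝓝 0) ∨ Tendsto X (𝓝[<] b) (𝓝 0))
    (hlog : (fun s => ((Real.log (1 - X s) : ℝ) : ℂ)) ∈ D 1) {r : ℕ} (hr : 1 ≤ r) :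
    (fun s => ((pser Hn r (X s) : ℝ) : ℂ)) ∈ D (r + 1) := by
  obtain ⟨n, rfl⟩ := Nat.exists_eq_add_of_le hr
  rw [show 1 + n + 1 = 2 + n by ring]
  refine hD.pser_comp_mem abs_Hn_le hX hX' hω hlim ?_ n
  refine hD.mem_of_hasDerivAt (w := 1) (L := 0) (Submodule.neg_mem _ hlog)
    (Submodule.add_mem _ hω hω') (fun s hs => ?_) (Submodule.zero_mem _) ?_
  · have h1 := (hX s hs).1.ne'
    have h2 : 1 - X s ≠ 0 := by linarith [(hX s hs).2]
    have := ((hasDerivAt_pser abs_Hn_le 0 (hX s hs).1 (hX s hs).2).comp s (hX' s hs)).ofReal_comp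
    refine this.congr_deriv ?_
    rw [pser_Hn_zero (abs_lt.2 ⟨by linarith [(hX s hs).1], (hX s hs).2⟩)]
    simp only [Pi.neg_apply, Pi.add_apply]
    norm_cast
    field_simp
    ring
  · have ht : Tendsto (fun x : ℝ => (x : ℂ)) (𝓝 0) (𝓝 0) := Complex.continuous_ofReal.tendsto 0
    exact hlim.imp (fun h => ht.comp ((tendsto_pser_zero abs_Hn_le _).comp h))
      (fun h => ht.comp ((tendsto_pser_zero abs_Hn_le _).comp h))

end PolyClass

/-! ### Beta integrals with logarithmic weights -/

/-- The value `m! / (2 ∏_{j ≤ m} (n + 1/2 + j))` of the Beta integral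
`∫₀¹ u^{2n} (1 - u²)^m du`. -/
noncomputable def betaVal (m n : ℕ) : ℝ :=
  m.factorial / (2 * ∏ j ∈ Finset.range (m + 1), ((n : ℝ) + 1 / 2 + j))

/-- The sum `∑_{j < m} 1 / (n + 1/2 + j)`. -/
noncomputable def halfSum (m n : ℕ) : ℝ := ∑ j ∈ Finset.range m, 1 / ((n : ℝ) + 1 / 2 + j)

lemma betaVal_succ_left (m n : ℕ) :
    betaVal (m + 1) n = betaVal m n * (m + 1) / (n + 1 / 2 + (m + 1)) := by
  unfold betaVal
  rw [Finset.prod_range_succ _ (m + 1), Nat.factorial_succ]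
  have h : ∏ j ∈ Finset.range (m + 1), ((n : ℝ) + 1 / 2 + j) ≠ 0 :=
    Finset.prod_ne_zero_iff.2 fun j _ => by positivity
  push_cast
  field_simp

lemma betaVal_succ_right (m n : ℕ) :
    betaVal m (n + 1) = betaVal m n * (n + 1 / 2) / (n + 1 / 2 + (m + 1)) := by
  unfold betaVal
  have e : (∏ j ∈ Finset.range (m + 1), (((n + 1 : ℕ) : ℝ) + 1 / 2 + j)) * (n + 1 / 2) =
      (∏ j ∈ Finset.range (m + 1), ((n : ℝ) + 1 / 2 + j)) * (n + 1 / 2 + (m + 1)) := by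
    have h1 := Finset.prod_range_succ (fun j : ℕ => (n : ℝ) + 1 / 2 + j) (m + 1)
    have h2 := Finset.prod_range_succ' (fun j : ℕ => (n : ℝ) + 1 / 2 + j) (m + 1)
    rw [h1] at h2
    push_cast at h2 ⊢
    rw [h2, add_zero]
    congr 1
    exact Finset.prod_congr rfl fun j _ => by ring
  have h : ∏ j ∈ Finset.range (m + 1), ((n : ℝ) + 1 / 2 + j) ≠ 0 :=
    Finset.prod_ne_zero_iff.2 fun j _ => by positivity
  have h' : ∏ j ∈ Finset.range (m + 1), (((n + 1 : ℕ) : ℝ) + 1 / 2 + j) ≠ 0 :=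
    Finset.prod_ne_zero_iff.2 fun j _ => by positivity
  have h3 : (n : ℝ) + 1 / 2 + (m + 1) ≠ 0 := by positivity
  have h4 : (n : ℝ) + 1 / 2 ≠ 0 := by positivity
  rw [div_mul_eq_mul_div, div_div, div_eq_div_iff (mul_ne_zero two_ne_zero h')
    (mul_ne_zero (mul_ne_zero two_ne_zero h) h3)]
  linear_combination (-2 * (m.factorial : ℝ)) * e

lemma halfSum_succ (m n : ℕ) : halfSum (m + 1) n = halfSum m n + 1 / (n + 1 / 2 + m) :=
  Finset.sum_range_succ _ _

lemma halfSum_succ_right (m n : ℕ) :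
    halfSum m (n + 1) = halfSum m n - 1 / (n + 1 / 2) + 1 / (n + 1 / 2 + m) := by
  have h1 := Finset.sum_range_succ (fun j : ℕ => 1 / ((n : ℝ) + 1 / 2 + j)) m
  have h2 := Finset.sum_range_succ' (fun j : ℕ => 1 / ((n : ℝ) + 1 / 2 + j)) m
  rw [h1] at h2
  unfold halfSum
  have h3 : ∑ j ∈ Finset.range m, 1 / (((n + 1 : ℕ) : ℝ) + 1 / 2 + j) =
      ∑ j ∈ Finset.range m, 1 / ((n : ℝ) + 1 / 2 + (j + 1 : ℕ)) :=
    Finset.sum_congr rfl fun j _ => by push_cast; ring_nf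
  rw [h3]
  simp only [Nat.cast_zero, add_zero] at h2
  linarith

/-- The weighted Beta integral `∫₀¹ u^{2n} (1 - u²)^m g(u) du`. -/
noncomputable def betaInt (g : ℝ → ℝ) (m n : ℕ) : ℝ :=
  ∫ u in (0 : ℝ)..1, u ^ (2 * n) * (1 - u ^ 2) ^ m * g u

lemma intervalIntegrable_beta {g : ℝ → ℝ} (hg : IntervalIntegrable g MeasureTheory.volume 0 1)
    (m n : ℕ) : IntervalIntegrable (fun u => u ^ (2 * n) * (1 - u ^ 2) ^ m * g u)
      MeasureTheory.volume 0 1 :=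
  hg.continuousOn_mul (by fun_prop)

/-- One factor `1 - u²` is expanded; this reduces all `m` to `m = 0` for any weight. -/
lemma betaInt_rec {g : ℝ → ℝ} (hg : IntervalIntegrable g MeasureTheory.volume 0 1) (m n : ℕ) :
    betaInt g (m + 1) n = betaInt g m n - betaInt g m (n + 1) := by
  unfold betaInt
  rw [← intervalIntegral.integral_sub (intervalIntegrable_beta hg m n)
    (intervalIntegrable_beta hg m (n + 1))]
  refine intervalIntegral.integral_congr fun u _ => ?_
  ring

lemma betaInt_one (m n : ℕ) : betaInt (fun _ => 1) m n = betaVal m n := by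
  have hg : IntervalIntegrable (fun _ : ℝ => (1 : ℝ)) MeasureTheory.volume 0 1 := by simp
  induction m generalizing n with
  | zero =>
    simp [betaInt, betaVal]
    have h4 : (n : ℝ) + 2⁻¹ = (2 * n + 1) / 2 := by ring
    rw [h4]
    field_simp
  | succ m ih =>
    rw [betaInt_rec hg, ih, ih, betaVal_succ_left, betaVal_succ_right]
    have h3 : (n : ℝ) + 1 / 2 + (m + 1) ≠ 0 := by positivity
    field_simp
    ring

lemma intervalIntegrable_log_sq :
    IntervalIntegrable (fun u : ℝ => Real.log (u ^ 2)) MeasureTheory.volume 0 1 := by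
  simp only [Real.log_pow]
  exact intervalIntegral.intervalIntegrable_log'.const_mul _

/-- The weight `log u²` is the derivative in `n` of `u^{2n}`, and the right side is the logarithmic
derivative in `n` of the Beta value. The case `m = 0` has an explicit primitive; the recursion in
`m` does the rest. -/
lemma betaInt_log_sq (m n : ℕ) :
    betaInt (fun u => Real.log (u ^ 2)) m n = -(betaVal m n * halfSum (m + 1) n) := by
  induction m generalizing n with
  | zero =>
    have key : betaInt (fun u => Real.log (u ^ 2)) 0 n =
        (1 : ℝ) ^ (2 * n) * (2 / (2 * n + 1) * (1 * Real.log 1) - 2 / (2 * n + 1) ^ 2 * 1) -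
        (0 : ℝ) ^ (2 * n) * (2 / (2 * n + 1) * (0 * Real.log 0) - 2 / (2 * n + 1) ^ 2 * 0) := by
      unfold betaInt
      refine intervalIntegral.integral_eq_sub_of_hasDerivAt_of_le
        (f := fun u : ℝ => u ^ (2 * n) * (2 / (2 * n + 1) * (u * Real.log u) -
          2 / (2 * n + 1) ^ 2 * u)) zero_le_one ?_ ?_ ?_
      · have := Real.continuous_mul_log
        fun_prop
      · intro u hu
        have hu0 : u ≠ 0 := hu.1.ne'
        have h1 := (hasDerivAt_pow (2 * n) u).mul
          (((Real.hasDerivAt_mul_log hu0).const_mul (2 / (2 * (n : ℝ) + 1))).sub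
            ((hasDerivAt_id u).const_mul (2 / (2 * (n : ℝ) + 1) ^ 2)))
        refine h1.congr_deriv ?_
        have h2 : ((2 * n : ℕ) : ℝ) * u ^ (2 * n - 1) * u = (2 * n) * u ^ (2 * n) := by
          rcases n with _ | n
          · simp
          · rw [show 2 * (n + 1) - 1 = 2 * n + 1 by omega]; push_cast; ring
        have h3 : (2 * (n : ℝ) + 1) ≠ 0 := by positivity
        push_cast at h2 ⊢
        simp only [Pi.sub_apply, id, Real.log_pow, pow_zero]
        field_simp
        push_cast
        linear_combination (2 * Real.log u * (2 * n + 1) - 2) * h2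
      · exact intervalIntegrable_beta intervalIntegrable_log_sq 0 n
    rw [key]
    simp [betaVal, halfSum]
    have h3 : (2 * (n : ℝ) + 1) ≠ 0 := by positivity
    have h4 : (n : ℝ) + 2⁻¹ = (2 * n + 1) / 2 := by ring
    rw [h4]
    field_simp
  | succ m ih =>
    rw [betaInt_rec intervalIntegrable_log_sq, ih, ih, betaVal_succ_left, betaVal_succ_right,
      halfSum_succ_right, halfSum_succ (m + 1)]
    have h3 : (n : ℝ) + 1 / 2 + (m + 1) ≠ 0 := by positivity
    have h4 : (n : ℝ) + 1 / 2 ≠ 0 := by positivity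
    push_cast
    set a : ℝ := (n : ℝ) + 1 / 2
    field_simp
    ring

lemma log_one_sub_sq {u : ℝ} (h0 : 0 < u) (h1 : u < 1) :
    Real.log (1 - u ^ 2) = Real.log (1 - u) + Real.log (1 + u) := by
  rw [← Real.log_mul (by linarith) (by linarith)]
  congr 1; ring

lemma intervalIntegrable_log_one_sub :
    IntervalIntegrable (fun u : ℝ => Real.log (1 - u)) MeasureTheory.volume 0 1 := by
  have := (intervalIntegral.intervalIntegrable_log' (a := 1) (b := 0)).comp_sub_left 1
  simpa using this

lemma intervalIntegrable_log_one_add :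
    IntervalIntegrable (fun u : ℝ => Real.log (1 + u)) MeasureTheory.volume 0 1 := by
  have := (intervalIntegral.intervalIntegrable_log' (a := 1) (b := 2)).comp_add_left 1
  simpa [show (2 : ℝ) - 1 = 1 by norm_num] using this

lemma intervalIntegrable_log_one_sub_sq :
    IntervalIntegrable (fun u : ℝ => Real.log (1 - u ^ 2)) MeasureTheory.volume 0 1 := by
  refine (intervalIntegrable_log_one_sub.add intervalIntegrable_log_one_add).congr_ae ?_
  rw [Set.uIoc_of_le zero_le_one, ← MeasureTheory.restrict_Ioo_eq_restrict_Ioc]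
  refine (MeasureTheory.ae_restrict_iff' measurableSet_Ioo).2 (Eventually.of_forall fun u hu => ?_)
  exact (log_one_sub_sq hu.1 hu.2).symm

lemma betaInt_log_one_sub_sq_zero_zero :
    betaInt (fun u => Real.log (1 - u ^ 2)) 0 0 = 2 * Real.log 2 - 2 := by
  have h1 : betaInt (fun u => Real.log (1 - u ^ 2)) 0 0 =
      ∫ u in (0 : ℝ)..1, (Real.log (1 - u) + Real.log (1 + u)) := by
    unfold betaInt
    rw [intervalIntegral.integral_of_le zero_le_one, intervalIntegral.integral_of_le zero_le_one,
      MeasureTheory.integral_Ioc_eq_integral_Ioo, MeasureTheory.integral_Ioc_eq_integral_Ioo]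
    refine MeasureTheory.setIntegral_congr_fun measurableSet_Ioo fun u hu => ?_
    simp [log_one_sub_sq hu.1 hu.2]
  rw [h1, intervalIntegral.integral_add intervalIntegrable_log_one_sub
    intervalIntegrable_log_one_add, intervalIntegral.integral_comp_sub_left (fun x => Real.log x),
    intervalIntegral.integral_comp_add_left (fun x => Real.log x), integral_log, integral_log]
  norm_num

/-- Integrate the derivative of `u (1-u²)^{m+1} log(1-u²)`, which vanishes at both ends. -/
lemma betaInt_log_one_sub_sq_succ_zero (m : ℕ) :
    (2 * m + 3) * betaInt (fun u => Real.log (1 - u ^ 2)) (m + 1) 0 =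
      2 * (m + 1) * betaInt (fun u => Real.log (1 - u ^ 2)) m 0 + 2 * betaVal m 0
        - 2 * betaVal (m + 1) 0 := by
  set g := fun u : ℝ => Real.log (1 - u ^ 2)
  have i1 := intervalIntegrable_beta intervalIntegrable_log_one_sub_sq (m + 1) 0
  have i2 := intervalIntegrable_beta intervalIntegrable_log_one_sub_sq m 0
  have hg : IntervalIntegrable (fun _ : ℝ => (1 : ℝ)) MeasureTheory.volume 0 1 := by simp
  have i3 := intervalIntegrable_beta hg m 0
  have i4 := intervalIntegrable_beta hg (m + 1) 0
  have key : ∫ u in (0 : ℝ)..1, ((2 * m + 3) * (u ^ (2 * 0) * (1 - u ^ 2) ^ (m + 1) * g u) -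
      (2 * (m + 1) * (u ^ (2 * 0) * (1 - u ^ 2) ^ m * g u) +
        2 * (u ^ (2 * 0) * (1 - u ^ 2) ^ m * 1) -
        2 * (u ^ (2 * 0) * (1 - u ^ 2) ^ (m + 1) * 1))) =
      1 * (1 - 1 ^ 2) ^ m * ((1 - 1 ^ 2) * Real.log (1 - 1 ^ 2)) -
      0 * (1 - 0 ^ 2) ^ m * ((1 - 0 ^ 2) * Real.log (1 - 0 ^ 2)) := by
    refine intervalIntegral.integral_eq_sub_of_hasDerivAt_of_le
      -- The factor `(1-u²) log(1-u²)` is kept together so that continuity of `x log x` gives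
      -- continuity at `u = 1`.
      (f := fun u : ℝ => u * (1 - u ^ 2) ^ m * ((1 - u ^ 2) * Real.log (1 - u ^ 2)))
      zero_le_one ?_ ?_ ?_
    · have h1 : Continuous fun u : ℝ => (1 - u ^ 2) * Real.log (1 - u ^ 2) :=
        Real.continuous_mul_log.comp (by fun_prop)
      fun_prop
    · intro u hu
      have hu0 : 1 - u ^ 2 ≠ 0 := by nlinarith [hu.1, hu.2]
      have d1 : HasDerivAt (fun u : ℝ => 1 - u ^ 2) (-(2 * u)) u := by
        simpa using (hasDerivAt_pow 2 u).const_sub 1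
      have d2 := ((hasDerivAt_id u).mul (d1.pow (m + 1))).mul (d1.log hu0)
      refine (d2.congr_of_eventuallyEq (Eventually.of_forall fun y => ?_)).congr_deriv ?_
      · simp only [Pi.mul_apply, Pi.pow_apply, id]; ring
      · simp only [Pi.mul_apply, Pi.pow_apply, id, g, Nat.add_sub_cancel]
        push_cast
        field_simp
        ring
    · exact (i1.const_mul _).sub (((i2.const_mul _).add (i3.const_mul _)).sub (i4.const_mul _))
  rw [intervalIntegral.integral_sub (i1.const_mul _)
    (((i2.const_mul _).add (i3.const_mul _)).sub (i4.const_mul _)),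
    intervalIntegral.integral_sub ((i2.const_mul _).add (i3.const_mul _)) (i4.const_mul _),
    intervalIntegral.integral_add (i2.const_mul _) (i3.const_mul _)] at key
  simp only [intervalIntegral.integral_const_mul] at key
  have e3 := betaInt_one m 0
  have e4 := betaInt_one (m + 1) 0
  unfold betaInt at e3 e4 ⊢
  rw [← e3, ← e4]
  simp only [one_pow, sub_self, zero_mul, mul_zero] at key
  simp only [g, mul_zero]
  linarith

/-- The derivative of the Beta value in `m`, that is `ψ(m+1) - ψ(m+n+3/2)`; the term `2 log 2` is
`ψ(1) - ψ(1/2)`. Here the recursion is used backwards, to raise `n` from the case `n = 0`. -/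
lemma betaInt_log_one_sub_sq (m n : ℕ) :
    betaInt (fun u => Real.log (1 - u ^ 2)) m n =
      betaVal m n * (Hn m + 2 * Real.log 2 - halfSum (m + n + 1) 0) := by
  induction n generalizing m with
  | zero =>
    induction m with
    | zero =>
      rw [betaInt_log_one_sub_sq_zero_zero]
      simp [betaVal, halfSum, Hn_zero]
    | succ m ih =>
      have h := betaInt_log_one_sub_sq_succ_zero m
      rw [ih, betaVal_succ_left] at h
      rw [betaVal_succ_left, show m + 1 + 0 + 1 = (m + 0 + 1) + 1 by ring, halfSum_succ, Hn_succ]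
      have h3 : (2 * (m : ℝ) + 3) ≠ 0 := by positivity
      refine mul_left_cancel₀ h3 (h.trans ?_)
      have h4 : ((0 : ℕ) : ℝ) + 1 / 2 + (m + 1) = (2 * m + 3) / 2 := by push_cast; ring
      push_cast at h4 ⊢
      simp only [add_zero] at h4 ⊢
      rw [h4]
      have h5 : (m : ℝ) + 1 ≠ 0 := by positivity
      field_simp
      ring
  | succ n ih =>
    have h := betaInt_rec intervalIntegrable_log_one_sub_sq m n
    rw [ih, ih, betaVal_succ_left] at h
    rw [show m + 1 + n + 1 = (m + n + 1) + 1 by ring, halfSum_succ, Hn_succ] at h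
    rw [betaVal_succ_right, show m + (n + 1) + 1 = (m + n + 1) + 1 by ring, halfSum_succ]
    have h3 : (n : ℝ) + 1 / 2 + (m + 1) ≠ 0 := by positivity
    have h4 : ((0 : ℕ) : ℝ) + 1 / 2 + ((m + n + 1 : ℕ) : ℝ) = n + 1 / 2 + (m + 1) := by
      push_cast; ring
    rw [h4] at h ⊢
    have h5 : (m : ℝ) + 1 ≠ 0 := by positivity
    rw [← sub_eq_iff_eq_add'] at *
    have h6 : betaInt (fun u => Real.log (1 - u ^ 2)) m (n + 1) =
      betaVal m n * (Hn m + 2 * Real.log 2 - halfSum (m + n + 1) 0) -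
      betaVal m n * (m + 1) / (n + 1 / 2 + (m + 1)) *
        (Hn m + 1 / (m + 1) + 2 * Real.log 2 -
          (halfSum (m + n + 1) 0 + 1 / (n + 1 / 2 + (m + 1)))) := by linarith
    rw [h6]
    field_simp
    ring

/-! ### The binomial coefficients and convergence of the series -/

lemma prod_half_eq (m k : ℕ) :
    ∏ j ∈ Finset.range m, ((k : ℝ) + 1 / 2 + j) =
      (2 * (k + m)).factorial * k.factorial / (4 ^ m * (k + m).factorial * (2 * k).factorial) := by
  induction m with
  | zero =>
    have h1 : ((2 * k).factorial : ℝ) ≠ 0 := by positivity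
    have h2 : (k.factorial : ℝ) ≠ 0 := by positivity
    simp
    field_simp
  | succ m ih =>
    rw [Finset.prod_range_succ, ih, show 2 * (k + (m + 1)) = 2 * (k + m) + 1 + 1 by ring,
      show k + (m + 1) = k + m + 1 by ring, Nat.factorial_succ, Nat.factorial_succ,
      Nat.factorial_succ (k + m)]
    have h1 : ((2 * k).factorial : ℝ) ≠ 0 := by positivity
    have h2 : ((k + m).factorial : ℝ) ≠ 0 := by positivity
    have h3 : (k : ℝ) + m + 1 ≠ 0 := by positivity
    push_cast
    field_simp
    ring

lemma halfSum_eq (m k : ℕ) :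
    halfSum m k = 2 * Hn (2 * (k + m)) - Hn (k + m) - 2 * Hn (2 * k) + Hn k := by
  induction m with
  | zero => simp [halfSum]
  | succ m ih =>
    rw [halfSum_succ, ih, show 2 * (k + (m + 1)) = 2 * (k + m) + 1 + 1 by ring,
      show k + (m + 1) = k + m + 1 by ring, Hn_succ, Hn_succ, Hn_succ (k + m)]
    have h3 : (k : ℝ) + m + 1 ≠ 0 := by positivity
    have h4 : (k : ℝ) + 1 / 2 + m = (2 * (k + m) + 1) / 2 := by ring
    rw [h4]
    push_cast
    have h5 : 2 * ((k : ℝ) + m) + 1 ≠ 0 := by positivity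
    have h6 : 2 * ((k : ℝ) + m) + 1 + 1 = 2 * (k + m + 1) := by ring
    rw [h6]
    field_simp
    ring

/-- The coefficient `binom(2k,k) / (binom(3k,k) binom(6k,3k))`. -/
noncomputable def binomCoef (k : ℕ) : ℝ :=
  (2 * k).factorial ^ 2 * (3 * k).factorial / (k.factorial * (6 * k).factorial)

lemma binomCoef_pos (k : ℕ) : 0 < binomCoef k := by unfold binomCoef; positivity

lemma S6Term_eq (a : ℕ → ℝ) (r : ℕ) (z : ℝ) (k : ℕ) :
    S6Term a r z k = a k * binomCoef k * z ^ k / (k : ℝ) ^ (r + 1) := by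
  unfold S6Term binomCoef
  rw [Nat.cast_choose ℝ (show k ≤ 2 * k by omega), Nat.cast_choose ℝ (show k ≤ 3 * k by omega),
    Nat.cast_choose ℝ (show 3 * k ≤ 6 * k by omega), show 2 * k - k = k by omega,
    show 3 * k - k = 2 * k by omega, show 6 * k - 3 * k = 3 * k by omega]
  rcases Nat.eq_zero_or_pos k with rfl | hk
  · simp
  have h1 : (k.factorial : ℝ) ≠ 0 := by positivity
  have h2 : ((2 * k).factorial : ℝ) ≠ 0 := by positivity
  have h3 : ((3 * k).factorial : ℝ) ≠ 0 := by positivity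
  have h4 : ((6 * k).factorial : ℝ) ≠ 0 := by positivity
  field_simp

/-- The exponent `2k - 1` rather than `2k` accounts both for the `1/k` on the right and for the
measure `du/(1-u²)` after summation. -/
lemma betaVal_eq_binomCoef {k : ℕ} (hk : 0 < k) :
    4 * betaVal (2 * k - 1) k = 16 ^ k * binomCoef k / k := by
  unfold betaVal binomCoef
  rw [Nat.sub_add_cancel (by omega), prod_half_eq, show k + 2 * k = 3 * k by ring,
    show 2 * (3 * k) = 6 * k by ring]
  obtain ⟨n, hn⟩ : ∃ n, 2 * k = n + 1 := ⟨2 * k - 1, by omega⟩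
  have e : ((2 * k).factorial : ℝ) = 2 * k * (2 * k - 1).factorial := by
    rw [hn, Nat.factorial_succ, Nat.add_sub_cancel, ← hn]; push_cast; ring
  have e2 : (4 : ℝ) ^ (2 * k) = 16 ^ k := by rw [pow_mul]; norm_num
  rw [e2, e]
  have h1 : (k.factorial : ℝ) ≠ 0 := by positivity
  have h4 : ((6 * k).factorial : ℝ) ≠ 0 := by positivity
  field_simp
  ring

lemma binomCoef_succ (k : ℕ) :
    binomCoef (k + 1) =
      binomCoef k * ((k + 1) * (2 * k + 1) / (6 * (6 * k + 1) * (6 * k + 5))) := by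
  unfold binomCoef
  rw [show 2 * (k + 1) = 2 * k + 1 + 1 by ring, show 3 * (k + 1) = 3 * k + 1 + 1 + 1 by ring,
    show 6 * (k + 1) = 6 * k + 1 + 1 + 1 + 1 + 1 + 1 by ring]
  simp only [Nat.factorial_succ]
  have h1 : (k.factorial : ℝ) ≠ 0 := by positivity
  have h4 : ((6 * k).factorial : ℝ) ≠ 0 := by positivity
  push_cast
  have e1 : (6 * (k : ℝ) + 5 + 1) = 6 * (k + 1) := by ring
  have e2 : (6 * (k : ℝ) + 4 + 1) = 6 * k + 5 := by ring
  have e3 : (6 * (k : ℝ) + 3 + 1) = 2 * (3 * k + 2) := by ring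
  have e4 : (6 * (k : ℝ) + 2 + 1) = 3 * (2 * k + 1) := by ring
  have e5 : (6 * (k : ℝ) + 1 + 1) = 2 * (3 * k + 1) := by ring
  rw [e1, e2, e3, e4, e5]
  have : (3 * (k : ℝ) + 1) ≠ 0 := by positivity
  have : (3 * (k : ℝ) + 2) ≠ 0 := by positivity
  have : (2 * (k : ℝ) + 1) ≠ 0 := by positivity
  field_simp
  ring

/-- Consecutive quotients tend to `1/108`, the reciprocal of the radius of convergence. After
removing that factor the square grows at most linearly; the constant `16` covers `k = 1`, where the
square is `12.96`. -/
lemma binomCoef_sq_le {k : ℕ} (hk : 1 ≤ k) : (binomCoef k * 108 ^ k) ^ 2 ≤ 16 * k := by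
  induction k, hk using Nat.le_induction with
  | base =>
    norm_num [binomCoef, Nat.factorial]
  | succ k hk ih =>
    have h0 : (1 : ℝ) ≤ k := by exact_mod_cast hk
    have h1 : (0 : ℝ) < (6 * k + 1) * (6 * k + 5) := by positivity
    have h2 : binomCoef (k + 1) * 108 ^ (k + 1) = (binomCoef k * 108 ^ k) *
        (18 * ((k + 1) * (2 * k + 1)) / ((6 * k + 1) * (6 * k + 5))) := by
      rw [binomCoef_succ, pow_succ]; field_simp; ring
    rw [h2, mul_pow]
    refine (mul_le_mul_of_nonneg_right ih (sq_nonneg _)).trans ?_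
    rw [div_pow, ← mul_div_assoc, div_le_iff₀ (by positivity)]
    push_cast
    nlinarith [mul_pos (show (0 : ℝ) < k by linarith) (show (0 : ℝ) < k + 1 by linarith), sq_nonneg ((k : ℝ) ^ 2 + k)]

lemma binomCoef_le {k : ℕ} (hk : 1 ≤ k) : binomCoef k * 108 ^ k ≤ 4 * (k : ℝ) ^ (1 / 2 : ℝ) := by
  rw [← Real.sqrt_eq_rpow]
  have h := Real.le_sqrt_of_sq_le (binomCoef_sq_le hk)
  rw [Real.sqrt_mul (by norm_num), show (16 : ℝ) = 4 ^ 2 by norm_num,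
    Real.sqrt_sq (by norm_num)] at h
  exact h

lemma Hn_six_mul_le {k : ℕ} (hk : 1 ≤ k) : Hn (6 * k) ≤ 9 * (k : ℝ) ^ (1 / 4 : ℝ) := by
  have h0 : (1 : ℝ) ≤ k := by exact_mod_cast hk
  have h1 : Hn (6 * k) ≤ 1 + Real.log ((6 * k : ℕ) : ℝ) := harmonic_le_one_add_log _
  have h2 := Real.log_le_rpow_div (x := ((6 * k : ℕ) : ℝ)) (by positivity)
    (show (0 : ℝ) < 1 / 4 by norm_num)
  have h3 : ((6 * k : ℕ) : ℝ) ^ (1 / 4 : ℝ) ≤ 2 * (k : ℝ) ^ (1 / 4 : ℝ) := by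
    push_cast
    rw [Real.mul_rpow (by norm_num) (by positivity)]
    refine mul_le_mul_of_nonneg_right ?_ (by positivity)
    calc (6 : ℝ) ^ (1 / 4 : ℝ) ≤ (2 ^ (4 : ℝ)) ^ (1 / 4 : ℝ) :=
          Real.rpow_le_rpow (by norm_num) (by norm_num) (by norm_num)
      _ = 2 := by rw [← Real.rpow_mul (by norm_num)]; norm_num
  have h4 : (1 : ℝ) ≤ (k : ℝ) ^ (1 / 4 : ℝ) := Real.one_le_rpow h0 (by norm_num)
  linarith

/-- Absolute convergence holds even on the boundary `z = 108`: the coefficient contributes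
`k^{1/2}`, the harmonic numbers `k^{1/4}`, and the denominator at least `k²` as `r ≥ 1`, which
leaves `k^{-5/4}`. -/
lemma summable_S6Term {a : ℕ → ℝ} {C : ℝ} (ha : ∀ k, 1 ≤ k → |a k| ≤ C * Hn (6 * k)) {r : ℕ}
    (hr : 1 ≤ r) {z : ℝ} (hz : 0 ≤ z) (hz' : z ≤ 108) :
    Summable fun k : ℕ => S6Term a r z (k + 1) := by
  have hC : 0 ≤ C := by
    have := (abs_nonneg _).trans (ha 1 le_rfl)
    have h2 : 0 < Hn (6 * 1) := by norm_num [Hn, harmonic, Finset.sum_range_succ]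
    exact nonneg_of_mul_nonneg_left this h2
  have hs : Summable fun k : ℕ => (C * 36) * (1 / ((k + 1 : ℕ) : ℝ) ^ (5 / 4 : ℝ)) :=
    ((summable_nat_add_iff 1).2 (Real.summable_one_div_nat_rpow.2 (by norm_num))).mul_left _
  refine Summable.of_norm_bounded hs fun k => ?_
  have hk : 1 ≤ k + 1 := by omega
  set n := k + 1
  have hn : (1 : ℝ) ≤ n := by exact_mod_cast hk
  have hn0 : (0 : ℝ) < n := by linarith
  rw [S6Term_eq, norm_div, norm_mul, norm_mul, Real.norm_eq_abs, Real.norm_eq_abs,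
    Real.norm_eq_abs, Real.norm_eq_abs, abs_of_pos (binomCoef_pos n), abs_of_nonneg (pow_nonneg hz n),
    abs_of_pos (by positivity : (0 : ℝ) < (n : ℝ) ^ (r + 1))]
  have h1 : |a n| * binomCoef n * z ^ n ≤ (C * 36) * ((n : ℝ) ^ (3 / 4 : ℝ)) := by
    calc |a n| * binomCoef n * z ^ n = |a n| * (binomCoef n * z ^ n) := by ring
      _ ≤ (C * (9 * (n : ℝ) ^ (1 / 4 : ℝ))) * (4 * (n : ℝ) ^ (1 / 2 : ℝ)) := by
          refine mul_le_mul ((ha n hk).trans (mul_le_mul_of_nonneg_left (Hn_six_mul_le hk) hC))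
            (le_trans ?_ (binomCoef_le hk)) (mul_nonneg (binomCoef_pos n).le (pow_nonneg hz n))
            (by positivity)
          exact mul_le_mul_of_nonneg_left (pow_le_pow_left₀ hz hz' n) (binomCoef_pos n).le
      _ = (C * 36) * ((n : ℝ) ^ (1 / 4 : ℝ) * (n : ℝ) ^ (1 / 2 : ℝ)) := by ring
      _ = _ := by rw [← Real.rpow_add hn0]; norm_num
  have h2 : (n : ℝ) ^ (2 : ℝ) ≤ (n : ℝ) ^ (r + 1) := by
    rw [Real.rpow_two]
    exact pow_le_pow_right₀ hn (by omega)
  calc |a n| * binomCoef n * z ^ n / (n : ℝ) ^ (r + 1)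
      ≤ (C * 36) * ((n : ℝ) ^ (3 / 4 : ℝ)) / (n : ℝ) ^ (2 : ℝ) :=
        div_le_div₀ (by positivity) h1 (by positivity) h2
    _ = (C * 36) * (1 / (n : ℝ) ^ (5 / 4 : ℝ)) := by
        rw [mul_div_assoc, ← Real.rpow_sub hn0, one_div, ← Real.rpow_neg hn0.le]
        norm_num

/-! ### The integral representation -/

lemma integrable_tsum_of_summable_integral_norm {α : Type*} [MeasurableSpace α]
    {μ : MeasureTheory.Measure α} {F : ℕ → α → ℝ} (hF : ∀ i, MeasureTheory.Integrable (F i) μ)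
    (hs : Summable fun i => ∫ x, ‖F i x‖ ∂μ) :
    MeasureTheory.Integrable (fun x => ∑' i, F i x) μ := by
  refine ⟨(AEMeasurable.tsum fun i => (hF i).aemeasurable).aestronglyMeasurable, ?_⟩
  rw [MeasureTheory.hasFiniteIntegral_iff_enorm]
  calc ∫⁻ x, ‖∑' i, F i x‖ₑ ∂μ ≤ ∫⁻ x, ∑' i, ‖F i x‖ₑ ∂μ :=
        MeasureTheory.lintegral_mono fun x => enorm_tsum_le_tsum_enorm
    _ = ∑' i, ∫⁻ x, ‖F i x‖ₑ ∂μ :=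
        MeasureTheory.lintegral_tsum fun i => (hF i).aemeasurable.enorm
    _ = ∑' i, ENNReal.ofReal (∫ x, ‖F i x‖ ∂μ) := by
        refine tsum_congr fun i => ?_
        rw [MeasureTheory.ofReal_integral_norm_eq_lintegral_enorm (hF i)]
    _ = ENNReal.ofReal (∑' i, ∫ x, ‖F i x‖ ∂μ) :=
        (ENNReal.ofReal_tsum_of_nonneg
          (fun i => MeasureTheory.integral_nonneg fun x => norm_nonneg _) hs).symm
    _ < ⊤ := ENNReal.ofReal_lt_top

/-- The argument of the power series in the integral representation of `S6`. -/
noncomputable def kerArg (z u : ℝ) : ℝ := z / 16 * u ^ 2 * (1 - u ^ 2) ^ 2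

/-- Each integrand has the constant sign of `σ`, so its `L¹` norm is `σ` times its integral.
Summability of the series itself therefore justifies exchanging sum and integral. -/
theorem S6_eq_integral {h c : ℕ → ℝ} {g : ℝ → ℝ} {σ : ℝ} (hσ : σ ^ 2 = 1) (hh : ∀ k, 0 ≤ h k)
    (hg : IntervalIntegrable g MeasureTheory.volume 0 1)
    (hsign : ∀ u ∈ Set.Ioo (0 : ℝ) 1, 0 ≤ σ * g u)
    (hc : ∀ k, 1 ≤ k → betaInt g (2 * k - 1) k = betaVal (2 * k - 1) k * c k)
    {r : ℕ} {z : ℝ} (hz : 0 ≤ z) {a : ℕ → ℝ} (ha : ∀ k, 1 ≤ k → a k = h k * c k)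
    (hs : Summable fun k : ℕ => S6Term a r z (k + 1)) :
    IntervalIntegrable (fun u => pser h r (kerArg z u) * g u * (1 - u ^ 2)⁻¹)
      MeasureTheory.volume 0 1 ∧
    S6 a r z = 4 * ∫ u in (0 : ℝ)..1, pser h r (kerArg z u) * g u * (1 - u ^ 2)⁻¹ := by
  set μ := MeasureTheory.volume.restrict (Set.Ioo (0 : ℝ) 1)
  set F : ℕ → ℝ → ℝ := fun k u => (h (k + 1) * (z / 16) ^ (k + 1) / ((k + 1 : ℕ) : ℝ) ^ r) *
    (u ^ (2 * (k + 1)) * (1 - u ^ 2) ^ (2 * (k + 1) - 1) * g u) with hF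
  have conv : ∀ f : ℝ → ℝ, IntervalIntegrable f MeasureTheory.volume 0 1 ↔
      MeasureTheory.Integrable f μ := fun f => by
    rw [intervalIntegrable_iff_integrableOn_Ioo_of_le zero_le_one]; rfl
  have conv' : ∀ f : ℝ → ℝ, ∫ u in (0 : ℝ)..1, f u = ∫ u, f u ∂μ := fun f => by
    rw [intervalIntegral.integral_of_le zero_le_one, MeasureTheory.integral_Ioc_eq_integral_Ioo]
  have hFi : ∀ k, MeasureTheory.Integrable (F k) μ := fun k =>
    (conv _).1 ((intervalIntegrable_beta hg _ _).const_mul _)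
  have hFv : ∀ k, ∫ u, F k u ∂μ = S6Term a r z (k + 1) / 4 := by
    intro k
    have hb := betaVal_eq_binomCoef (Nat.succ_pos k)
    have hI := hc (k + 1) (by omega)
    unfold betaInt at hI
    rw [← conv', hF]
    simp only
    rw [intervalIntegral.integral_const_mul, hI, S6Term_eq, ha _ (by omega)]
    rw [show betaVal (2 * (k + 1) - 1) (k + 1) =
      16 ^ (k + 1) * binomCoef (k + 1) / ((k + 1 : ℕ) : ℝ) / 4 by rw [← hb]; ring]
    rw [div_pow]
    have : (((k + 1 : ℕ) : ℝ)) ≠ 0 := by positivity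
    field_simp
    ring
  have hFn : ∀ k, ∫ u, ‖F k u‖ ∂μ = σ * (S6Term a r z (k + 1) / 4) := by
    intro k
    rw [← hFv, ← MeasureTheory.integral_const_mul]
    refine MeasureTheory.setIntegral_congr_fun measurableSet_Ioo fun u hu => ?_
    have h1 : 0 ≤ σ * F k u := by
      have := hsign u hu
      have h2 : 0 ≤ 1 - u ^ 2 := by nlinarith [hu.1, hu.2]
      have h3 := hh (k + 1)
      have : σ * F k u = (h (k + 1) * (z / 16) ^ (k + 1) / ((k + 1 : ℕ) : ℝ) ^ r) *
        (u ^ (2 * (k + 1)) * (1 - u ^ 2) ^ (2 * (k + 1) - 1) * (σ * g u)) := by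
        simp only [hF]; ring
      rw [this]
      have h4 := hu.1.le
      positivity
    have h2 : ‖F k u‖ = ‖σ * F k u‖ := by
      have : ‖σ‖ = 1 := by
        rw [Real.norm_eq_abs, ← sq_eq_sq₀ (abs_nonneg _) zero_le_one, sq_abs, hσ, one_pow]
      rw [norm_mul σ, this, one_mul]
    rw [h2, Real.norm_eq_abs, abs_of_nonneg h1]
  have hsum : Summable fun k => ∫ u, ‖F k u‖ ∂μ := by
    simp only [hFn]
    exact (hs.div_const 4).mul_left σ
  have hts : ∀ u ∈ Set.Ioo (0 : ℝ) 1,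
      pser h r (kerArg z u) * g u * (1 - u ^ 2)⁻¹ = ∑' k, F k u := by
    intro u hu
    have h2 : 1 - u ^ 2 ≠ 0 := by nlinarith [hu.1, hu.2]
    rw [pser, ← tsum_mul_right, ← tsum_mul_right]
    refine tsum_congr fun k => ?_
    simp only [hF, kerArg]
    rw [show 2 * (k + 1) - 1 = 2 * k + 1 by omega]
    have e : (z / 16 * u ^ 2 * (1 - u ^ 2) ^ 2) ^ (k + 1) =
      (z / 16) ^ (k + 1) * u ^ (2 * (k + 1)) * ((1 - u ^ 2) ^ (2 * k + 1) * (1 - u ^ 2)) := by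
      rw [mul_pow, mul_pow, ← pow_mul, ← pow_mul]
      ring
    rw [e]
    field_simp
  refine ⟨(conv _).2 ?_, ?_⟩
  · refine (integrable_tsum_of_summable_integral_norm hFi hsum).congr ?_
    refine (MeasureTheory.ae_restrict_iff' measurableSet_Ioo).2 (Eventually.of_forall fun u hu => ?_)
    exact (hts u hu).symm
  · rw [conv', MeasureTheory.setIntegral_congr_fun measurableSet_Ioo hts,
      ← (MeasureTheory.hasSum_integral_of_summable_integral_norm hFi hsum).tsum_eq]
    simp only [hFv]
    rw [tsum_div_const, S6]
    ring

lemma Hn_mono {m n : ℕ} (h : m ≤ n) : Hn m ≤ Hn n := by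
  induction n, h using Nat.le_induction with
  | base => exact le_rfl
  | succ n _ ih =>
    rw [Hn_succ]
    have : (0 : ℝ) ≤ 1 / ((n : ℝ) + 1) := by positivity
    linarith

lemma one_le_Hn {n : ℕ} (h : 1 ≤ n) : 1 ≤ Hn n := by
  have := Hn_mono h
  rwa [show Hn 1 = 1 by simp [Hn, harmonic]] at this

lemma abs_inv_le_Hn (k : ℕ) (hk : 1 ≤ k) : |1 / (k : ℝ)| ≤ 6 * Hn (6 * k) := by
  have h0 : (1 : ℝ) ≤ k := by exact_mod_cast hk
  have := one_le_Hn (show 1 ≤ 6 * k by omega)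
  rw [abs_of_pos (by positivity)]
  have : 1 / (k : ℝ) ≤ 1 := by rw [div_le_one (by positivity)]; exact h0
  linarith

lemma abs_Hn_le_Hn {j k : ℕ} (hjk : j ≤ 6 * k) : |Hn j| ≤ 6 * Hn (6 * k) := by
  have := Hn_mono hjk
  have := Hn_nonneg j
  rw [abs_of_nonneg this]
  linarith

lemma abs_Hn_comb_le (k : ℕ) :
    |-Hn k + 2 * Hn (2 * k) + Hn (3 * k) - 2 * Hn (6 * k)| ≤ 6 * Hn (6 * k) := by
  have h1 := Hn_mono (show k ≤ 6 * k by omega)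
  have h2 := Hn_mono (show 2 * k ≤ 6 * k by omega)
  have h3 := Hn_mono (show 3 * k ≤ 6 * k by omega)
  have := Hn_nonneg k
  have := Hn_nonneg (2 * k)
  have := Hn_nonneg (3 * k)
  rw [abs_le]
  constructor <;> linarith

lemma abs_Hn_pred_comb_le (k : ℕ) :
    |Hn (2 * k - 1) + Hn (3 * k) - 2 * Hn (6 * k)| ≤ 6 * Hn (6 * k) := by
  have h2 := Hn_mono (show 2 * k - 1 ≤ 6 * k by omega)
  have h3 := Hn_mono (show 3 * k ≤ 6 * k by omega)
  have := Hn_nonneg (2 * k - 1)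
  have := Hn_nonneg (3 * k)
  rw [abs_le]
  constructor <;> linarith

/-- The series `S6 a r z` converges and equals four times the integral of `f (kerArg z u) g(u)`
against `du / (1 - u²)`. -/
def HasKernel (a : ℕ → ℝ) (r : ℕ) (z : ℝ) (f g : ℝ → ℝ) : Prop :=
  Summable (fun k : ℕ => S6Term a r z (k + 1)) ∧
  IntervalIntegrable (fun u => f (kerArg z u) * g u * (1 - u ^ 2)⁻¹) MeasureTheory.volume 0 1 ∧
  S6 a r z = 4 * ∫ u in (0 : ℝ)..1, f (kerArg z u) * g u * (1 - u ^ 2)⁻¹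

/-- The factor `1/k` is absorbed into the series, raising `r` by one. -/
lemma hasKernel_inv {r : ℕ} (hr : 1 ≤ r) {z : ℝ} (hz : 0 ≤ z) (hz' : z ≤ 108) :
    HasKernel (fun k => 1 / (k : ℝ)) r z (pserOne (r + 1)) fun _ => 1 := by
  have hs := summable_S6Term abs_inv_le_Hn hr hz hz'
  have e : ∀ x, pser (fun k => 1 / (k : ℝ)) r x = pserOne (r + 1) x := fun x => by
    refine tsum_congr fun k => ?_
    simp only [Nat.succ_ne_zero, if_false, pow_succ ((k + 1 : ℕ) : ℝ)]
    field_simp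
  obtain ⟨h1, h2⟩ := S6_eq_integral (h := fun k => 1 / (k : ℝ)) (c := fun _ => 1) (σ := 1)
    (by norm_num) (fun k => by positivity) (g := fun _ => 1) (by simp) (fun u _ => by simp)
    (fun k _ => by rw [betaInt_one, mul_one]) hz (fun k _ => by simp) hs
  simp only [e] at h1 h2
  exact ⟨hs, h1, h2⟩

lemma hasKernel_Hn {r : ℕ} (hr : 1 ≤ r) {z : ℝ} (hz : 0 ≤ z) (hz' : z ≤ 108) :
    HasKernel Hn r z (pser Hn r) fun _ => 1 := by
  have hs := summable_S6Term (a := Hn) (C := 6) (fun k _ => abs_Hn_le_Hn (by omega)) hr hz hz'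
  exact ⟨hs, S6_eq_integral (c := fun _ => 1) (σ := 1)
    (by norm_num) Hn_nonneg (g := fun _ => 1) (by simp) (fun u _ => by simp)
    (fun k _ => by rw [betaInt_one, mul_one]) hz (fun k _ => by simp) hs⟩

lemma hasKernel_log_sq {r : ℕ} (hr : 1 ≤ r) {z : ℝ} (hz : 0 ≤ z) (hz' : z ≤ 108) :
    HasKernel (fun k => -Hn k + 2 * Hn (2 * k) + Hn (3 * k) - 2 * Hn (6 * k)) r z (pserOne r)
      fun u => Real.log (u ^ 2) := by
  have hs := summable_S6Term (fun k _ => abs_Hn_comb_le k) hr hz hz'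
  refine ⟨hs, S6_eq_integral (σ := -1) (by norm_num) (fun k => by positivity)
    intervalIntegrable_log_sq (fun u hu => ?_)
    (c := fun k => -Hn k + 2 * Hn (2 * k) + Hn (3 * k) - 2 * Hn (6 * k)) (fun k hk => ?_) hz
    (fun k hk => by rw [if_neg (by omega), one_mul]) hs⟩
  · have := Real.log_nonpos (sq_nonneg u) (by nlinarith [hu.1, hu.2] : u ^ 2 ≤ 1)
    linarith
  · rw [betaInt_log_sq, Nat.sub_add_cancel (by omega), halfSum_eq, show k + 2 * k = 3 * k by ring,
      show 2 * (3 * k) = 6 * k by ring]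
    ring

/-- Subtracting `2 log 2` cancels the constant of `betaInt_log_one_sub_sq`, leaving harmonic numbers
only, and keeps the weight nonpositive. -/
lemma hasKernel_log_one_sub_sq {r : ℕ} (hr : 1 ≤ r) {z : ℝ} (hz : 0 ≤ z) (hz' : z ≤ 108) :
    HasKernel (fun k => Hn (2 * k - 1) + Hn (3 * k) - 2 * Hn (6 * k)) r z (pserOne r)
      fun u => Real.log (1 - u ^ 2) - 2 * Real.log 2 := by
  have hs := summable_S6Term (fun k _ => abs_Hn_pred_comb_le k) hr hz hz'
  have hi : IntervalIntegrable (fun _ : ℝ => 2 * Real.log 2) MeasureTheory.volume 0 1 := by simp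
  refine ⟨hs, S6_eq_integral (σ := -1) (by norm_num) (fun k => by positivity)
    (intervalIntegrable_log_one_sub_sq.sub hi) (fun u hu => ?_)
    (c := fun k => Hn (2 * k - 1) + Hn (3 * k) - 2 * Hn (6 * k)) (fun k hk => ?_) hz
    (fun k hk => by rw [if_neg (by omega), one_mul]) hs⟩
  · have := Real.log_nonpos (by nlinarith [hu.1, hu.2] : 0 ≤ 1 - u ^ 2)
      (by nlinarith [hu.1, hu.2] : 1 - u ^ 2 ≤ 1)
    have := Real.log_pos (show (1 : ℝ) < 2 by norm_num)
    linarith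
  · have e1 : betaInt (fun u => Real.log (1 - u ^ 2) - 2 * Real.log 2) (2 * k - 1) k =
        betaInt (fun u => Real.log (1 - u ^ 2)) (2 * k - 1) k -
        2 * Real.log 2 * betaInt (fun _ => 1) (2 * k - 1) k := by
      unfold betaInt
      rw [← intervalIntegral.integral_const_mul, ← intervalIntegral.integral_sub
        (intervalIntegrable_beta intervalIntegrable_log_one_sub_sq _ _)
        ((intervalIntegrable_beta (by simp) _ _).const_mul _)]
      refine intervalIntegral.integral_congr fun u _ => ?_
      ring
    rw [e1, betaInt_one, betaInt_log_one_sub_sq, show 2 * k - 1 + k + 1 = 3 * k by omega,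
      halfSum_eq, show 2 * (0 + 3 * k) = 6 * k by ring, show 0 + 3 * k = 3 * k by ring, mul_zero,
      Hn_zero]
    ring

/-! ### Parametrized kernels -/

/-- A parametrization `U` of a subinterval of `(0, 1)` along which the integrands of the integral
representations of `S6` belong to a class of polylogarithmic functions. -/
structure KernelPath (N : ℕ) (z a b : ℝ) (D : ℕ → Submodule ℚ (ℝ → ℂ))
    (Ω Lg : Submodule ℚ (ℝ → ℂ)) (U U' : ℝ → ℝ) : Prop where
  polyClass : PolyClass N a b D Ω Lg
  pos : 0 < z
  continuousOn : ContinuousOn U (Set.Icc a b)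
  hasDerivAt : ∀ s ∈ Set.Ioo a b, HasDerivAt U (U' s) s
  deriv_nonneg : ∀ s ∈ Set.Ioo a b, 0 ≤ U' s
  mem : ∀ s ∈ Set.Ioo a b, U s ∈ Set.Ioo (0 : ℝ) 1
  arg_lt : ∀ s ∈ Set.Ioo a b, kerArg z (U s) < 1
  tendsto : Tendsto (fun s => kerArg z (U s)) (𝓝[>] a) (𝓝 0) ∨
    Tendsto (fun s => kerArg z (U s)) (𝓝[<] b) (𝓝 0)
  form : (fun s => ((U' s / (1 - U s ^ 2) : ℝ) : ℂ)) ∈ Ω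
  form_log : (fun s => ((U' s / U s : ℝ) : ℂ)) ∈ Ω
  form_log_one_sub_sq : (fun s => ((U s * U' s / (1 - U s ^ 2) : ℝ) : ℂ)) ∈ Ω
  log_sq : (fun s => ((Real.log (U s ^ 2) : ℝ) : ℂ)) ∈ Lg
  log_one_sub_sq : (fun s => ((Real.log (1 - U s ^ 2) - 2 * Real.log 2 : ℝ) : ℂ)) ∈ Lg
  log_one_sub_arg : (fun s => ((Real.log (1 - kerArg z (U s)) : ℝ) : ℂ)) ∈ D 1

lemma hasDerivAt_kerArg (z u : ℝ) :
    HasDerivAt (kerArg z) (z / 16 * (2 * u * (1 - u ^ 2) * (1 - 3 * u ^ 2))) u := by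
  have h1 : HasDerivAt (fun u : ℝ => 1 - u ^ 2) (-(2 * u)) u := by
    simpa using (hasDerivAt_pow 2 u).const_sub 1
  have h2 := ((hasDerivAt_pow 2 u).const_mul (z / 16)).mul (h1.pow 2)
  refine h2.congr_deriv ?_
  simp only [Pi.pow_apply]
  push_cast
  ring

section KernelPath

variable {N : ℕ} {z a b : ℝ} {D : ℕ → Submodule ℚ (ℝ → ℂ)} {Ω Lg : Submodule ℚ (ℝ → ℂ)}
  {U U' : ℝ → ℝ}

lemma KernelPath.one_sub_sq_pos (h : KernelPath N z a b D Ω Lg U U') {s : ℝ}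
    (hs : s ∈ Set.Ioo a b) : 0 < 1 - U s ^ 2 := by
  obtain ⟨h0, h1⟩ := h.mem s hs
  nlinarith

lemma KernelPath.arg_mem (h : KernelPath N z a b D Ω Lg U U') {s : ℝ} (hs : s ∈ Set.Ioo a b) :
    kerArg z (U s) ∈ Set.Ioo (0 : ℝ) 1 := by
  refine ⟨?_, h.arg_lt s hs⟩
  have h1 := (h.mem s hs).1
  have h2 := h.one_sub_sq_pos hs
  have h3 := h.pos
  unfold kerArg
  positivity

/-- The derivative of the argument along the path. -/
noncomputable def argDeriv (z : ℝ) (U U' : ℝ → ℝ) (s : ℝ) : ℝ :=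
  z / 16 * (2 * U s * (1 - U s ^ 2) * (1 - 3 * U s ^ 2)) * U' s

lemma KernelPath.hasDerivAt_arg (h : KernelPath N z a b D Ω Lg U U') {s : ℝ}
    (hs : s ∈ Set.Ioo a b) :
    HasDerivAt (fun s => kerArg z (U s)) (argDeriv z U U' s) s :=
  (hasDerivAt_kerArg z (U s)).comp s (h.hasDerivAt s hs)

/-- `dX/X = 2 dU/U - 4 U dU/(1-U²)`, by the product formula for `X`. -/
lemma KernelPath.form_arg (h : KernelPath N z a b D Ω Lg U U') :
    (fun s => ((argDeriv z U U' s / kerArg z (U s) : ℝ) : ℂ)) ∈ Ω := by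
  refine h.polyClass.form_congr (Submodule.sub_mem _ (Submodule.smul_mem _ (2 : ℚ) h.form_log)
    (Submodule.smul_mem _ (4 : ℚ) h.form_log_one_sub_sq)) fun s hs => ?_
  have h1 := (h.mem s hs).1.ne'
  have h2 := (h.one_sub_sq_pos hs).ne'
  have h3 := h.pos.ne'
  simp only [Pi.sub_apply, Pi.smul_apply, Rat.smul_def]
  rw [argDeriv, kerArg]
  norm_cast
  field_simp
  ring

lemma KernelPath.pserOne_mem (h : KernelPath N z a b D Ω Lg U U') {r : ℕ} (hr : 1 ≤ r) :
    (fun s => ((pserOne r (kerArg z (U s)) : ℝ) : ℂ)) ∈ D r :=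
  h.polyClass.pserOne_comp_mem (fun _ hs => h.arg_mem hs) (fun _ hs => h.hasDerivAt_arg hs)
    h.form_arg h.tendsto h.log_one_sub_arg hr

lemma KernelPath.pserHn_mem (h : KernelPath N z a b D Ω Lg U U')
    (hω : (fun s => ((argDeriv z U U' s / (1 - kerArg z (U s)) : ℝ) : ℂ)) ∈ Ω)
    {r : ℕ} (hr : 1 ≤ r) :
    (fun s => ((pser Hn r (kerArg z (U s)) : ℝ) : ℂ)) ∈ D (r + 1) :=
  h.polyClass.pserHn_comp_mem (fun _ hs => h.arg_mem hs) (fun _ hs => h.hasDerivAt_arg hs)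
    h.form_arg hω h.tendsto h.log_one_sub_arg hr

/-- Change of variables along the monotone map `U`; the measure `du/(1-u²)` becomes the form
`h.form`. -/
lemma KernelPath.integral_mem (h : KernelPath N z a b D Ω Lg U U') (ha : 0 ≤ U a) (hb : U b ≤ 1)
    {w : ℕ} {f g : ℝ → ℝ} (hΦ : (fun s => ((f (kerArg z (U s)) * g (U s) : ℝ) : ℂ)) ∈ D w)
    (hinteg : IntervalIntegrable (fun u => f (kerArg z u) * g u * (1 - u ^ 2)⁻¹)
      MeasureTheory.volume 0 1) :
    ((∫ u in (U a)..(U b), f (kerArg z u) * g u * (1 - u ^ 2)⁻¹ : ℝ) : ℂ) ∈ Zsp N (w + 1) := by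
  have hab := h.polyClass.lt
  set F := fun u => f (kerArg z u) * g u * (1 - u ^ 2)⁻¹ with hF
  have hUab : U a ≤ U b := by
    have M : MonotoneOn U (Set.Icc a b) := by
      refine monotoneOn_of_deriv_nonneg (convex_Icc a b) h.continuousOn ?_ ?_ <;> rw [interior_Icc]
      · exact fun s hs => (h.hasDerivAt s hs).differentiableAt.differentiableWithinAt
      · intro s hs
        rw [(h.hasDerivAt s hs).deriv]
        exact h.deriv_nonneg s hs
    exact M ⟨le_rfl, hab.le⟩ ⟨hab.le, le_rfl⟩ hab.le
  have hF1 : MeasureTheory.IntegrableOn F (Set.Icc (U a) (U b)) :=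
    ((intervalIntegrable_iff_integrableOn_Icc_of_le zero_le_one).1 hinteg).mono_set
      (Set.Icc_subset_Icc ha hb)
  have hF2 : IntervalIntegrable (fun s => U' s • F (U s)) MeasureTheory.volume a b :=
    (intervalIntegrable_iff_integrableOn_Icc_of_le hab.le).2
      ((MeasureTheory.integrableOn_Icc_deriv_smul_iff_of_deriv_nonneg h.continuousOn h.hasDerivAt
        h.deriv_nonneg hab.le).2 hF1)
  have e1 : ∫ u in (U a)..(U b), F u = ∫ s in a..b, U' s • F (U s) := by
    rw [intervalIntegral.integral_of_le hUab, intervalIntegral.integral_of_le hab.le,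
      ← MeasureTheory.integral_Icc_eq_integral_Ioc, ← MeasureTheory.integral_Icc_eq_integral_Ioc,
      MeasureTheory.integral_Icc_deriv_smul_of_deriv_nonneg h.continuousOn h.hasDerivAt h.deriv_nonneg hab.le]
  have e2 : (fun s => ((f (kerArg z (U s)) * g (U s) : ℝ) : ℂ) *
      ((U' s / (1 - U s ^ 2) : ℝ) : ℂ)) = fun s => ((U' s • F (U s) : ℝ) : ℂ) := by
    funext s
    rw [← Complex.ofReal_mul]
    congr 1
    simp only [hF, smul_eq_mul]
    ring
  have key := h.polyClass.integral_mem hΦ h.form (by rw [e2]; exact ⟨hF2.1.ofReal, hF2.2.ofReal⟩)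
  rw [e2, intervalIntegral.integral_ofReal, ← e1] at key
  exact key

end KernelPath

lemma polyClass_of_arc {N : ℕ} (hN : 0 < N) {a b : ℝ} (hab : a < b) {Λa Λb γ γ' : ℝ → ℂ}
    (hγ : Arc N a b Λa Λb γ γ') (ha : Tendsto (fun s => ‖Λa s‖) (𝓝[>] a) atTop)
    (hb : Tendsto (fun s => ‖Λb s‖) (𝓝[<] b) atTop) :
    PolyClass N a b (PathFn N a b γ) (PathForm N a b γ γ') (PathFn N a b γ 1) := by
  simpa only [sup_idem, inf_idem] using polyClass_of_arcs hN hab hγ hγ ha hb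

/-- A logarithm is the primitive of its logarithmic form, and its value at a single end fixes the
constant. -/
lemma PolyClass.log_mem {N : ℕ} {a b : ℝ} {D : ℕ → Submodule ℚ (ℝ → ℂ)}
    {Ω Lg : Submodule ℚ (ℝ → ℂ)} (hD : PolyClass N a b D Ω Lg) {F F' : ℝ → ℝ} {L : ℝ}
    (hF : ∀ s ∈ Set.Ioo a b, F s ≠ 0) (hF' : ∀ s ∈ Set.Ioo a b, HasDerivAt F (F' s) s)
    (hω : (fun s => ((F' s / F s : ℝ) : ℂ)) ∈ Ω) (hL : L ≠ 0)
    (hlog : (Real.log L : ℂ) ∈ Zsp N 1)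
    (hlim : Tendsto F (𝓝[>] a) (𝓝 L) ∨ Tendsto F (𝓝[<] b) (𝓝 L)) :
    (fun s => ((Real.log (F s) : ℝ) : ℂ)) ∈ D 1 := by
  refine hD.mem_of_hasDerivAt (hD.const (one_mem_Zsp N)) hω (fun s hs => ?_) hlog ?_
  · refine ((hF' s hs).log (hF s hs)).ofReal_comp.congr_deriv ?_
    rw [one_mul]
  · have h1 : Tendsto (fun x : ℝ => ((Real.log x : ℝ) : ℂ)) (𝓝 L) (𝓝 (Real.log L : ℂ)) :=
      (Complex.continuous_ofReal.tendsto _).comp (Real.continuousAt_log hL)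
    exact hlim.imp (fun h => h1.comp h) fun h => h1.comp h

lemma PathForm.one_div_sub_mem {N : ℕ} {a b : ℝ} {γ γ' : ℝ → ℂ} {α : ℂ} (hα : α = 0 ∨ α ^ N = 1) :
    (fun s => γ' s / (γ s - α)) ∈ PathForm N a b γ γ' :=
  ⟨_, Submodule.subset_span ⟨α, hα, rfl⟩, fun s _ => by ring⟩

lemma PathForm.logDeriv_mem {N : ℕ} {a b : ℝ} {γ γ' : ℝ → ℂ}
    (hD : ∀ s ∈ Set.Ioo a b, γ s ∈ Dom N) {p : Polynomial ℂ} (hp : p ≠ 0)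
    (hroots : ∀ α, p.eval α = 0 → α = 0 ∨ α ^ N = 1) :
    (fun s => p.derivative.eval (γ s) / p.eval (γ s) * γ' s) ∈ PathForm N a b γ γ' := by
  obtain ⟨R, hR, h⟩ := logDeriv_mem_Forms hp hroots
  exact ⟨R, hR, fun s hs => by rw [h _ (hD s hs)]⟩

/-- The roots of `X^n + 1` are `2n`-th roots of unity. -/
lemma PathForm.logDeriv_pow_add_one_mem {N : ℕ} {a b : ℝ} {γ γ' : ℝ → ℂ}
    (hD : ∀ s ∈ Set.Ioo a b, γ s ∈ Dom N) {n : ℕ} (hn : 0 < n) (hN : 2 * n ∣ N) :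
    (fun s => n * γ s ^ (n - 1) / (γ s ^ n + 1) * γ' s) ∈ PathForm N a b γ γ' := by
  have h1 : (Polynomial.X ^ n + Polynomial.C (1 : ℂ)) ≠ 0 :=
    Polynomial.X_pow_add_C_ne_zero hn 1
  refine PathForm.congr (PathForm.logDeriv_mem hD h1 fun α hα => Or.inr ?_) fun s _ => by
    simp [Polynomial.derivative_X_pow]
  obtain ⟨m, rfl⟩ := hN
  have h2 : α ^ n = -1 := by
    simp only [Polynomial.eval_add, Polynomial.eval_pow, Polynomial.eval_X, Polynomial.eval_C] at hα
    exact eq_neg_of_add_eq_zero_left hα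
  rw [mul_comm 2 n, mul_assoc, pow_mul, h2, pow_mul]
  norm_num

lemma log_two_mem_Zsp {N : ℕ} (hN : 0 < N) (h2 : Even N) : (Real.log 2 : ℂ) ∈ Zsp N 1 := by
  have := log_one_sub_mem_Zsp hN (β := -1) h2.neg_one_pow (by norm_num)
  rw [show (1 : ℂ) - -1 = ((2 : ℝ) : ℂ) by norm_num, ← Complex.ofReal_log (by norm_num)] at this
  exact this

lemma pathToOne_ofReal {N : ℕ} (hN : 0 < N) {ι : Type*} {l : Filter ι} {f : ι → ℝ}
    (h1 : Tendsto f l (𝓝 1)) (hf : ∀ᶠ s in l, f s ∈ Set.Ioo (0 : ℝ) 1) :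
    PathToOne N l fun s => (f s : ℂ) where
  tendsto := by
    have := (Complex.continuous_ofReal.tendsto 1).comp h1
    rwa [Complex.ofReal_one] at this
  norm_le := hf.mono fun s hs => by
    rw [Complex.norm_real, Real.norm_eq_abs, abs_of_pos hs.1]; exact hs.2.le
  mem := hf.mono fun s hs => ofReal_mem_Dom hN hs.1 hs.2

lemma le_rpow_quarter {x : ℝ} (h0 : 0 ≤ x) (h1 : x ≤ 1) : x ≤ x ^ (1 / 4 : ℝ) := by
  rcases h0.eq_or_lt with rfl | h
  · simp
  · nth_rewrite 1 [← Real.rpow_one x]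
    exact Real.rpow_le_rpow_of_exponent_ge h h1 (by norm_num)

/-! ### Level 8: the substitution u = 2p/(1+p²) -/

/-- The substitution `p ↦ 2p / (1 + p²)`. -/
noncomputable def dbl (p : ℝ) : ℝ := 2 * p / (1 + p ^ 2)

/-- The derivative of `dbl`. -/
noncomputable def dblDeriv (p : ℝ) : ℝ := 2 * (1 - p ^ 2) / (1 + p ^ 2) ^ 2

lemma hasDerivAt_dbl (p : ℝ) : HasDerivAt dbl (dblDeriv p) p := by
  have h : (1 : ℝ) + p ^ 2 ≠ 0 := by positivity
  have h1 := ((hasDerivAt_id p).const_mul 2).div ((hasDerivAt_pow 2 p).const_add 1) h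
  refine h1.congr_deriv ?_
  simp only [dblDeriv, id]
  push_cast
  congr 1
  ring

lemma continuous_dbl : Continuous dbl := continuous_iff_continuousAt.2 fun p =>
  (hasDerivAt_dbl p).continuousAt

lemma dbl_zero : dbl 0 = 0 := by simp [dbl]

lemma dbl_one : dbl 1 = 1 := by norm_num [dbl]

lemma dbl_mem {p : ℝ} (hp : p ∈ Set.Ioo (0 : ℝ) 1) : dbl p ∈ Set.Ioo (0 : ℝ) 1 := by
  obtain ⟨h0, h1⟩ := hp
  refine ⟨by unfold dbl; positivity, ?_⟩
  unfold dbl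
  rw [div_lt_one (by positivity)]
  nlinarith [sq_nonneg (1 - p), mul_self_pos.2 (show 1 - p ≠ 0 by linarith)]

lemma arc_id {N : ℕ} (hN : 0 < N) : Arc N 0 1 (fun p => Complex.log (p : ℂ))
    (fun p => Complex.log (1 - (p : ℂ))) (fun p => (p : ℂ)) (fun _ => 1) where
  hasDerivAt s _ := (hasDerivAt_id s).ofReal_comp.congr_deriv (by simp)
  mem s hs := ofReal_mem_Dom hN hs.1 hs.2
  left := by
    refine goodEnd_zero hN ?_ ?_
    · have := (Complex.continuous_ofReal.tendsto 0).mono_left (nhdsWithin_le_nhds (s := Set.Ioi 0))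
      rwa [Complex.ofReal_zero] at this
    · filter_upwards [Ioo_mem_nhdsGT zero_lt_one] with s hs using ofReal_mem_Dom hN hs.1 hs.2
  right := by
    refine PathToOne.goodEnd (pathToOne_ofReal hN (f := fun s => s) nhdsWithin_le_nhds ?_) hN
    filter_upwards [Ioo_mem_nhdsLT zero_lt_one] with s hs using hs

lemma log_dbl {p : ℝ} (hp : p ∈ Set.Ioo (0 : ℝ) 1) :
    Real.log (dbl p) = Real.log p + Real.log 2 - Real.log (1 + p ^ 2) := by
  rw [dbl, Real.log_div (by linarith [hp.1]) (by positivity),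
    Real.log_mul two_ne_zero hp.1.ne']
  ring

lemma one_sub_dbl (p : ℝ) : 1 - dbl p = (1 - p) ^ 2 / (1 + p ^ 2) := by
  have h : (1 : ℝ) + p ^ 2 ≠ 0 := by positivity
  rw [dbl, one_sub_div h]
  congr 1
  ring

lemma log_one_sub_dbl {p : ℝ} (hp : p ∈ Set.Ioo (0 : ℝ) 1) :
    Real.log (1 - dbl p) = 2 * Real.log (1 - p) - Real.log (1 + p ^ 2) := by
  rw [one_sub_dbl, Real.log_div (pow_ne_zero 2 (by linarith [hp.2])) (by positivity), Real.log_pow]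
  norm_num

lemma ofReal_log_one_sub {x : ℝ} (hx : x ≤ 1) :
    Complex.log (1 - (x : ℂ)) = ((Real.log (1 - x) : ℝ) : ℂ) := by
  rw [Complex.ofReal_log (by linarith)]; push_cast; rfl

lemma log_one_add_sq_mem {p : ℝ} (hp : p ∈ Set.Ioo (0 : ℝ) 1) :
    0 ≤ Real.log (1 + p ^ 2) ∧ Real.log (1 + p ^ 2) ≤ p ∧ Real.log (1 + p ^ 2) ≤ 1 ∧
    0 ≤ Real.log 2 - Real.log (1 + p ^ 2) ∧ Real.log 2 - Real.log (1 + p ^ 2) ≤ 2 * (1 - p) := by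
  obtain ⟨h0, h1⟩ := hp
  have e1 : 0 ≤ Real.log (1 + p ^ 2) := Real.log_nonneg (by nlinarith)
  have e2 := Real.log_le_sub_one_of_pos (show (0 : ℝ) < 1 + p ^ 2 by positivity)
  have e3 : Real.log (1 + p ^ 2) ≤ Real.log 2 := Real.log_le_log (by positivity) (by nlinarith)
  have e4 : Real.log 2 - Real.log (1 + p ^ 2) ≤ 2 * (1 - p) := by
    rw [← Real.log_div (by norm_num) (by positivity)]
    refine (Real.log_le_sub_one_of_pos (by positivity)).trans ?_
    rw [div_sub_one (by positivity), div_le_iff₀ (by positivity)]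
    nlinarith
  refine ⟨e1, by nlinarith, by nlinarith, by linarith, e4⟩

/-- The arc in `u` must be expanded in the same variables as the arc in `p`. Near `0` one has `log u
= log p + log 2` and near `1` one has `log(1-u) = 2 log(1-p) - log 2`, up to rapid errors; an even
level makes `log 2` a value of weight one. -/
lemma arc_dbl {N : ℕ} (hN : 0 < N) (h2 : Even N) : Arc N 0 1 (fun p => Complex.log (p : ℂ))
    (fun p => Complex.log (1 - (p : ℂ))) (fun p => (dbl p : ℂ)) (fun p => (dblDeriv p : ℂ)) where
  hasDerivAt s _ := (hasDerivAt_dbl s).ofReal_comp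
  mem s hs := ofReal_mem_Dom hN (dbl_mem hs).1 (dbl_mem hs).2
  left := by
    have hI : ∀ᶠ p : ℝ in 𝓝[>] 0, p ∈ Set.Ioo (0 : ℝ) 1 := Ioo_mem_nhdsGT zero_lt_one
    have h0 : GoodEnd N (𝓝[>] (0 : ℝ)) (fun p => Complex.log (dbl p : ℂ)) (fun p => (dbl p : ℂ)) := by
      refine goodEnd_zero hN ?_ ?_
      · have := ((Complex.continuous_ofReal.comp continuous_dbl).tendsto 0).mono_left
          (nhdsWithin_le_nhds (s := Set.Ioi 0))
        simpa [dbl_zero, Function.comp_def] using this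
      · filter_upwards [hI] with s hs using ofReal_mem_Dom hN (dbl_mem hs).1 (dbl_mem hs).2
    -- The reflection `p ↦ 1 - p` transports the criterion for rapid functions from the end `1` to
    -- the end `0`.
    have hP : PathToOne N (𝓝[>] (0 : ℝ)) fun p => ((1 - p : ℝ) : ℂ) := by
      refine pathToOne_ofReal hN ?_ ?_
      · have : Tendsto (fun p : ℝ => 1 - p) (𝓝 0) (𝓝 (1 - 0)) :=
          (continuous_const.sub continuous_id).tendsto 0
        rw [sub_zero] at this
        exact this.mono_left nhdsWithin_le_nhds
      · filter_upwards [hI] with s hs using ⟨by linarith [hs.2], by linarith [hs.1]⟩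
    have hR : Rapid (𝓝[>] (0 : ℝ)) (fun p => Complex.log (p : ℂ))
        (fun p => ((-Real.log (1 + p ^ 2) : ℝ) : ℂ)) := by
      have := hP.rapid (f := fun p => ((-Real.log (1 + p ^ 2) : ℝ) : ℂ)) (C := 1) ?_
      · refine fun m => (this m).congr fun p => ?_
        push_cast; rw [sub_sub_cancel]
      · filter_upwards [hI] with p hp
        obtain ⟨e1, e2, -⟩ := log_one_add_sq_mem hp
        rw [Complex.norm_real, norm_neg, Real.norm_eq_abs, abs_of_nonneg e1, one_mul,
          show ((1 - p : ℝ) : ℂ) - 1 = ((-p : ℝ) : ℂ) by push_cast; ring, Complex.norm_real, norm_neg,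
          Real.norm_eq_abs, abs_of_pos hp.1]
        exact e2.trans (le_rpow_quarter hp.1.le hp.2.le)
    refine h0.change (A := 2) hN (((HasExp.self.add (HasExp.const (log_two_mem_Zsp hN h2))).add
      (HasExp.of_rapid hR)).congr' ?_) ?_
    · filter_upwards [hI] with p hp
      rw [← Complex.ofReal_log (dbl_mem hp).1.le, log_dbl hp, ← Complex.ofReal_log hp.1.le]
      push_cast; ring
    · filter_upwards [hI] with p hp
      obtain ⟨e1, -, e3, e4, -⟩ := log_one_add_sq_mem hp
      rw [← Complex.ofReal_log (dbl_mem hp).1.le, ← Complex.ofReal_log hp.1.le, Complex.norm_real,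
        Complex.norm_real, Real.norm_eq_abs, Real.norm_eq_abs,
        abs_of_neg (Real.log_neg hp.1 hp.2), log_dbl hp]
      have := Real.log_two_lt_d9
      have := neg_abs_le (Real.log p + Real.log 2 - Real.log (1 + p ^ 2))
      have := abs_nonneg (Real.log p + Real.log 2 - Real.log (1 + p ^ 2))
      linarith
  right := by
    have hI : ∀ᶠ p : ℝ in 𝓝[<] 1, p ∈ Set.Ioo (0 : ℝ) 1 := Ioo_mem_nhdsLT zero_lt_one
    have h0 : GoodEnd N (𝓝[<] (1 : ℝ)) (fun p => Complex.log (1 - (dbl p : ℂ)))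
        (fun p => (dbl p : ℂ)) := by
      refine PathToOne.goodEnd (pathToOne_ofReal hN ?_ ?_) hN
      · have := (continuous_dbl.tendsto 1).mono_left (nhdsWithin_le_nhds (s := Set.Iio 1))
        rwa [dbl_one] at this
      · filter_upwards [hI] with s hs using dbl_mem hs
    have hP : PathToOne N (𝓝[<] (1 : ℝ)) fun p => (p : ℂ) :=
      pathToOne_ofReal hN (f := fun s => s) nhdsWithin_le_nhds hI
    have hR : Rapid (𝓝[<] (1 : ℝ)) (fun p => Complex.log (1 - (p : ℂ)))
        (fun p => ((Real.log 2 - Real.log (1 + p ^ 2) : ℝ) : ℂ)) := by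
      refine hP.rapid (C := 2) ?_
      filter_upwards [hI] with p hp
      obtain ⟨-, -, -, e4, e5⟩ := log_one_add_sq_mem hp
      rw [Complex.norm_real, Real.norm_eq_abs, abs_of_nonneg e4,
        show (p : ℂ) - 1 = ((-(1 - p) : ℝ) : ℂ) by push_cast; ring, Complex.norm_real, norm_neg,
        Real.norm_eq_abs, abs_of_pos (by linarith [hp.2])]
      exact e5.trans (mul_le_mul_of_nonneg_left
        (le_rpow_quarter (by linarith [hp.2]) (by linarith [hp.1])) (by norm_num))
    refine h0.change (A := 1) hN ((((HasExp.self.smul 2).add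
      (HasExp.const (Submodule.neg_mem _ (log_two_mem_Zsp hN h2)))).add
      (HasExp.of_rapid hR)).congr' ?_) ?_
    · filter_upwards [hI] with p hp
      rw [ofReal_log_one_sub (dbl_mem hp).2.le, log_one_sub_dbl hp, ofReal_log_one_sub hp.2.le]
      push_cast; ring
    · filter_upwards [hI] with p hp
      obtain ⟨e1, -, e3, e4, -⟩ := log_one_add_sq_mem hp
      rw [ofReal_log_one_sub (dbl_mem hp).2.le, ofReal_log_one_sub hp.2.le, Complex.norm_real,
        Complex.norm_real, Real.norm_eq_abs, Real.norm_eq_abs,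
        abs_of_neg (Real.log_neg (by linarith [hp.2]) (by linarith [hp.1])), log_one_sub_dbl hp]
      have := neg_abs_le (2 * Real.log (1 - p) - Real.log (1 + p ^ 2))
      have := abs_nonneg (2 * Real.log (1 - p) - Real.log (1 + p ^ 2))
      linarith

lemma tendsto_norm_log_ofReal :
    Tendsto (fun p : ℝ => ‖Complex.log (p : ℂ)‖) (𝓝[>] 0) atTop := by
  refine (tendsto_abs_atBot_atTop.comp Real.tendsto_log_nhdsGT_zero).congr' ?_
  filter_upwards [Ioo_mem_nhdsGT zero_lt_one] with p hp
  rw [← Complex.ofReal_log hp.1.le, Complex.norm_real, Real.norm_eq_abs]; rfl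

lemma tendsto_norm_log_one_sub_ofReal :
    Tendsto (fun p : ℝ => ‖Complex.log (1 - (p : ℂ))‖) (𝓝[<] 1) atTop := by
  have h1 : Tendsto (fun p : ℝ => 1 - p) (𝓝[<] 1) (𝓝[>] 0) := by
    refine tendsto_nhdsWithin_iff.2 ⟨?_, ?_⟩
    · have : Tendsto (fun p : ℝ => 1 - p) (𝓝 1) (𝓝 (1 - 1)) :=
        (continuous_const.sub continuous_id).tendsto 1
      rw [sub_self] at this
      exact this.mono_left nhdsWithin_le_nhds
    · filter_upwards [self_mem_nhdsWithin] with p hp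
      exact Set.mem_Ioi.2 (sub_pos.2 (Set.mem_Iio.1 hp))
  refine (tendsto_norm_log_ofReal.comp h1).congr fun p => ?_
  simp

lemma one_sub_dbl_sq (p : ℝ) : 1 - dbl p ^ 2 = (1 - p ^ 2) ^ 2 / (1 + p ^ 2) ^ 2 := by
  have h : (1 : ℝ) + p ^ 2 ≠ 0 := by positivity
  rw [dbl]; field_simp; ring

lemma dblForm_eq {p : ℝ} (hp : p ∈ Set.Ioo (0 : ℝ) 1) :
    dblDeriv p / (1 - dbl p ^ 2) = 1 / (p - -1) - 1 / (p - 1) := by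
  have h : (1 : ℝ) + p ^ 2 ≠ 0 := by positivity
  have h1 : 1 - p ^ 2 ≠ 0 := by nlinarith [hp.1, hp.2]
  have h2 : p - 1 ≠ 0 := by linarith [hp.2]
  have h3 : p - -1 ≠ 0 := by linarith [hp.1]
  rw [one_sub_dbl_sq, dblDeriv]
  field_simp
  ring

lemma dblForm_log_eq {p : ℝ} (hp : p ∈ Set.Ioo (0 : ℝ) 1) :
    dblDeriv p / dbl p = 1 / (p - 0) - 2 * p ^ (2 - 1) / (p ^ 2 + 1) * 1 := by
  have h : (1 : ℝ) + p ^ 2 ≠ 0 := by positivity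
  have h1 : p ^ 2 + 1 ≠ 0 := by positivity
  have h2 := hp.1.ne'
  rw [dbl, dblDeriv, sub_zero]
  field_simp
  ring

lemma dblForm_log_one_sub_eq {p : ℝ} (hp : p ∈ Set.Ioo (0 : ℝ) 1) :
    dbl p * dblDeriv p / (1 - dbl p ^ 2) =
      2 * p ^ (2 - 1) / (p ^ 2 + 1) * 1 - 1 / (p - 1) - 1 / (p - -1) := by
  have h : (1 : ℝ) + p ^ 2 ≠ 0 := by positivity
  have h0 : p ^ 2 + 1 ≠ 0 := by positivity
  have h1 : 1 - p ^ 2 ≠ 0 := by nlinarith [hp.1, hp.2]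
  have h2 : p - 1 ≠ 0 := by linarith [hp.2]
  have h3 : p - -1 ≠ 0 := by linarith [hp.1]
  rw [one_sub_dbl_sq, dblDeriv, dbl]
  field_simp
  ring

/-- The purpose of the substitution: `1 - u²/2 = (1+p⁴)/(1+p²)²`, whose zeros and poles are eighth
roots of unity. -/
lemma dblForm_log_two_sub_eq (p : ℝ) :
    -(dbl p * dblDeriv p) / (1 - dbl p ^ 2 / 2) =
      4 * p ^ (4 - 1) / (p ^ 4 + 1) * 1 - 2 * (2 * p ^ (2 - 1) / (p ^ 2 + 1) * 1) := by
  have h : (1 : ℝ) + p ^ 2 ≠ 0 := by positivity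
  have h0 : p ^ 2 + 1 ≠ 0 := by positivity
  have h1 : p ^ 4 + 1 ≠ 0 := by positivity
  have e : 1 - dbl p ^ 2 / 2 = (p ^ 4 + 1) / (1 + p ^ 2) ^ 2 := by
    rw [dbl]; field_simp; ring
  rw [e, dblDeriv, dbl]
  field_simp
  ring

lemma one_sub_kerArg_eight (u : ℝ) :
    1 - kerArg 8 u = (1 - u ^ 2 / 2) * (1 + u ^ 4) := by
  unfold kerArg; ring

/-- In `u` the factor `1 - u²/2` has the inadmissible zeros `±√2`, while in `p` the zeros of `1 +
u⁴` satisfy `(p + 1/p)⁴ = -16` and are off the unit circle. So each factor of `1 - X` is assigned to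
its own arc, and `log(1-X)` lies only in the sum of the two classes. -/
theorem kernelPath_dbl : ∃ D Ω Lg, KernelPath 8 8 0 1 D Ω Lg dbl dblDeriv := by
  have hN : 0 < 8 := by norm_num
  have hE : Even 8 := by decide
  have hA := arc_id hN
  have hB := arc_dbl hN hE
  have ta := tendsto_norm_log_ofReal
  have tb := tendsto_norm_log_one_sub_ofReal
  have cA := polyClass_of_arc hN zero_lt_one hA ta tb
  have cB := polyClass_of_arc hN zero_lt_one hB ta tb
  have z0 : (0 : ℂ) = 0 ∨ (0 : ℂ) ^ 8 = 1 := Or.inl rfl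
  have z1 : (1 : ℂ) = 0 ∨ (1 : ℂ) ^ 8 = 1 := Or.inr (one_pow 8)
  have z2 : (-1 : ℂ) = 0 ∨ (-1 : ℂ) ^ 8 = 1 := Or.inr (by norm_num)
  have d2 : ∀ s ∈ Set.Ioo (0 : ℝ) 1, 1 - dbl s ^ 2 ≠ 0 := fun s hs => by
    nlinarith [(dbl_mem hs).1, (dbl_mem hs).2]
  have fA1 : (fun s => ((dblDeriv s / (1 - dbl s ^ 2) : ℝ) : ℂ)) ∈
      PathForm 8 0 1 (fun p => (p : ℂ)) (fun _ => 1) := by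
    refine PathForm.congr (Submodule.sub_mem _ (PathForm.one_div_sub_mem z2)
      (PathForm.one_div_sub_mem z1)) fun s hs => ?_
    rw [dblForm_eq hs]
    simp only [Pi.sub_apply]; push_cast; rfl
  have fA2 : (fun s => ((dblDeriv s / dbl s : ℝ) : ℂ)) ∈
      PathForm 8 0 1 (fun p => (p : ℂ)) (fun _ => 1) := by
    refine PathForm.congr (Submodule.sub_mem _ (PathForm.one_div_sub_mem z0)
      (PathForm.logDeriv_pow_add_one_mem hA.mem (n := 2) (by norm_num) (by norm_num))) fun s hs => ?_
    rw [dblForm_log_eq hs]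
    simp only [Pi.sub_apply]; push_cast; rfl
  have fA3 : (fun s => ((dbl s * dblDeriv s / (1 - dbl s ^ 2) : ℝ) : ℂ)) ∈
      PathForm 8 0 1 (fun p => (p : ℂ)) (fun _ => 1) := by
    refine PathForm.congr (Submodule.sub_mem _ (Submodule.sub_mem _
      (PathForm.logDeriv_pow_add_one_mem hA.mem (n := 2) (by norm_num) (by norm_num))
      (PathForm.one_div_sub_mem z1)) (PathForm.one_div_sub_mem z2)) fun s hs => ?_
    rw [dblForm_log_one_sub_eq hs]
    simp only [Pi.sub_apply]; push_cast; rfl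
  have ne1 : ∀ s ∈ Set.Ioo (0 : ℝ) 1, dbl s - 1 ≠ 0 ∧ dbl s - -1 ≠ 0 := fun s hs =>
    ⟨by linarith [(dbl_mem hs).2], by linarith [(dbl_mem hs).1]⟩
  have fB1 : (fun s => ((dblDeriv s / (1 - dbl s ^ 2) : ℝ) : ℂ)) ∈
      PathForm 8 0 1 (fun p => (dbl p : ℂ)) (fun p => (dblDeriv p : ℂ)) := by
    refine PathForm.congr (Submodule.smul_mem _ (1 / 2 : ℚ) (Submodule.sub_mem _
      (PathForm.one_div_sub_mem z2) (PathForm.one_div_sub_mem z1))) fun s hs => ?_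
    have e : dblDeriv s / (1 - dbl s ^ 2) =
        1 / 2 * (dblDeriv s / (dbl s - -1) - dblDeriv s / (dbl s - 1)) := by
      obtain ⟨n1, n2⟩ := ne1 s hs
      have := d2 s hs
      field_simp
      ring
    rw [e]
    simp only [Pi.sub_apply, Pi.smul_apply, Rat.smul_def]; push_cast; rfl
  have fB2 : (fun s => ((dblDeriv s / dbl s : ℝ) : ℂ)) ∈
      PathForm 8 0 1 (fun p => (dbl p : ℂ)) (fun p => (dblDeriv p : ℂ)) := by
    refine PathForm.congr (PathForm.one_div_sub_mem z0) fun s hs => ?_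
    push_cast; rw [sub_zero]
  have fB3 : (fun s => ((dbl s * dblDeriv s / (1 - dbl s ^ 2) : ℝ) : ℂ)) ∈
      PathForm 8 0 1 (fun p => (dbl p : ℂ)) (fun p => (dblDeriv p : ℂ)) := by
    refine PathForm.congr (Submodule.smul_mem _ (-1 / 2 : ℚ) (Submodule.add_mem _
      (PathForm.one_div_sub_mem z2) (PathForm.one_div_sub_mem z1))) fun s hs => ?_
    have e : dbl s * dblDeriv s / (1 - dbl s ^ 2) =
        -1 / 2 * (dblDeriv s / (dbl s - -1) + dblDeriv s / (dbl s - 1)) := by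
      obtain ⟨n1, n2⟩ := ne1 s hs
      have := d2 s hs
      field_simp
      ring
    rw [e]
    simp only [Pi.add_apply, Pi.smul_apply, Rat.smul_def]; push_cast; rfl
  have lim0 : ∀ f : ℝ → ℝ, Continuous f → ∀ L, f 0 = L →
      Tendsto (fun s => f (dbl s)) (𝓝[>] 0) (𝓝 L) := by
    intro f hf L hL
    rw [← hL]
    have := ((hf.comp continuous_dbl).tendsto 0).mono_left (nhdsWithin_le_nhds (s := Set.Ioi 0))
    simpa [dbl_zero, Function.comp_def] using this
  have lim1 : ∀ f : ℝ → ℝ, Continuous f → ∀ L, f 1 = L →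
      Tendsto (fun s => f (dbl s)) (𝓝[<] 1) (𝓝 L) := by
    intro f hf L hL
    rw [← hL]
    have := ((hf.comp continuous_dbl).tendsto 1).mono_left (nhdsWithin_le_nhds (s := Set.Iio 1))
    simpa [dbl_one, Function.comp_def] using this
  have l1 : (Real.log 1 : ℂ) ∈ Zsp 8 1 := by
    rw [Real.log_one, Complex.ofReal_zero]; exact Submodule.zero_mem _
  have dsq : ∀ s, HasDerivAt (fun s => dbl s ^ 2) (2 * (dbl s * dblDeriv s)) s := fun s =>
    ((hasDerivAt_dbl s).pow 2).congr_deriv (by push_cast; ring)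
  have logSq : ∀ {D : ℕ → Submodule ℚ (ℝ → ℂ)} {Ω Lg : Submodule ℚ (ℝ → ℂ)},
      PolyClass 8 0 1 D Ω Lg → (fun s => ((dblDeriv s / dbl s : ℝ) : ℂ)) ∈ Ω →
      (fun s => ((Real.log (dbl s ^ 2) : ℝ) : ℂ)) ∈ D 1 := by
    intro D Ω Lg hD hω
    refine hD.log_mem (L := 1) (fun s hs => pow_ne_zero 2 (dbl_mem hs).1.ne') (fun s _ => dsq s)
      (hD.form_congr (Submodule.smul_mem _ (2 : ℚ) hω) fun s hs => ?_) one_ne_zero l1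
      (Or.inr (lim1 (fun u => u ^ 2) (by fun_prop) 1 (by norm_num)))
    have := (dbl_mem hs).1.ne'
    simp only [Pi.smul_apply, Rat.smul_def]
    norm_cast
    field_simp
  have logOneSub : ∀ {D : ℕ → Submodule ℚ (ℝ → ℂ)} {Ω Lg : Submodule ℚ (ℝ → ℂ)},
      PolyClass 8 0 1 D Ω Lg → (fun s => ((dbl s * dblDeriv s / (1 - dbl s ^ 2) : ℝ) : ℂ)) ∈ Ω →
      (fun s => ((Real.log (1 - dbl s ^ 2) - 2 * Real.log 2 : ℝ) : ℂ)) ∈ D 1 := by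
    intro D Ω Lg hD hω
    have h1 : (fun s => ((Real.log (1 - dbl s ^ 2) : ℝ) : ℂ)) ∈ D 1 := by
      refine hD.log_mem (L := 1) d2 (fun s _ => (dsq s).const_sub 1)
        (hD.form_congr (Submodule.smul_mem _ (-2 : ℚ) hω) fun s hs => ?_) one_ne_zero l1
        (Or.inl (lim0 (fun u => 1 - u ^ 2) (by fun_prop) 1 (by norm_num)))
      have := d2 s hs
      simp only [Pi.smul_apply, Rat.smul_def]
      norm_cast
      push_cast
      ring
    refine hD.congr (Submodule.sub_mem _ h1 (hD.const (Submodule.smul_mem _ (2 : ℚ)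
      (log_two_mem_Zsp hN hE)))) fun s _ => ?_
    simp [Rat.smul_def]
  refine ⟨_, _, _, ⟨polyClass_of_arcs hN zero_lt_one hA hB ta tb, by norm_num,
    continuous_dbl.continuousOn, fun s _ => hasDerivAt_dbl s, fun s hs => ?_, fun s hs => dbl_mem hs,
    fun s hs => ?_, Or.inl ?_, ⟨fA1, fB1⟩, ⟨fA2, fB2⟩, ⟨fA3, fB3⟩, ⟨logSq cA fA2, logSq cB fB2⟩,
    ⟨logOneSub cA fA3, logOneSub cB fB3⟩, ?_⟩⟩
  · have := hs.1
    have : 0 ≤ 1 - s ^ 2 := by nlinarith [hs.1, hs.2]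
    unfold dblDeriv
    positivity
  · obtain ⟨h0, h1⟩ := dbl_mem hs
    have e := one_sub_kerArg_eight (dbl s)
    have : 0 < (1 - dbl s ^ 2 / 2) * (1 + dbl s ^ 4) := by
      have : 0 < 1 - dbl s ^ 2 / 2 := by nlinarith
      positivity
    linarith
  · exact lim0 (kerArg 8) (by unfold kerArg; fun_prop) 0 (by simp [kerArg])
  · have n1 : ∀ s ∈ Set.Ioo (0 : ℝ) 1, 1 - dbl s ^ 2 / 2 ≠ 0 := fun s hs => by
      nlinarith [(dbl_mem hs).1, (dbl_mem hs).2]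
    have hA' : (fun s => ((Real.log (1 - dbl s ^ 2 / 2) : ℝ) : ℂ)) ∈
        PathFn 8 0 1 (fun p => (p : ℂ)) 1 := by
      refine cA.log_mem (L := 1) n1
        (fun s _ => (((dsq s).div_const 2).const_sub 1).congr_deriv
          (show _ = -(dbl s * dblDeriv s) by ring))
        (PathForm.congr (Submodule.sub_mem _
          (PathForm.logDeriv_pow_add_one_mem hA.mem (n := 4) (by norm_num) (by norm_num))
          (Submodule.smul_mem _ (2 : ℚ)
            (PathForm.logDeriv_pow_add_one_mem hA.mem (n := 2) (by norm_num) (by norm_num))))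
          fun s hs => ?_) one_ne_zero l1
        (Or.inl (lim0 (fun u => 1 - u ^ 2 / 2) (by fun_prop) 1 (by norm_num)))
      rw [dblForm_log_two_sub_eq]
      simp only [Pi.sub_apply, Pi.smul_apply, Rat.smul_def]; push_cast; rfl
    have hB' : (fun s => ((Real.log (1 + dbl s ^ 4) : ℝ) : ℂ)) ∈
        PathFn 8 0 1 (fun p => (dbl p : ℂ)) 1 := by
      refine cB.log_mem (L := 1) (fun s _ => by positivity)
        (fun s _ => ((hasDerivAt_dbl s).pow 4).const_add 1)
        (PathForm.congr
          (PathForm.logDeriv_pow_add_one_mem hB.mem (n := 4) (by norm_num) (by norm_num))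
          fun s hs => ?_) one_ne_zero l1
        (Or.inl (lim0 (fun u => 1 + u ^ 4) (by fun_prop) 1 (by norm_num)))
      push_cast
      ring
    refine (polyClass_of_arcs hN zero_lt_one hA hB ta tb).congr
      (Submodule.add_mem_sup hA' hB') fun s hs => ?_
    rw [one_sub_kerArg_eight, Real.log_mul (n1 s hs) (by positivity)]
    simp

/-! ### Level 12: arcs of the unit circle -/

/-- The point `exp(iθ)` of the unit circle. -/
noncomputable def cis (θ : ℝ) : ℂ := Complex.exp (θ * Complex.I)

lemma cis_ne_zero (θ : ℝ) : cis θ ≠ 0 := Complex.exp_ne_zero _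

lemma norm_cis (θ : ℝ) : ‖cis θ‖ = 1 := Complex.norm_exp_ofReal_mul_I θ

lemma cis_zero : cis 0 = 1 := by simp [cis]

lemma cis_add (x y : ℝ) : cis (x + y) = cis x * cis y := by
  rw [cis, cis, cis, ← Complex.exp_add]; congr 1; push_cast; ring

lemma cis_pow (θ : ℝ) (n : ℕ) : cis θ ^ n = cis (n * θ) := by
  rw [cis, cis, ← Complex.exp_nat_mul]; congr 1; push_cast; ring

lemma hasDerivAt_cis (θ : ℝ) : HasDerivAt cis (Complex.I * cis θ) θ := by
  have h1 : HasDerivAt (fun θ : ℝ => (θ : ℂ) * Complex.I) Complex.I θ := by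
    simpa using (hasDerivAt_id θ).ofReal_comp.mul_const Complex.I
  exact h1.cexp.congr_deriv (by rw [cis]; ring)

lemma continuous_cis : Continuous cis := continuous_iff_continuousAt.2 fun θ =>
  (hasDerivAt_cis θ).continuousAt

lemma log_cis {θ : ℝ} (h0 : -π < θ) (h1 : θ ≤ π) : Complex.log (cis θ) = θ * Complex.I :=
  Complex.log_exp (by simpa using h0) (by simpa using h1)

lemma ofReal_cos_eq (θ : ℝ) : ((Real.cos θ : ℝ) : ℂ) = (cis θ ^ 2 + 1) / (2 * cis θ) := by
  have h := cis_ne_zero θ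
  rw [eq_div_iff (by simpa using h), cis]
  push_cast
  rw [Complex.cos, pow_two]
  have : Complex.exp (-(θ : ℂ) * Complex.I) * Complex.exp (θ * Complex.I) = 1 := by
    rw [← Complex.exp_add]; simp
  linear_combination this

lemma ofReal_sin_eq (θ : ℝ) :
    ((Real.sin θ : ℝ) : ℂ) = -Complex.I * (cis θ ^ 2 - 1) / (2 * cis θ) := by
  have h := cis_ne_zero θ
  rw [eq_div_iff (by simpa using h), cis]
  push_cast
  rw [Complex.sin, pow_two]
  have : Complex.exp (-(θ : ℂ) * Complex.I) * Complex.exp (θ * Complex.I) = 1 := by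
    rw [← Complex.exp_add]; simp
  linear_combination Complex.I * this

/-- On the unit circle the cuts of `1 - z^12` are met only at twelfth roots of unity, which are
excluded between consecutive multiples of `π/6`. -/
lemma cis_mem_Dom {φ : ℝ} (hφ : |φ| < π / 2) {k : ℤ} (h0 : k * (π / 6) < φ)
    (h1 : φ < (k + 1) * (π / 6)) : cis φ ∈ Dom 12 := by
  refine ⟨Or.inl ?_, ?_⟩
  · rw [cis, Complex.exp_ofReal_mul_I_re]
    exact Real.cos_pos_of_mem_Ioo (abs_lt.1 hφ)
  · by_contra h
    obtain ⟨x, hx, hxe⟩ := not_mem_slitPlane_one_sub.1 h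
    have hx1 : x = 1 := by
      have := congrArg norm hxe
      rw [norm_pow, norm_cis, one_pow, Complex.norm_real, Real.norm_eq_abs,
        abs_of_pos (by linarith)] at this
      exact this.symm
    rw [hx1, cis_pow, cis, Complex.ofReal_one, Complex.exp_eq_one_iff] at hxe
    obtain ⟨n, hn⟩ := hxe
    have h2 : (12 : ℝ) * φ = n * (2 * π) := by
      have h3 : (((12 : ℕ) * φ : ℝ) : ℂ) * Complex.I = ((n * (2 * π) : ℝ) : ℂ) * Complex.I := by
        rw [hn]; push_cast; ring
      have := mul_right_cancel₀ Complex.I_ne_zero h3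
      exact_mod_cast this
    have h4 : φ = n * (π / 6) := by linarith
    rw [h4] at h0 h1
    have hπ : 0 < π / 6 := by positivity
    have h5 : (k : ℝ) < n := lt_of_mul_lt_mul_right h0 hπ.le
    have h6 : (n : ℝ) < k + 1 := lt_of_mul_lt_mul_right h1 hπ.le
    have h7 : k < n := by exact_mod_cast h5
    have h8 : n < k + 1 := by exact_mod_cast h6
    omega

lemma one_sub_cis_pi_div_three : 1 - cis (π / 3) = cis (-(π / 3)) := by
  have h := ofReal_cos_eq (π / 3)
  have h0 := cis_ne_zero (π / 3)
  rw [Real.cos_pi_div_three, eq_div_iff (by simpa using h0)] at h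
  have h1 : cis (-(π / 3)) * cis (π / 3) = 1 := by rw [← cis_add, neg_add_cancel, cis_zero]
  refine mul_right_cancel₀ h0 ?_
  rw [h1]
  push_cast at h
  linear_combination h

lemma cis_nat_mul_pow (n : ℕ) : cis (n * (π / 6)) ^ 12 = 1 := by
  rw [cis_pow, cis, Complex.exp_eq_one_iff]
  exact ⟨n, by push_cast; ring⟩

/-- From `1 - exp(iπ/3) = exp(-iπ/3)`: the logarithm of the left side is a value of weight one, and
it equals `-iπ/3`. -/
lemma pi_mul_I_mem_Zsp : ((π / 6 : ℝ) : ℂ) * Complex.I ∈ Zsp 12 1 := by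
  have h1 : cis (π / 3) ^ 12 = 1 := by
    have := cis_nat_mul_pow 2
    rwa [show ((2 : ℕ) : ℝ) * (π / 6) = π / 3 by push_cast; ring] at this
  have hπ := Real.pi_pos
  have h2 : cis (π / 3) ≠ 1 := by
    intro h
    have h3 := one_sub_cis_pi_div_three
    rw [h, sub_self] at h3
    exact cis_ne_zero _ h3.symm
  have h3 := log_one_sub_mem_Zsp (by norm_num) h1 h2
  rw [one_sub_cis_pi_div_three, log_cis (by linarith) (by linarith)] at h3
  have h4 := Submodule.smul_mem _ (-1 / 2 : ℚ) h3
  convert h4 using 1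
  rw [Rat.smul_def]
  push_cast
  ring

/-- For a primitive cube root of unity `ω`, the sum `log(1-ω) + log(1-ω̄)` equals `log |1-ω|² = log
3`. -/
lemma log_three_mem_Zsp : (Real.log 3 : ℂ) ∈ Zsp 12 1 := by
  have h3 : (√3 : ℝ) ^ 2 = 3 := Real.sq_sqrt (by norm_num)
  have h3' : ((√3 : ℝ) : ℂ) ^ 2 = 3 := by exact_mod_cast h3
  have key : ∀ ε : ℂ, ε ^ 2 = -1 → (-1 / 2 + (√3 : ℝ) / 2 * ε : ℂ) ^ 12 = 1 := by
    intro ε hε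
    have e3 : (-1 / 2 + (√3 : ℝ) / 2 * ε : ℂ) ^ 3 = 1 := by
      linear_combination (-3 / 8 + (√3 : ℝ) / 8 * ε : ℂ) * ((√3 : ℝ) : ℂ) ^ 2 * hε +
        (3 / 8 - (√3 : ℝ) / 8 * ε : ℂ) * h3'
    rw [show 12 = 3 * 4 by norm_num, pow_mul, e3, one_pow]
  set z : ℂ := 3 / 2 - (√3 : ℝ) / 2 * Complex.I with hz
  have hre : z.re = 3 / 2 := by simp [hz]
  have him : z.im = -(√3 / 2) := by simp [hz]
  have m1 : Complex.log z ∈ Zsp 12 1 := by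
    have := log_one_sub_mem_Zsp (N := 12) (by norm_num) (key Complex.I Complex.I_sq) (fun h => by
      have := congrArg Complex.re h
      simp at this
      norm_num at this)
    convert this using 2
    rw [hz]; ring
  have m2 : Complex.log (starRingEnd ℂ z) ∈ Zsp 12 1 := by
    have := log_one_sub_mem_Zsp (N := 12) (by norm_num) (key (-Complex.I) (by simp)) (fun h => by
      have := congrArg Complex.re h
      simp at this
      norm_num at this)
    convert this using 2
    apply Complex.ext
    · rw [Complex.conj_re, hre]; simp; norm_num
    · rw [Complex.conj_im, him]; simp
  have harg : z.arg ≠ π := by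
    intro h
    have := (Complex.arg_eq_pi_iff.1 h).1
    rw [hre] at this
    norm_num at this
  rw [Complex.log_conj _ harg] at m2
  have hs := Submodule.add_mem _ m1 m2
  rw [Complex.add_conj, Complex.log_re] at hs
  have hn : ‖z‖ ^ 2 = 3 := by
    rw [← Complex.normSq_eq_norm_sq, Complex.normSq_apply, hre, him]
    linear_combination h3 / 4
  have : 2 * Real.log ‖z‖ = Real.log 3 := by
    rw [← hn, Real.log_pow]; norm_num
  rwa [this] at hs

lemma tendsto_norm_log_one_sub_cis {l : Filter ℝ} {θ₀ : ℝ} (h : Tendsto (fun θ => θ - θ₀) l (𝓝 0))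
    (hD : ∀ᶠ θ in l, cis (θ - θ₀) ∈ Dom 12) :
    Tendsto (fun θ => ‖Complex.log (1 - cis (θ - θ₀))‖) l atTop := by
  have h1 : Tendsto (fun θ => ‖1 - cis (θ - θ₀)‖) l (𝓝[>] 0) := by
    refine tendsto_nhdsWithin_iff.2 ⟨?_, ?_⟩
    · have := ((continuous_const.sub continuous_cis).norm.tendsto (0 : ℝ) :
        Tendsto (fun x => ‖1 - cis x‖) (𝓝 0) (𝓝 ‖1 - cis 0‖)).comp h
      simpa [cis_zero, Function.comp_def] using this
    · filter_upwards [hD] with θ hθ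
      refine norm_pos_iff.2 fun h0 => one_not_mem_Dom (N := 12) ?_
      rw [sub_eq_zero.1 h0]; exact hθ
  refine tendsto_atTop_mono (fun θ => ?_)
    (tendsto_abs_atBot_atTop.comp (Real.tendsto_log_nhdsGT_zero.comp h1))
  have := Complex.abs_re_le_norm (Complex.log (1 - cis (θ - θ₀)))
  rwa [Complex.log_re] at this

/-- Rotation by `ζ = exp(i m π/6)`. All arguments involved stay inside `(-π, π)`, so the logarithms
add without a branch jump. -/
lemma goodEnd_cis {l : Filter ℝ} {m : ℕ} (hm : m ≤ 2)
    (h : Tendsto (fun θ => θ - m * (π / 6)) l (𝓝 0))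
    (hD : ∀ᶠ θ in l, cis θ ∈ Dom 12) (hD' : ∀ᶠ θ in l, cis (θ - m * (π / 6)) ∈ Dom 12) :
    GoodEnd 12 l (fun θ => Complex.log (1 - cis (θ - m * (π / 6)))) cis := by
  have hπ := Real.pi_pos
  have hm' : (m : ℝ) ≤ 2 := by exact_mod_cast hm
  have hm0 : (0 : ℝ) ≤ m := m.cast_nonneg
  have hlog : Complex.log (cis (m * (π / 6))) = ((m * (π / 6) : ℝ) : ℂ) * Complex.I :=
    log_cis (by nlinarith) (by nlinarith)
  refine goodEnd_rotate (ζ := cis (m * (π / 6))) (by norm_num) (cis_nat_mul_pow m) ?_ ⟨?_, ?_, hD'⟩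
    ?_ hD ?_
  · rw [hlog]
    have := Submodule.smul_mem _ (m : ℚ) pi_mul_I_mem_Zsp
    convert this using 1
    rw [Rat.smul_def]; push_cast; ring
  · have := (continuous_cis.tendsto 0).comp h
    rwa [cis_zero] at this
  · exact Eventually.of_forall fun θ => (norm_cis _).le
  · exact Eventually.of_forall fun θ => by rw [← cis_add]; congr 1; ring
  · have h1 : ∀ᶠ θ in l, |θ - m * (π / 6)| < π / 2 := by
      have := h.abs
      rw [abs_zero] at this
      exact this.eventually_lt_const (by positivity)
    filter_upwards [h1] with θ hθ
    obtain ⟨h2, h3⟩ := abs_lt.1 hθ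
    have e1 : Complex.log (cis θ) = θ * Complex.I := log_cis (by nlinarith) (by nlinarith)
    rw [hlog, e1, log_cis (by linarith) (by linarith)]
    push_cast; ring

theorem arc_cis {m : ℕ} (hm : m ≤ 1) :
    Arc 12 (m * (π / 6)) ((m + 1 : ℕ) * (π / 6))
      (fun θ => Complex.log (1 - cis (θ - m * (π / 6))))
      (fun θ => Complex.log (1 - cis (θ - (m + 1 : ℕ) * (π / 6)))) cis
      (fun θ => Complex.I * cis θ) ∧
    Tendsto (fun θ => ‖Complex.log (1 - cis (θ - m * (π / 6)))‖) (𝓝[>] (m * (π / 6))) atTop ∧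
    Tendsto (fun θ => ‖Complex.log (1 - cis (θ - (m + 1 : ℕ) * (π / 6)))‖)
      (𝓝[<] ((m + 1 : ℕ) * (π / 6))) atTop := by
  have hπ := Real.pi_pos
  have hm' : (m : ℝ) ≤ 1 := by exact_mod_cast hm
  have hm0 : (0 : ℝ) ≤ m := m.cast_nonneg
  have hlt : (m : ℝ) * (π / 6) < (m + 1 : ℕ) * (π / 6) := by push_cast; nlinarith
  have hmem : ∀ s ∈ Set.Ioo ((m : ℝ) * (π / 6)) ((m + 1 : ℕ) * (π / 6)), cis s ∈ Dom 12 := by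
    intro s hs
    have h1 := hs.1
    have h2 := hs.2
    push_cast at h2
    refine cis_mem_Dom (k := m) (abs_lt.2 ⟨by nlinarith, by nlinarith⟩) ?_ ?_
    · exact_mod_cast h1
    · push_cast; exact h2
  have ht : ∀ (c : ℝ) (S : Set ℝ), Tendsto (fun θ => θ - c) (𝓝[S] c) (𝓝 0) := by
    intro c S
    have : Tendsto (fun θ => θ - c) (𝓝 c) (𝓝 (c - c)) := (continuous_id.sub continuous_const).tendsto c
    rw [sub_self] at this
    exact this.mono_left nhdsWithin_le_nhds
  have hl : ∀ᶠ θ in 𝓝[>] ((m : ℝ) * (π / 6)), cis (θ - m * (π / 6)) ∈ Dom 12 := by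
    filter_upwards [Ioo_mem_nhdsGT hlt] with θ hθ
    have h1 := hθ.1
    have h2 := hθ.2
    push_cast at h2
    exact cis_mem_Dom (k := 0) (abs_lt.2 ⟨by nlinarith, by nlinarith⟩) (by push_cast; linarith)
      (by push_cast; linarith)
  have hr : ∀ᶠ θ in 𝓝[<] (((m + 1 : ℕ) : ℝ) * (π / 6)),
      cis (θ - (m + 1 : ℕ) * (π / 6)) ∈ Dom 12 := by
    filter_upwards [Ioo_mem_nhdsLT hlt] with θ hθ
    have h1 := hθ.1
    have h2 := hθ.2
    push_cast at h2 ⊢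
    exact cis_mem_Dom (k := -1) (abs_lt.2 ⟨by nlinarith, by nlinarith⟩) (by push_cast; linarith)
      (by push_cast; linarith)
  refine ⟨⟨fun s _ => hasDerivAt_cis s, hmem, ?_, ?_⟩, tendsto_norm_log_one_sub_cis (ht _ _) hl,
    tendsto_norm_log_one_sub_cis (ht _ _) hr⟩
  · refine goodEnd_cis (by omega) (ht _ _) ?_ hl
    filter_upwards [Ioo_mem_nhdsGT hlt] with θ hθ using hmem θ hθ
  · refine goodEnd_cis (by omega) (ht _ _) ?_ hr
    filter_upwards [Ioo_mem_nhdsLT hlt] with θ hθ using hmem θ hθ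

/-- The substitution `θ ↦ (2 / √3) sin θ`. -/
noncomputable def sinSub (θ : ℝ) : ℝ := 2 / √3 * Real.sin θ

/-- The derivative of `sinSub`. -/
noncomputable def sinSubDeriv (θ : ℝ) : ℝ := 2 / √3 * Real.cos θ

lemma hasDerivAt_sinSub (θ : ℝ) : HasDerivAt sinSub (sinSubDeriv θ) θ :=
  (Real.hasDerivAt_sin θ).const_mul _

lemma continuous_sinSub : Continuous sinSub := continuous_const.mul Real.continuous_sin

lemma sq_sqrt_three : (√3 : ℝ) ^ 2 = 3 := Real.sq_sqrt (by norm_num)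

lemma sinSub_sq (θ : ℝ) : sinSub θ ^ 2 = 4 / 3 * Real.sin θ ^ 2 := by
  rw [sinSub, mul_pow, div_pow, sq_sqrt_three]; norm_num

lemma sinSub_zero : sinSub 0 = 0 := by simp [sinSub]

lemma sinSub_pi_div_three : sinSub (π / 3) = 1 := by
  have h : (√3 : ℝ) ≠ 0 := by positivity
  rw [sinSub, Real.sin_pi_div_three]
  field_simp

lemma sinSub_pi_div_six_sq : sinSub (π / 6) ^ 2 = 1 / 3 := by
  rw [sinSub_sq, Real.sin_pi_div_six]; norm_num

lemma sinSub_mem {θ : ℝ} (h0 : 0 < θ) (h1 : θ < π / 3) : sinSub θ ∈ Set.Ioo (0 : ℝ) 1 := by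
  have hπ := Real.pi_pos
  have h3 : (0 : ℝ) < 2 / √3 := by positivity
  refine ⟨mul_pos h3 (Real.sin_pos_of_pos_of_lt_pi h0 (by linarith)), ?_⟩
  rw [← sinSub_pi_div_three, sinSub, sinSub]
  refine mul_lt_mul_of_pos_left (Real.sin_lt_sin_of_lt_of_le_pi_div_two ?_ ?_ h1) h3 <;> linarith

/-- The constant `2/√3` is chosen so that `√X` becomes the triple-angle polynomial `3 sin θ - 4 sin³
θ` up to sign. -/
lemma kerArg_sinSub (θ : ℝ) : kerArg 108 (sinSub θ) = Real.sin (3 * θ) ^ 2 := by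
  rw [kerArg, sinSub_sq, Real.sin_three_mul]; ring

lemma one_sub_kerArg_sinSub (θ : ℝ) : 1 - kerArg 108 (sinSub θ) = Real.cos (3 * θ) ^ 2 := by
  rw [kerArg_sinSub, Real.cos_sq']

lemma argDeriv_sinSub (θ : ℝ) :
    argDeriv 108 sinSub sinSubDeriv θ = 6 * Real.sin (3 * θ) * Real.cos (3 * θ) := by
  have h : (√3 : ℝ) ≠ 0 := by positivity
  have e : sinSub θ * sinSubDeriv θ = 4 / 3 * Real.sin θ * Real.cos θ := by
    rw [sinSub, sinSubDeriv]
    field_simp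
    rw [sq_sqrt_three]; ring
  have e2 : argDeriv 108 sinSub sinSubDeriv θ =
      108 / 16 * (2 * (1 - sinSub θ ^ 2) * (1 - 3 * sinSub θ ^ 2)) *
        (sinSub θ * sinSubDeriv θ) := by
    rw [argDeriv]; ring
  rw [e2, e, sinSub_sq, Real.sin_three_mul, Real.cos_three_mul]
  have hc := Real.cos_sq' θ
  have : 4 * Real.cos θ ^ 3 - 3 * Real.cos θ = Real.cos θ * (1 - 4 * Real.sin θ ^ 2) := by
    rw [pow_succ, hc]; ring
  rw [this]
  ring

section Forms

variable {θ : ℝ}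

lemma cis_mem_factor (hθ : cis θ ∈ Dom 12) :
    cis θ ^ 2 - 1 ≠ 0 ∧ cis θ ^ 4 + cis θ ^ 2 + 1 ≠ 0 ∧ cis θ ^ 6 + 1 ≠ 0 := by
  have h : 1 - cis θ ^ 12 ≠ 0 := Complex.slitPlane_ne_zero hθ.2
  have e : 1 - cis θ ^ 12 = -((cis θ ^ 2 - 1) * (cis θ ^ 4 + cis θ ^ 2 + 1) * (cis θ ^ 6 + 1)) := by
    ring
  rw [e, neg_ne_zero] at h
  exact ⟨left_ne_zero_of_mul (left_ne_zero_of_mul h), right_ne_zero_of_mul (left_ne_zero_of_mul h),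
    right_ne_zero_of_mul h⟩

lemma ofReal_one_sub_sinSub_sq (θ : ℝ) :
    ((1 - sinSub θ ^ 2 : ℝ) : ℂ) = (cis θ ^ 4 + cis θ ^ 2 + 1) / (3 * cis θ ^ 2) := by
  have h0 := cis_ne_zero θ
  rw [sinSub_sq]
  push_cast
  rw [← Complex.ofReal_sin, ofReal_sin_eq]
  field_simp
  linear_combination (-4 * (cis θ ^ 2 - 1) ^ 2) * Complex.I_sq

lemma sinForm_log_eq (hθ : cis θ ∈ Dom 12) :
    ((sinSubDeriv θ / sinSub θ : ℝ) : ℂ) = Complex.I * cis θ / (cis θ - 1) +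
      Complex.I * cis θ / (cis θ - -1) - Complex.I * cis θ / (cis θ - 0) := by
  have h0 := cis_ne_zero θ
  obtain ⟨h1, -, -⟩ := cis_mem_factor hθ
  have h2 : cis θ - 1 ≠ 0 := fun h => h1 (by linear_combination (cis θ + 1) * h)
  have h3 : cis θ - -1 ≠ 0 := fun h => h1 (by linear_combination (cis θ - 1) * h)
  have h4 : (√3 : ℝ) ≠ 0 := by positivity
  have e : sinSubDeriv θ / sinSub θ = Real.cos θ / Real.sin θ := by
    rw [sinSub, sinSubDeriv, mul_div_mul_left _ _ (by positivity)]
  rw [e, Complex.ofReal_div, ofReal_cos_eq, ofReal_sin_eq, sub_zero]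
  have hI := Complex.I_ne_zero
  field_simp
  linear_combination (-(cis θ ^ 2 - 1) * (cis θ ^ 2 + 1)) * Complex.I_sq

lemma sinForm_log_one_sub_eq (hθ : cis θ ∈ Dom 12) :
    ((sinSub θ * sinSubDeriv θ / (1 - sinSub θ ^ 2) : ℝ) : ℂ) =
      ((-1 / 2 : ℚ) : ℂ) * ((4 * cis θ ^ 3 + 2 * cis θ) / (cis θ ^ 4 + cis θ ^ 2 + 1) *
        (Complex.I * cis θ)) + Complex.I * cis θ / (cis θ - 0) := by
  have h0 := cis_ne_zero θ
  obtain ⟨-, h1, -⟩ := cis_mem_factor hθ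
  have h : (√3 : ℝ) ≠ 0 := by positivity
  have e : sinSub θ * sinSubDeriv θ = 4 / 3 * Real.sin θ * Real.cos θ := by
    rw [sinSub, sinSubDeriv]
    field_simp
    rw [sq_sqrt_three]; ring
  rw [Complex.ofReal_div, ofReal_one_sub_sinSub_sq, e]
  push_cast
  rw [← Complex.ofReal_sin, ← Complex.ofReal_cos, ofReal_sin_eq, ofReal_cos_eq, sub_zero]
  generalize hK : cis θ ^ 4 + cis θ ^ 2 + 1 = K at h1 ⊢
  field_simp
  rw [← hK]
  ring

lemma inv_quadratic_sub {q a b : ℂ} (ha : q - a ≠ 0) (hb : q - b ≠ 0) :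
    1 / (q - a) - 1 / (q - b) = (a - b) / ((q - a) * (q - b)) := by
  field_simp
  ring

lemma sixthRoot_pow {ε : ℂ} (hε : ε ^ 2 = -3) :
    ((1 + ε) / 2) ^ 12 = 1 ∧ (-((1 + ε) / 2)) ^ 12 = 1 := by
  have h : ((1 + ε) / 2) ^ 3 = -1 := by linear_combination ((3 + ε) / 8) * hε
  constructor
  · rw [show 12 = 3 * 4 by norm_num, pow_mul, h]; norm_num
  · rw [Even.neg_pow (by decide), show 12 = 3 * 4 by norm_num, pow_mul, h]; norm_num

/-- In `q = exp(iθ)` one has `1 - u² = (q²-q+1)(q²+q+1)/(3q²)`. The result is a partial fraction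
expansion at the roots `(±1 ± ε)/2`, which are sixth roots of unity; the irrational `1/√3` cancels
against `ε = i√3`. -/
lemma sinForm_eq {ε : ℂ} (hε : ε = Complex.I * (√3 : ℝ)) (hθ : cis θ ∈ Dom 12) :
    ((sinSubDeriv θ / (1 - sinSub θ ^ 2) : ℝ) : ℂ) =
      ((-1 / 2 : ℚ) : ℂ) * ((Complex.I * cis θ / (cis θ - (1 + ε) / 2) -
        Complex.I * cis θ / (cis θ - (1 + -ε) / 2)) +
        (Complex.I * cis θ / (cis θ - -((1 + -ε) / 2)) -
          Complex.I * cis θ / (cis θ - -((1 + ε) / 2)))) := by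
  have h0 := cis_ne_zero θ
  obtain ⟨-, h1, -⟩ := cis_mem_factor hθ
  have h3 : ((√3 : ℝ) : ℂ) ^ 2 = 3 := by exact_mod_cast sq_sqrt_three
  have h3' : ((√3 : ℝ) : ℂ) ≠ 0 := by
    rw [Complex.ofReal_ne_zero]; positivity
  have hε2 : ε ^ 2 = -3 := by rw [hε, mul_pow, Complex.I_sq, h3]; ring
  set q := cis θ
  have p1 : (q - (1 + ε) / 2) * (q - (1 + -ε) / 2) = q ^ 2 - q + 1 := by
    linear_combination (-1 / 4) * hε2
  have p2 : (q - -((1 + -ε) / 2)) * (q - -((1 + ε) / 2)) = q ^ 2 + q + 1 := by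
    linear_combination (-1 / 4) * hε2
  have hq : (q ^ 2 - q + 1) * (q ^ 2 + q + 1) ≠ 0 := by
    convert h1 using 1; ring
  have q1 := left_ne_zero_of_mul hq
  have q2 := right_ne_zero_of_mul hq
  have n1 := p1 ▸ q1
  have n2 := p2 ▸ q2
  have s1 := inv_quadratic_sub (left_ne_zero_of_mul n1) (right_ne_zero_of_mul n1)
  have s2 := inv_quadratic_sub (left_ne_zero_of_mul n2) (right_ne_zero_of_mul n2)
  rw [p1] at s1
  rw [p2] at s2
  have e1 : ∀ x y : ℂ, Complex.I * q / x - Complex.I * q / y =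
      Complex.I * q * (1 / x - 1 / y) := fun x y => by ring
  rw [e1, e1, s1, s2, show (1 + ε) / 2 - (1 + -ε) / 2 = ε by ring,
    show -((1 + -ε) / 2) - -((1 + ε) / 2) = ε by ring, Complex.ofReal_div,
    ofReal_one_sub_sinSub_sq, sinSubDeriv]
  push_cast
  rw [← Complex.ofReal_cos, ofReal_cos_eq, hε]
  change 2 / ((√3 : ℝ) : ℂ) * ((q ^ 2 + 1) / (2 * q)) / ((q ^ 4 + q ^ 2 + 1) / (3 * q ^ 2)) = _
  rw [show q ^ 4 + q ^ 2 + 1 = (q ^ 2 - q + 1) * (q ^ 2 + q + 1) by ring]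
  generalize hA : q ^ 2 - q + 1 = A at q1 ⊢
  generalize hB : q ^ 2 + q + 1 = B at q2 ⊢
  field_simp
  rw [Complex.I_sq, h3, ← hA, ← hB]
  ring

/-- The form is `6 tan(3θ) dθ`, with poles only at `q⁶ = -1` and `q = 0`. -/
lemma sinForm_arg_eq (hθ : cis θ ∈ Dom 12) :
    ((argDeriv 108 sinSub sinSubDeriv θ / (1 - kerArg 108 (sinSub θ)) : ℝ) : ℂ) =
      ((-2 : ℚ) : ℂ) * (((6 : ℕ) : ℂ) * cis θ ^ (6 - 1) / (cis θ ^ 6 + 1) * (Complex.I * cis θ)) +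
      ((6 : ℚ) : ℂ) * (Complex.I * cis θ / (cis θ - 0)) := by
  have h0 := cis_ne_zero θ
  obtain ⟨-, -, h1⟩ := cis_mem_factor hθ
  have e3 : cis (3 * θ) = cis θ ^ 3 := by rw [cis_pow]; norm_num
  have hc := ofReal_cos_eq (3 * θ)
  have hs := ofReal_sin_eq (3 * θ)
  rw [e3, ← pow_mul] at hc hs
  have hc0 : Real.cos (3 * θ) ≠ 0 := by
    intro h
    rw [h, Complex.ofReal_zero, eq_comm, div_eq_zero_iff] at hc
    rcases hc with hc | hc
    · exact h1 hc
    · exact pow_ne_zero 3 h0 (by simpa using hc)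
  have e : argDeriv 108 sinSub sinSubDeriv θ / (1 - kerArg 108 (sinSub θ)) =
      6 * (Real.sin (3 * θ) / Real.cos (3 * θ)) := by
    rw [argDeriv_sinSub, one_sub_kerArg_sinSub]
    field_simp
  rw [e, Complex.ofReal_mul, Complex.ofReal_div, hc, hs, sub_zero]
  norm_num
  field_simp
  ring

end Forms

lemma cis_pow_factor_root {α : ℂ} (h : α ^ 4 + α ^ 2 + 1 = 0) : α ^ 12 = 1 := by
  linear_combination (α ^ 2 - 1) * (α ^ 6 + 1) * h

/-- A single arc suffices, as every form is rational in `q` with cyclotomic poles. The hypotheses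
`hX`, `hsq` and `hsub` ask for each initial value at one end only, because the other end may be
singular. -/
theorem kernelPath_sinSub {a b : ℝ} {Λa Λb : ℝ → ℂ} (hab : a < b) (ha : 0 ≤ a) (hb : b ≤ π / 3)
    (hγ : Arc 12 a b Λa Λb cis (fun θ => Complex.I * cis θ))
    (ta : Tendsto (fun s => ‖Λa s‖) (𝓝[>] a) atTop)
    (tb : Tendsto (fun s => ‖Λb s‖) (𝓝[<] b) atTop)
    (hX : kerArg 108 (sinSub a) = 0 ∨ kerArg 108 (sinSub b) = 0)
    (hsq : ∃ L : ℝ, L ≠ 0 ∧ (Real.log L : ℂ) ∈ Zsp 12 1 ∧ (sinSub a ^ 2 = L ∨ sinSub b ^ 2 = L))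
    (hsub : ∃ L : ℝ, L ≠ 0 ∧ (Real.log L : ℂ) ∈ Zsp 12 1 ∧
      (1 - sinSub a ^ 2 = L ∨ 1 - sinSub b ^ 2 = L)) :
    ∃ D Ω Lg, KernelPath 12 108 a b D Ω Lg sinSub sinSubDeriv ∧
      (fun s => ((argDeriv 108 sinSub sinSubDeriv s / (1 - kerArg 108 (sinSub s)) : ℝ) : ℂ)) ∈ Ω := by
  have hπ := Real.pi_pos
  have hD := polyClass_of_arc (by norm_num) hab hγ ta tb
  have hU : ∀ s ∈ Set.Ioo a b, sinSub s ∈ Set.Ioo (0 : ℝ) 1 := fun s hs =>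
    sinSub_mem (by linarith [hs.1]) (by linarith [hs.2])
  have d2 : ∀ s ∈ Set.Ioo a b, 1 - sinSub s ^ 2 ≠ 0 := fun s hs => by
    nlinarith [(hU s hs).1, (hU s hs).2]
  have z0 : (0 : ℂ) = 0 ∨ (0 : ℂ) ^ 12 = 1 := Or.inl rfl
  have z1 : (1 : ℂ) = 0 ∨ (1 : ℂ) ^ 12 = 1 := Or.inr (one_pow 12)
  have z2 : (-1 : ℂ) = 0 ∨ (-1 : ℂ) ^ 12 = 1 := Or.inr (by norm_num)
  have hε : (Complex.I * (√3 : ℝ)) ^ 2 = -3 := by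
    rw [mul_pow, Complex.I_sq]
    have : ((√3 : ℝ) : ℂ) ^ 2 = 3 := by exact_mod_cast sq_sqrt_three
    rw [this]; ring
  have hε' : (-(Complex.I * (√3 : ℝ))) ^ 2 = -3 := by rw [neg_sq, hε]
  have f1 : (fun s => ((sinSubDeriv s / (1 - sinSub s ^ 2) : ℝ) : ℂ)) ∈
      PathForm 12 a b cis (fun θ => Complex.I * cis θ) :=
    PathForm.congr (Submodule.smul_mem _ (-1 / 2 : ℚ) (Submodule.add_mem _
      (Submodule.sub_mem _ (PathForm.one_div_sub_mem (Or.inr (sixthRoot_pow hε).1))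
        (PathForm.one_div_sub_mem (Or.inr (sixthRoot_pow hε').1)))
      (Submodule.sub_mem _ (PathForm.one_div_sub_mem (Or.inr (sixthRoot_pow hε').2))
        (PathForm.one_div_sub_mem (Or.inr (sixthRoot_pow hε).2)))))
      fun s hs => by
        rw [sinForm_eq rfl (hγ.mem s hs)]
        simp only [Pi.sub_apply, Pi.add_apply, Pi.smul_apply, Rat.smul_def]
  have f2 : (fun s => ((sinSubDeriv s / sinSub s : ℝ) : ℂ)) ∈
      PathForm 12 a b cis (fun θ => Complex.I * cis θ) :=
    PathForm.congr (Submodule.sub_mem _ (Submodule.add_mem _ (PathForm.one_div_sub_mem z1)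
      (PathForm.one_div_sub_mem z2)) (PathForm.one_div_sub_mem z0)) fun s hs =>
        sinForm_log_eq (hγ.mem s hs)
  have f3 : (fun s => ((sinSub s * sinSubDeriv s / (1 - sinSub s ^ 2) : ℝ) : ℂ)) ∈
      PathForm 12 a b cis (fun θ => Complex.I * cis θ) := by
    have hp : (Polynomial.X ^ 4 + Polynomial.X ^ 2 + 1 : Polynomial ℂ) ≠ 0 := by
      intro h
      have := congrArg (Polynomial.eval 0) h
      simp at this
    refine PathForm.congr (Submodule.add_mem _ (Submodule.smul_mem _ (-1 / 2 : ℚ)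
      (PathForm.logDeriv_mem hγ.mem hp fun α hα => Or.inr (cis_pow_factor_root (by simpa using hα))))
      (PathForm.one_div_sub_mem z0)) fun s hs => ?_
    rw [sinForm_log_one_sub_eq (hγ.mem s hs)]
    simp only [Pi.add_apply, Pi.smul_apply, Rat.smul_def]
    simp
    left
    congr 1
    ring
  have f4 : (fun s => ((argDeriv 108 sinSub sinSubDeriv s / (1 - kerArg 108 (sinSub s)) : ℝ) : ℂ)) ∈
      PathForm 12 a b cis (fun θ => Complex.I * cis θ) :=
    PathForm.congr (Submodule.add_mem _ (Submodule.smul_mem _ (-2 : ℚ)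
      (PathForm.logDeriv_pow_add_one_mem hγ.mem (n := 6) (by norm_num) (by norm_num)))
      (Submodule.smul_mem _ (6 : ℚ) (PathForm.one_div_sub_mem z0))) fun s hs => by
        rw [sinForm_arg_eq (hγ.mem s hs)]
        simp only [Pi.add_apply, Pi.smul_apply, Rat.smul_def]
  have lim : ∀ (f : ℝ → ℝ), Continuous f → ∀ (c L : ℝ) (S : Set ℝ), f (sinSub c) = L →
      Tendsto (fun s => f (sinSub s)) (𝓝[S] c) (𝓝 L) := by
    intro f hf c L S hL
    rw [← hL]
    exact ((hf.comp continuous_sinSub).tendsto c).mono_left nhdsWithin_le_nhds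
  have dsq : ∀ s, HasDerivAt (fun s => sinSub s ^ 2) (2 * (sinSub s * sinSubDeriv s)) s := fun s =>
    ((hasDerivAt_sinSub s).pow 2).congr_deriv (by push_cast; ring)
  have hk : Continuous (kerArg 108) := by unfold kerArg; fun_prop
  have hX1 : ∀ s ∈ Set.Ioo a b, 1 - kerArg 108 (sinSub s) ≠ 0 := by
    intro s hs
    rw [one_sub_kerArg_sinSub]
    obtain ⟨-, -, h1⟩ := cis_mem_factor (hγ.mem s hs)
    have hc := ofReal_cos_eq (3 * s)
    rw [show cis (3 * s) = cis s ^ 3 by rw [cis_pow]; norm_num, ← pow_mul] at hc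
    refine pow_ne_zero 2 fun h => ?_
    rw [h, Complex.ofReal_zero, eq_comm, div_eq_zero_iff] at hc
    rcases hc with hc | hc
    · exact h1 hc
    · exact pow_ne_zero 3 (cis_ne_zero s) (by simpa using hc)
  have hXd : ∀ s, HasDerivAt (fun s => kerArg 108 (sinSub s)) (argDeriv 108 sinSub sinSubDeriv s) s :=
    fun s => (hasDerivAt_kerArg 108 (sinSub s)).comp s (hasDerivAt_sinSub s)
  refine ⟨_, _, _, ⟨hD, by norm_num, continuous_sinSub.continuousOn, fun s _ => hasDerivAt_sinSub s,
    fun s hs => ?_, hU, fun s hs => ?_, hX.imp (lim _ hk _ _ _) (lim _ hk _ _ _), f1, f2, f3, ?_, ?_,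
    ?_⟩, f4⟩
  · have : 0 ≤ Real.cos s :=
      Real.cos_nonneg_of_mem_Icc ⟨by linarith [hs.1], by linarith [hs.2]⟩
    unfold sinSubDeriv
    positivity
  · refine lt_of_le_of_ne ?_ fun h => hX1 s hs (by rw [h, sub_self])
    rw [kerArg_sinSub]; exact Real.sin_sq_le_one _
  · obtain ⟨L, hL, hlog, hend⟩ := hsq
    refine hD.log_mem (fun s hs => pow_ne_zero 2 (hU s hs).1.ne') (fun s _ => dsq s)
      (hD.form_congr (Submodule.smul_mem _ (2 : ℚ) f2) fun s hs => ?_) hL hlog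
      (hend.imp (lim (fun u => u ^ 2) (by fun_prop) _ _ _)
        (lim (fun u => u ^ 2) (by fun_prop) _ _ _))
    have := (hU s hs).1.ne'
    simp only [Pi.smul_apply, Rat.smul_def]
    norm_cast
    field_simp
  · obtain ⟨L, hL, hlog, hend⟩ := hsub
    have h1 := hD.log_mem d2 (fun s _ => (dsq s).const_sub 1)
      (hD.form_congr (Submodule.smul_mem _ (-2 : ℚ) f3) fun s hs => by
        simp only [Pi.smul_apply, Rat.smul_def]
        norm_cast
        push_cast
        ring) hL hlog
      (hend.imp (lim (fun u => 1 - u ^ 2) (by fun_prop) _ _ _)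
        (lim (fun u => 1 - u ^ 2) (by fun_prop) _ _ _))
    refine hD.congr (Submodule.sub_mem _ h1 (hD.const (Submodule.smul_mem _ (2 : ℚ)
      (log_two_mem_Zsp (by norm_num) (by decide))))) fun s _ => ?_
    simp [Rat.smul_def]
  · refine hD.log_mem (L := 1) hX1 (fun s _ => (hXd s).const_sub 1)
      (hD.form_congr (Submodule.neg_mem _ f4) fun s hs => ?_) one_ne_zero
      (by rw [Real.log_one, Complex.ofReal_zero]; exact Submodule.zero_mem _)
      (hX.imp (fun h => lim (fun u => 1 - kerArg 108 u) (by fun_prop) _ _ _ (by simp [h]))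
        (fun h => lim (fun u => 1 - kerArg 108 u) (by fun_prop) _ _ _ (by simp [h])))
    simp only [Pi.neg_apply]
    push_cast
    ring

/-! ### Membership of the individual series -/

/-- The series `S6 a r z` converges to a cyclotomic multiple zeta value of level `N` and weight
`r + 2`. -/
def S6Mem (N r : ℕ) (z : ℝ) (a : ℕ → ℝ) : Prop :=
  Summable (fun k : ℕ => S6Term a r z (k + 1)) ∧ ((S6 a r z : ℝ) : ℂ) ∈ Zsp N (r + 2)

section S6Mem

variable {N r : ℕ} {z : ℝ} {a b : ℕ → ℝ}

lemma S6Mem.congr (ha : S6Mem N r z a) (h : ∀ k, 1 ≤ k → b k = a k) : S6Mem N r z b := by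
  have e : (fun k : ℕ => S6Term b r z (k + 1)) = fun k : ℕ => S6Term a r z (k + 1) := by
    funext k
    rw [S6Term, S6Term, h (k + 1) (by omega)]
  rw [S6Mem, S6, e]
  exact ha

lemma S6Mem.add (ha : S6Mem N r z a) (hb : S6Mem N r z b) : S6Mem N r z fun k => a k + b k := by
  have e : (fun k : ℕ => S6Term (fun k => a k + b k) r z (k + 1)) =
      fun k : ℕ => S6Term a r z (k + 1) + S6Term b r z (k + 1) := by
    funext k
    simp only [S6Term]; ring
  rw [S6Mem, S6, e, ha.1.tsum_add hb.1, Complex.ofReal_add]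
  exact ⟨ha.1.add hb.1, Submodule.add_mem _ ha.2 hb.2⟩

lemma S6Mem.smul (ha : S6Mem N r z a) (c : ℚ) : S6Mem N r z fun k => c * a k := by
  have e : (fun k : ℕ => S6Term (fun k => c * a k) r z (k + 1)) =
      fun k : ℕ => (c : ℝ) * S6Term a r z (k + 1) := by
    funext k
    simp only [S6Term]; ring
  rw [S6Mem, S6, e, tsum_mul_left, Complex.ofReal_mul]
  refine ⟨ha.1.mul_left _, ?_⟩
  have := Submodule.smul_mem _ c ha.2
  rwa [Rat.smul_def] at this

lemma HasKernel.s6Mem {f g : ℝ → ℝ} (hK : HasKernel a r z f g)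
    (h : ((∫ u in (0 : ℝ)..1, f (kerArg z u) * g u * (1 - u ^ 2)⁻¹ : ℝ) : ℂ) ∈ Zsp N (r + 2)) :
    S6Mem N r z a := by
  refine ⟨hK.1, ?_⟩
  rw [hK.2.2, Complex.ofReal_mul]
  have := Submodule.smul_mem _ (4 : ℚ) h
  rw [Rat.smul_def] at this
  exact_mod_cast this

end S6Mem

lemma ofReal_mul_one_mem {S : Submodule ℚ (ℝ → ℂ)} {f : ℝ → ℝ}
    (hf : (fun s => ((f s : ℝ) : ℂ)) ∈ S) : (fun s => ((f s * 1 : ℝ) : ℂ)) ∈ S := by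
  simpa only [mul_one] using hf

section KernelPath

variable {N : ℕ} {z a b : ℝ} {D : ℕ → Submodule ℚ (ℝ → ℂ)} {Ω Lg : Submodule ℚ (ℝ → ℂ)}
  {U U' : ℝ → ℝ} {r : ℕ}

lemma KernelPath.pserOne_mul_log_sq_mem (h : KernelPath N z a b D Ω Lg U U') (hr : 1 ≤ r) :
    (fun s => ((pserOne r (kerArg z (U s)) * Real.log (U s ^ 2) : ℝ) : ℂ)) ∈ D (r + 1) := by
  simpa only [Complex.ofReal_mul] using h.polyClass.mul (h.pserOne_mem hr) h.log_sq

lemma KernelPath.pserOne_mul_log_one_sub_sq_mem (h : KernelPath N z a b D Ω Lg U U')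
    (hr : 1 ≤ r) :
    (fun s => ((pserOne r (kerArg z (U s)) * (Real.log (1 - U s ^ 2) - 2 * Real.log 2) : ℝ) : ℂ)) ∈
      D (r + 1) := by
  simpa only [Complex.ofReal_mul] using h.polyClass.mul (h.pserOne_mem hr) h.log_one_sub_sq

end KernelPath

lemma HasKernel.s6Mem_eight {r : ℕ} {a : ℕ → ℝ} {f g : ℝ → ℝ} (hK : HasKernel a r 8 f g)
    (h : ∀ D Ω Lg, KernelPath 8 8 0 1 D Ω Lg dbl dblDeriv →
      (fun s => ((f (kerArg 8 (dbl s)) * g (dbl s) : ℝ) : ℂ)) ∈ D (r + 1)) : S6Mem 8 r 8 a := by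
  obtain ⟨D, Ω, Lg, hP⟩ := kernelPath_dbl
  refine hK.s6Mem ?_
  have := hP.integral_mem (by rw [dbl_zero]) (by rw [dbl_one]) (h D Ω Lg hP) hK.2.1
  rwa [dbl_zero, dbl_one] at this

/-- At `θ = 0` both `X` and `u` vanish, so `log u²` is normalized at the other end, where `u² =
1/3`. -/
lemma exists_kernelPath_sinSub_left : ∃ D Ω Lg,
    KernelPath 12 108 0 (π / 6) D Ω Lg sinSub sinSubDeriv ∧
    (fun s => ((argDeriv 108 sinSub sinSubDeriv s / (1 - kerArg 108 (sinSub s)) : ℝ) : ℂ)) ∈ Ω := by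
  have hπ := Real.pi_pos
  obtain ⟨h1, h2, h3⟩ := arc_cis (m := 0) zero_le_one
  have e0 : ((0 : ℕ) : ℝ) * (π / 6) = 0 := by simp
  have e1 : ((0 + 1 : ℕ) : ℝ) * (π / 6) = π / 6 := by simp
  rw [e0, e1] at h1
  rw [e0] at h2
  rw [e1] at h3
  refine kernelPath_sinSub (by positivity) le_rfl (by linarith) h1 h2 h3
    (Or.inl (by simp [sinSub_zero, kerArg])) ⟨1 / 3, by norm_num, ?_, Or.inr sinSub_pi_div_six_sq⟩
    ⟨1, one_ne_zero, ?_, Or.inl (by simp [sinSub_zero])⟩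
  · rw [one_div, Real.log_inv, Complex.ofReal_neg]
    exact Submodule.neg_mem _ log_three_mem_Zsp
  · rw [Real.log_one, Complex.ofReal_zero]; exact Submodule.zero_mem _

/-- At `θ = π/3` one has `u = 1` and `X = 0`; there `log(1-u²)` diverges and is normalized at `π/6`,
where `1 - u² = 2/3`. -/
lemma exists_kernelPath_sinSub_right : ∃ D Ω Lg,
    KernelPath 12 108 (π / 6) (π / 3) D Ω Lg sinSub sinSubDeriv ∧
    (fun s => ((argDeriv 108 sinSub sinSubDeriv s / (1 - kerArg 108 (sinSub s)) : ℝ) : ℂ)) ∈ Ω := by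
  have hπ := Real.pi_pos
  obtain ⟨h1, h2, h3⟩ := arc_cis (m := 1) le_rfl
  have e0 : ((1 : ℕ) : ℝ) * (π / 6) = π / 6 := by simp
  have e1 : ((1 + 1 : ℕ) : ℝ) * (π / 6) = π / 3 := by push_cast; ring
  rw [e0, e1] at h1
  rw [e0] at h2
  rw [e1] at h3
  refine kernelPath_sinSub (by linarith) (by positivity) le_rfl h1 h2 h3
    (Or.inr (by simp [sinSub_pi_div_three, kerArg]))
    ⟨1, one_ne_zero, ?_, Or.inr (by simp [sinSub_pi_div_three])⟩
    ⟨2 / 3, by norm_num, ?_, Or.inl (by rw [sinSub_pi_div_six_sq]; norm_num)⟩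
  · rw [Real.log_one, Complex.ofReal_zero]; exact Submodule.zero_mem _
  · rw [Real.log_div (by norm_num) (by norm_num), Complex.ofReal_sub]
    exact Submodule.sub_mem _ (log_two_mem_Zsp (by norm_num) (by decide)) log_three_mem_Zsp

lemma HasKernel.s6Mem_twelve {r : ℕ} {a : ℕ → ℝ} {f g : ℝ → ℝ} (hK : HasKernel a r 108 f g)
    (h : ∀ (x y : ℝ) (D : ℕ → Submodule ℚ (ℝ → ℂ)) (Ω Lg : Submodule ℚ (ℝ → ℂ)),
      KernelPath 12 108 x y D Ω Lg sinSub sinSubDeriv →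
      (fun s => ((argDeriv 108 sinSub sinSubDeriv s / (1 - kerArg 108 (sinSub s)) : ℝ) : ℂ)) ∈ Ω →
      (fun s => ((f (kerArg 108 (sinSub s)) * g (sinSub s) : ℝ) : ℂ)) ∈ D (r + 1)) :
    S6Mem 12 r 108 a := by
  have hπ := Real.pi_pos
  obtain ⟨D₁, Ω₁, Lg₁, h1, h1'⟩ := exists_kernelPath_sinSub_left
  obtain ⟨D₂, Ω₂, Lg₂, h2, h2'⟩ := exists_kernelPath_sinSub_right
  obtain ⟨m0, m1⟩ := sinSub_mem (θ := π / 6) (by positivity) (by linarith)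
  have i1 := h1.integral_mem (by rw [sinSub_zero]) m1.le (h _ _ _ _ _ h1 h1') hK.2.1
  have i2 := h2.integral_mem m0.le (by rw [sinSub_pi_div_three]) (h _ _ _ _ _ h2 h2') hK.2.1
  rw [sinSub_zero] at i1
  rw [sinSub_pi_div_three] at i2
  refine hK.s6Mem ?_
  have hmem : sinSub (π / 6) ∈ Set.uIcc (0 : ℝ) 1 := by
    rw [Set.uIcc_of_le zero_le_one]; exact ⟨m0.le, m1.le⟩
  have := Submodule.add_mem _ i1 i2
  rwa [← Complex.ofReal_add, intervalIntegral.integral_add_adjacent_intervals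
    (hK.2.1.mono_set (Set.uIcc_subset_uIcc_left hmem))
    (hK.2.1.mono_set (Set.uIcc_subset_uIcc_right hmem))] at this

section

variable {r : ℕ}

lemma s6Mem_eight_inv (hr : 1 ≤ r) : S6Mem 8 r 8 fun k => 1 / (k : ℝ) :=
  (hasKernel_inv hr (by norm_num) (by norm_num)).s6Mem_eight fun _ _ _ hP =>
    ofReal_mul_one_mem (hP.pserOne_mem (by omega))

lemma s6Mem_eight_log_sq (hr : 1 ≤ r) :
    S6Mem 8 r 8 fun k => -Hn k + 2 * Hn (2 * k) + Hn (3 * k) - 2 * Hn (6 * k) :=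
  (hasKernel_log_sq hr (by norm_num) (by norm_num)).s6Mem_eight fun _ _ _ hP =>
    hP.pserOne_mul_log_sq_mem hr

lemma s6Mem_eight_log_one_sub_sq (hr : 1 ≤ r) :
    S6Mem 8 r 8 fun k => Hn (2 * k - 1) + Hn (3 * k) - 2 * Hn (6 * k) :=
  (hasKernel_log_one_sub_sq hr (by norm_num) (by norm_num)).s6Mem_eight fun _ _ _ hP =>
    hP.pserOne_mul_log_one_sub_sq_mem hr

lemma s6Mem_twelve_inv (hr : 1 ≤ r) : S6Mem 12 r 108 fun k => 1 / (k : ℝ) :=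
  (hasKernel_inv hr (by norm_num) (by norm_num)).s6Mem_twelve fun _ _ _ _ _ hP _ =>
    ofReal_mul_one_mem (hP.pserOne_mem (by omega))

lemma s6Mem_twelve_Hn (hr : 1 ≤ r) : S6Mem 12 r 108 Hn :=
  (hasKernel_Hn hr (by norm_num) (by norm_num)).s6Mem_twelve fun _ _ _ _ _ hP hω =>
    ofReal_mul_one_mem (hP.pserHn_mem hω hr)

lemma s6Mem_twelve_log_sq (hr : 1 ≤ r) :
    S6Mem 12 r 108 fun k => -Hn k + 2 * Hn (2 * k) + Hn (3 * k) - 2 * Hn (6 * k) :=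
  (hasKernel_log_sq hr (by norm_num) (by norm_num)).s6Mem_twelve fun _ _ _ _ _ hP _ =>
    hP.pserOne_mul_log_sq_mem hr

lemma s6Mem_twelve_log_one_sub_sq (hr : 1 ≤ r) :
    S6Mem 12 r 108 fun k => Hn (2 * k - 1) + Hn (3 * k) - 2 * Hn (6 * k) :=
  (hasKernel_log_one_sub_sq hr (by norm_num) (by norm_num)).s6Mem_twelve fun _ _ _ _ _ hP _ =>
    hP.pserOne_mul_log_one_sub_sq_mem hr

lemma Hn_two_mul {k : ℕ} (hk : 1 ≤ k) : Hn (2 * k) = Hn (2 * k - 1) + 1 / 2 * (1 / (k : ℝ)) := by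
  obtain ⟨n, rfl⟩ : ∃ n, k = n + 1 := ⟨k - 1, by omega⟩
  rw [show 2 * (n + 1) - 1 = 2 * n + 1 by omega, show 2 * (n + 1) = (2 * n + 1) + 1 by ring, Hn_succ]
  push_cast
  have h : (n : ℝ) + 1 ≠ 0 := by positivity
  rw [show 2 * (n : ℝ) + 1 + 1 = 2 * (n + 1) by ring]
  field_simp

/-- The difference of the two logarithmic kernels is `-H_k + 2H_{2k} - H_{2k-1}`, which equals `-H_k
+ H_{2k} + 1/(2k)`; the series for `H_k` and `1/k` remove the other terms. -/
lemma s6Mem_twelve_Hn_two_mul (hr : 1 ≤ r) : S6Mem 12 r 108 fun k => Hn (2 * k) := by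
  refine (((s6Mem_twelve_log_sq hr).add ((s6Mem_twelve_log_one_sub_sq hr).smul (-1))).add
    ((s6Mem_twelve_Hn hr).add ((s6Mem_twelve_inv hr).smul (-1 / 2)))).congr fun k hk => ?_
  have := Hn_two_mul hk
  push_cast
  linarith

lemma s6Mem_twelve_Hn_three_mul_sub (hr : 1 ≤ r) :
    S6Mem 12 r 108 fun k => Hn (3 * k) - 2 * Hn (6 * k) := by
  refine (((s6Mem_twelve_log_one_sub_sq hr).add ((s6Mem_twelve_Hn_two_mul hr).smul (-1))).add
    ((s6Mem_twelve_inv hr).smul (1 / 2))).congr fun k hk => ?_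
  have := Hn_two_mul hk
  push_cast
  linarith

end

end

theorem mainTheorem6 (r : ℕ) (hr : 1 ≤ r) :
    (∀ a ∈ ({fun k : ℕ => 1 / (k : ℝ),
          fun k : ℕ => -Hn k + 2 * Hn (2 * k) + Hn (3 * k) - 2 * Hn (6 * k),
          fun k : ℕ => Hn (2 * k - 1) + Hn (3 * k) - 2 * Hn (6 * k)} : Set (ℕ → ℝ)),
        Summable (fun k : ℕ => S6Term a r (2 ^ 3) (k + 1)) ∧
        ((S6 a r (2 ^ 3) : ℝ) : ℂ) ∈ CMZV (r + 2) 8) ∧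
    (∀ a ∈ ({fun k : ℕ => 1 / (k : ℝ),
          fun k : ℕ => Hn (3 * k) - 2 * Hn (6 * k),
          fun k : ℕ => Hn (2 * k),
          fun k : ℕ => Hn k} : Set (ℕ → ℝ)),
        Summable (fun k : ℕ => S6Term a r (2 ^ 2 * 3 ^ 3) (k + 1)) ∧
        ((S6 a r (2 ^ 2 * 3 ^ 3) : ℝ) : ℂ) ∈ CMZV (r + 2) 12) := by
  rw [show (2 : ℝ) ^ 3 = 8 by norm_num, show (2 : ℝ) ^ 2 * 3 ^ 3 = 108 by norm_num]
  have lift : ∀ {N : ℕ} {z : ℝ} {a : ℕ → ℝ}, S6Mem N r z a →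
      Summable (fun k : ℕ => S6Term a r z (k + 1)) ∧ ((S6 a r z : ℝ) : ℂ) ∈ CMZV (r + 2) N :=
    fun h => ⟨h.1, Zsp_le_CMZV _ _ h.2⟩
  constructor
  · rintro a (rfl | rfl | rfl)
    · exact lift (s6Mem_eight_inv hr)
    · exact lift (s6Mem_eight_log_sq hr)
    · exact lift (s6Mem_eight_log_one_sub_sq hr)
  · rintro a (rfl | rfl | rfl | rfl)
    · exact lift (s6Mem_twelve_inv hr)
    · exact lift (s6Mem_twelve_Hn_three_mul_sub hr)
    · exact lift (s6Mem_twelve_Hn_two_mul hr)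
    · exact lift (s6Mem_twelve_Hn hr)
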